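/- Let $L$ be a fixed integer, let $(M(N))_{N\ge 1}$ be integers such that $c_N = M(N)L/N \to c_* > 0$ as $N\to\infty$ (so that $M=M(N)\to\infty$), and let $R_N$ be Hermitian $M\times M$ matrices with $aI \le R_N < bI$ for all $N\ge1$, where $a,b>0$ do not depend on $N$. Let $\lambda_{1,N}\ge\dots\ge\lambda_{M,N}$ be the eigenvalues of $R_N$. For $z\in\mathbb{C}^+$ let $t_N(z)$ be the solution of $$t_N(z)=\frac1M\mathrm{Tr}\,R_N T_N(z),\qquad T_N(z)=\Big(-zI-\frac{z c_N t_N(z)}{1-z c_N^2 t_N(z)^2}R_N\Big)^{-1},$$ such that $t_N(z)\in\mathbb{C}^+$ and $z t_N(z)\in\mathbb{C}^+$. Let $\mu_N$ be the finite positive measure carried by $[0,\infty)$ with Stieltjes transform $\int\frac{d\mu_N(x)}{x-z}=t_N(z)$, and let $\nu_N$ be the one with Stieltjes transform $\frac1M\mathrm{Tr}\,T_N(z)$. Put $$\phi_N(w)=c_N w^2\,\frac1M\mathrm{Tr}R_N(R_N-wI)^{-1}\Big(c_N\frac1M\mathrm{Tr}R_N(R_N-wI)^{-1}-1\Big).$$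 Assume that there is $\kappa>0$ such that for all $N$ large enough $$|\lambda_{k,N}-\lambda_{l,N}|\le\kappa\Big(\frac{|k-l|}{M}\Big)^{1/2}\qquad\text{for all }1\le k\le l\le M.$$ Then, for all $N$ (equivalently, all $M$) large enough, $\phi_N'$ has a unique zero $w_{+,N}$ in $(\lambda_{1,N},\infty)$ and, with $x_{+,N}=\phi_N(w_{+,N})$: - if $c_N\le 1$, then the supports of $\mu_N$ and of $\nu_N$ are both equal to $\mathcal S_N=[0,x_{+,N}]$; - if $c_N>1$, then $\frac1M\mathrm{Tr}R_N(R_N-\omega I)^{-1}=1/c_N$ has a smallest real root $\omega_{1,N}<0$, $\phi_N'$ has a unique zero $w_{-,N}$ in $(\omega_{1,N},0)$, the point $x_{-,N}=\phi_N(w_{-,N})$ satisfies $0<x_{-,N}<x_{+,N}$, and the supports of $\mu_N$ and of $\nu_N$ are both equal to $\mathcal S_N=\{0\}\cup[x_{-,N},x_{+,N}]$. -/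

import Mathlib

open MeasureTheory Filter Topology
open scoped ComplexOrder

noncomputable section

namespace AutocovSupport

/-- The Stieltjes transform `z ↦ ∫ dμ(x) / (x - z)` of a measure on the real line. -/
def stieltjes (μ : Measure ℝ) (z : ℂ) : ℂ := resolventTransform μ z

theorem stieltjes_eq_integral (μ : Measure ℝ) (z : ℂ) :
    stieltjes μ z = ∫ x : ℝ, ((x : ℂ) - z)⁻¹ ∂μ := by
  simp [stieltjes, resolventTransform_apply, resolvent]

/-- The normalized trace `(1/m) Tr A` of an `m × m` matrix. -/
def ntr {m : ℕ} (A : Matrix (Fin m) (Fin m) ℂ) : ℂ := (1 / (m : ℂ)) * A.trace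

/-- The matrix `(-z I - (z c t / (1 - z c² t²)) R)⁻¹`. -/
def resolventT {m : ℕ} (R : Matrix (Fin m) (Fin m) ℂ) (c : ℝ) (z t : ℂ) :
    Matrix (Fin m) (Fin m) ℂ :=
  (-(z • (1 : Matrix (Fin m) (Fin m) ℂ))
    - ((z * (c : ℂ) * t) / (1 - z * (c : ℂ) ^ 2 * t ^ 2)) • R)⁻¹

/-- `t` is an admissible solution at `z` of the canonical equation
`t = (1/m) Tr R (-z I - (z c t / (1 - z c² t²)) R)⁻¹`, that is, one for which
both `t` and `z t` lie in the open upper half-plane. -/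
def IsCanonicalSolution {m : ℕ} (R : Matrix (Fin m) (Fin m) ℂ) (c : ℝ) (z t : ℂ) : Prop :=
  0 < t.im ∧ 0 < (z * t).im ∧ t = ntr (R * resolventT R c z t)

/-- `μ` is a finite positive measure carried by `[0, ∞)` whose Stieltjes transform is, at every
point of the open upper half-plane, the admissible solution of the canonical equation. -/
def IsMu {m : ℕ} (R : Matrix (Fin m) (Fin m) ℂ) (c : ℝ) (μ : Measure ℝ) : Prop :=
  IsFiniteMeasure μ ∧ μ (Set.Iio 0) = 0 ∧
    ∀ z : ℂ, 0 < z.im → IsCanonicalSolution R c z (stieltjes μ z)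

open Classical in
/-- The measure whose Stieltjes transform is the admissible solution of the canonical equation
(the zero measure if there were none). -/
def mu {m : ℕ} (R : Matrix (Fin m) (Fin m) ℂ) (c : ℝ) : Measure ℝ :=
  if h : ∃ μ : Measure ℝ, IsMu R c μ then h.choose else 0

/-- The function `t(z)`, the Stieltjes transform of `mu R c`. -/
def tfun {m : ℕ} (R : Matrix (Fin m) (Fin m) ℂ) (c : ℝ) (z : ℂ) : ℂ := stieltjes (mu R c) z

/-- `ν` is a finite positive measure carried by `[0, ∞)` with Stieltjes transform
`(1/m) Tr T(z)`, where `T(z) = (-z I - (z c t(z) / (1 - z c² t(z)²)) R)⁻¹`. -/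
def IsNu {m : ℕ} (R : Matrix (Fin m) (Fin m) ℂ) (c : ℝ) (ν : Measure ℝ) : Prop :=
  IsFiniteMeasure ν ∧ ν (Set.Iio 0) = 0 ∧
    ∀ z : ℂ, 0 < z.im → stieltjes ν z = ntr (resolventT R c z (tfun R c z))

open Classical in
/-- The deterministic equivalent: the measure with Stieltjes transform `(1/m) Tr T(z)`
(the zero measure if there were none). -/
def nu {m : ℕ} (R : Matrix (Fin m) (Fin m) ℂ) (c : ℝ) : Measure ℝ :=
  if h : ∃ ν : Measure ℝ, IsNu R c ν then h.choose else 0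

/-- The real number `(1/m) Tr R (R - w I)⁻¹`, for Hermitian `R` and real `w`. -/
def rtr {m : ℕ} (R : Matrix (Fin m) (Fin m) ℂ) (w : ℝ) : ℝ :=
  (ntr (R * (R - (w : ℂ) • (1 : Matrix (Fin m) (Fin m) ℂ))⁻¹)).re

/-- `φ(w) = c w² · (1/m) Tr R (R - w I)⁻¹ · (c (1/m) Tr R (R - w I)⁻¹ - 1)`. -/
def phi {m : ℕ} (R : Matrix (Fin m) (Fin m) ℂ) (c : ℝ) (w : ℝ) : ℝ :=
  c * w ^ 2 * rtr R w * (c * rtr R w - 1)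

/-- `w` is a zero of `φ'` to the right of all the eigenvalues of `R`. -/
def IsWPlus {m : ℕ} {R : Matrix (Fin m) (Fin m) ℂ} (hR : R.IsHermitian) (c : ℝ) (w : ℝ) : Prop :=
  (∀ k, hR.eigenvalues₀ k < w) ∧ deriv (phi R c) w = 0

/-- `w` is a zero of `φ'` in `(ω₁, 0)`, where `ω₁` is the smallest real root of
`(1/m) Tr R (R - ω I)⁻¹ = 1 / c`. -/
def IsWMinus {m : ℕ} (R : Matrix (Fin m) (Fin m) ℂ) (c : ℝ) (w : ℝ) : Prop :=
  (∃ ω₁ : ℝ, IsLeast {ω : ℝ | rtr R ω = 1 / c} ω₁ ∧ ω₁ < w) ∧ w < 0 ∧ deriv (phi R c) w = 0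

/-- `x` is the point `x₊ = φ(w₊)`, with `w₊` the unique zero of `φ'` to the right of all the
eigenvalues of `R`. -/
def IsXPlus {m : ℕ} {R : Matrix (Fin m) (Fin m) ℂ} (hR : R.IsHermitian) (c : ℝ) (x : ℝ) : Prop :=
  ∃ w : ℝ, IsWPlus hR c w ∧ (∀ w' : ℝ, IsWPlus hR c w' → w' = w) ∧ x = phi R c w

/-- `x` is the point `x₋ = φ(w₋)`, with `w₋` the unique zero of `φ'` in `(ω₁, 0)`. -/
def IsXMinus {m : ℕ} (R : Matrix (Fin m) (Fin m) ℂ) (c : ℝ) (x : ℝ) : Prop :=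
  ∃ w : ℝ, IsWMinus R c w ∧ (∀ w' : ℝ, IsWMinus R c w' → w' = w) ∧ x = phi R c w

end AutocovSupport

end

/-! Write `l` for the eigenvalues and `f(w) = (1/M) ∑ l/(l - w)`. The substitution `w = z c t - 1/(c
t)` turns the canonical equation into `φ(w) = z` with `Im w > 0` and `(c/M) ∑ l²/|l - w|² < 1`. The
transforms of μ and ν, multiplied by `z`, become `w f(w)` and `f(w) - 1`.

The support is read off from real values of `w`. Off the support, letting `z → x` yields a real `w`,
not an eigenvalue, with `φ(w) = x` and `(c/M) ∑ (l/(l - w))² ≤ 1` (`WRep.exists_real`). Conversely,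
if `x > 0` equals `φ(w)` at a real point where this sum is `< 1` and `φ' > 0`, local inversion shows
that `x` is off the support (`WRep.notMem_support`).

The spacing condition excludes every `w` between two eigenvalues. An eigenvalue `i` places away from
`w` is at distance at most `κ (i/M)^(1/2)`, so `(1/M) ∑ (l/(l - w))²` dominates a multiple of a
harmonic sum and exceeds `1/c` for large `M` (`sum_inv_sq_ge`, `outsideOnly_of_spacing`). What
remains is the behaviour of `φ` on the two outer half-lines: to the right it decreases and then
increases from `x₊` to infinity (`exists_wplus`); to the left it is negative if `c ≤ 1`, and takes
positive values up to `x₋` if `c > 1` (`exists_wminus`).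

Existence and uniqueness of `t` are proved in the variables `ζ = √z`, `m = ζ c t`, where the
equation is the fixed-point equation of `sqrtMap`. Iterates from `0` are built from transforms of
finite atomic measures; vague limits and the identity theorem give a solution
(`exists_sqrt_measures`), Cauchy–Schwarz gives uniqueness (`sqrtMap_unique`), and squaring the real
line returns to `z`. -/

noncomputable section
namespace AutocovSupport

/-! ### Stieltjes transforms of finite atomic measures and their closure properties. -/

/-- `g` is, on the upper half-plane, the Stieltjes transform of a finitely supported positive
measure of total mass `P`. -/
def IsAtomic (P : ℝ) (g : ℂ → ℂ) : Prop :=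
  ∃ (d : ℕ) (p x : Fin d → ℝ), (∀ i, 0 ≤ p i) ∧ ∑ i, p i = P ∧
    ∀ ζ : ℂ, 0 < ζ.im → g ζ = ∑ i, (p i : ℂ) / ((x i : ℂ) - ζ)

theorem ofReal_sub_ne_zero (x : ℝ) {ζ : ℂ} (h : 0 < ζ.im) : (x : ℂ) - ζ ≠ 0 := by
  intro h0
  have := congrArg Complex.im h0
  simp at this
  linarith

theorem im_ofReal_div_sub (p x : ℝ) (ζ : ℂ) :
    ((p : ℂ) / ((x : ℂ) - ζ)).im = p * ζ.im / Complex.normSq ((x : ℂ) - ζ) := by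
  rw [Complex.div_im]
  simp
  ring

theorem isAtomic_of_fintype {ι : Type*} [Fintype ι] {P : ℝ} {g : ℂ → ℂ} (p x : ι → ℝ)
    (hp : ∀ i, 0 ≤ p i) (hP : ∑ i, p i = P)
    (hg : ∀ ζ : ℂ, 0 < ζ.im → g ζ = ∑ i, (p i : ℂ) / ((x i : ℂ) - ζ)) : IsAtomic P g := by
  refine ⟨Fintype.card ι, fun i => p ((Fintype.equivFin ι).symm i),
    fun i => x ((Fintype.equivFin ι).symm i), fun i => hp _, ?_, fun ζ hζ => ?_⟩
  · rw [← hP]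
    exact Equiv.sum_comp (Fintype.equivFin ι).symm p
  · rw [hg ζ hζ]
    exact (Equiv.sum_comp (Fintype.equivFin ι).symm (fun i => (p i : ℂ) / ((x i : ℂ) - ζ))).symm

theorem IsAtomic.zero : IsAtomic 0 (fun _ => 0) :=
  isAtomic_of_fintype (ι := Empty) (fun _ => 0) (fun _ => 0) (by simp) (by simp) (by simp)

theorem IsAtomic.add {P Q : ℝ} {f g : ℂ → ℂ} (hf : IsAtomic P f) (hg : IsAtomic Q g) :
    IsAtomic (P + Q) (fun ζ => f ζ + g ζ) := by
  obtain ⟨d, p, x, hp, hP, hf⟩ := hf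
  obtain ⟨e, q, y, hq, hQ, hg⟩ := hg
  refine isAtomic_of_fintype (ι := Fin d ⊕ Fin e) (Sum.elim p q) (Sum.elim x y) ?_ ?_ ?_
  · rintro (i | i) <;> simp [hp, hq]
  · simp [hP, hQ]
  · intro ζ hζ
    simp [hf ζ hζ, hg ζ hζ]

theorem IsAtomic.smul {P : ℝ} {f : ℂ → ℂ} (hf : IsAtomic P f) {r : ℝ} (hr : 0 ≤ r) :
    IsAtomic (r * P) (fun ζ => (r : ℂ) * f ζ) := by
  obtain ⟨d, p, x, hp, hP, hf⟩ := hf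
  refine ⟨d, fun i => r * p i, x, fun i => mul_nonneg hr (hp i), ?_, fun ζ hζ => ?_⟩
  · rw [← Finset.mul_sum, hP]
  · beta_reduce
    rw [hf ζ hζ, Finset.mul_sum]
    exact Finset.sum_congr rfl fun i _ => by push_cast; ring

theorem IsAtomic.sum {ι : Type*} (s : Finset ι) {P : ι → ℝ} {f : ι → ℂ → ℂ}
    (h : ∀ i ∈ s, IsAtomic (P i) (f i)) :
    IsAtomic (∑ i ∈ s, P i) (fun ζ => ∑ i ∈ s, f i ζ) := by
  classical
  induction s using Finset.induction_on with
  | empty => simpa using IsAtomic.zero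
  | insert a s ha ih =>
    simp only [Finset.sum_insert ha]
    exact (h a (by simp)).add (ih fun i hi => h i (by simp [hi]))

theorem IsAtomic.congr {P Q : ℝ} {f g : ℂ → ℂ} (hf : IsAtomic P f) (hPQ : P = Q)
    (hfg : ∀ ζ : ℂ, 0 < ζ.im → g ζ = f ζ) : IsAtomic Q g := by
  obtain ⟨d, p, x, hp, hP, hf⟩ := hf
  exact ⟨d, p, x, hp, hP.trans hPQ, fun ζ hζ => (hfg ζ hζ).trans (hf ζ hζ)⟩

theorem IsAtomic.im_nonneg {P : ℝ} {f : ℂ → ℂ} (hf : IsAtomic P f) {ζ : ℂ} (hζ : 0 < ζ.im) :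
    0 ≤ (f ζ).im := by
  obtain ⟨d, p, x, hp, hP, hf⟩ := hf
  rw [hf ζ hζ, Complex.im_sum]
  refine Finset.sum_nonneg fun i _ => ?_
  rw [im_ofReal_div_sub]
  exact div_nonneg (mul_nonneg (hp i) hζ.le) (Complex.normSq_nonneg _)

/-- The zero measure has to be admitted because the iteration starts at `0`; in both cases `1 ± f`
cannot vanish. -/
theorem IsAtomic.im_pos_or {P : ℝ} {f : ℂ → ℂ} (hf : IsAtomic P f) {ζ : ℂ} (hζ : 0 < ζ.im) :
    0 < (f ζ).im ∨ f ζ = 0 := by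
  obtain ⟨d, p, x, hp, hP, hf⟩ := hf
  by_cases h : ∃ i, p i ≠ 0
  · left
    obtain ⟨i, hi⟩ := h
    rw [hf ζ hζ, Complex.im_sum]
    refine Finset.sum_pos' (fun i _ => ?_) ⟨i, Finset.mem_univ _, ?_⟩ <;> rw [im_ofReal_div_sub]
    · exact div_nonneg (mul_nonneg (hp i) hζ.le) (Complex.normSq_nonneg _)
    · exact div_pos (mul_pos (lt_of_le_of_ne (hp i) hi.symm) hζ)
        (Complex.normSq_pos.2 (ofReal_sub_ne_zero _ hζ))
  · right
    push Not at h
    rw [hf ζ hζ]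
    simp [h]

/-- Diagonal matrix elements of the resolvent of a symmetric operator are Stieltjes transforms. -/
theorem isAtomic_of_isSymmetric {E : Type*} [NormedAddCommGroup E] [InnerProductSpace ℂ E]
    [FiniteDimensional ℂ E] {T : E →ₗ[ℂ] E} (hT : T.IsSymmetric) (e : E) (y : ℂ → E)
    (hy : ∀ ζ : ℂ, 0 < ζ.im → T (y ζ) - ζ • y ζ = e) :
    IsAtomic (‖e‖ ^ 2) (fun ζ => inner ℂ e (y ζ)) := by
  set b := hT.eigenvectorBasis rfl
  set d := hT.eigenvalues rfl
  refine ⟨_, fun i => ‖inner ℂ (b i) e‖ ^ 2, d, fun i => by positivity,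
    b.sum_sq_norm_inner_right e, fun ζ hζ => ?_⟩
  beta_reduce
  rw [← b.sum_inner_mul_inner e (y ζ)]
  refine Finset.sum_congr rfl fun i _ => ?_
  -- This is the component of the resolvent equation along the `i`-th eigenvector.
  have h1 : inner ℂ (b i) e = ((d i : ℂ) - ζ) * inner ℂ (b i) (y ζ) := by
    conv_lhs => rw [← hy ζ hζ]
    rw [inner_sub_right, ← hT, hT.apply_eigenvectorBasis, inner_smul_left, inner_smul_right]
    simp [d, b]
    ring
  rw [eq_div_iff (ofReal_sub_ne_zero _ hζ), mul_assoc, mul_comm (inner ℂ (b i) (y ζ)), ← h1,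
    ← inner_conj_symm e (b i), mul_comm, Complex.mul_conj, Complex.normSq_eq_norm_sq]

/-- Rank-one perturbation: with `v i = √(p i)`, `m` is the matrix element at `v` of the resolvent of
`diag x`, and `m / (1 + s m)` is that of `diag x + s v vᵀ` (Sherman–Morrison). The mass is `‖v‖² =
P` in both cases. -/
theorem IsAtomic.div_one_add {P : ℝ} {m : ℂ → ℂ} (hm : IsAtomic P m) (s : ℝ)
    (hs : s = 1 ∨ s = -1) : IsAtomic P (fun ζ => m ζ / (1 + s * m ζ)) := by
  have hne : ∀ ζ : ℂ, 0 < ζ.im → 1 + (s : ℂ) * m ζ ≠ 0 := by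
    intro ζ hζ h0
    rcases hm.im_pos_or hζ with h | h
    · have := congrArg Complex.im h0
      rcases hs with rfl | rfl <;> simp at this <;> linarith
    · simp [h] at h0
  obtain ⟨d, p, x, hp, hP, hf⟩ := hm
  set v : Fin d → ℂ := fun i => (Real.sqrt (p i) : ℂ)
  have hv : ∀ i, v i * v i = p i := fun i => by
    simp only [v, ← Complex.ofReal_mul, Real.mul_self_sqrt (hp i)]
  have hvc : ∀ i, (starRingEnd ℂ) (v i) = v i := fun i => Complex.conj_ofReal _
  set A : Matrix (Fin d) (Fin d) ℂ := Matrix.diagonal (fun i => (x i : ℂ)) +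
    (s : ℂ) • Matrix.of (fun i j => v i * v j)
  have hA : A.IsHermitian := by
    ext i j
    simp [A, Matrix.diagonal_apply, hvc]
    by_cases h : i = j
    · subst h; simp
    · simp [h, Ne.symm h, mul_comm]
  set e : EuclideanSpace ℂ (Fin d) := WithLp.toLp 2 v
  set y : ℂ → EuclideanSpace ℂ (Fin d) := fun ζ =>
    WithLp.toLp 2 fun i => v i / (((x i : ℂ) - ζ) * (1 + s * m ζ))
  have hsum : ∀ ζ : ℂ, 0 < ζ.im → ∑ i, v i * (v i / (((x i : ℂ) - ζ) * (1 + s * m ζ)))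
      = m ζ / (1 + s * m ζ) := by
    intro ζ hζ
    conv_rhs => rw [hf ζ hζ]
    rw [Finset.sum_div, ← hf ζ hζ]
    refine Finset.sum_congr rfl fun i _ => ?_
    rw [← hv i]
    field_simp
  have := isAtomic_of_isSymmetric (Matrix.isSymmetric_toEuclideanLin_iff.2 hA) e y ?_
  · refine this.congr ?_ fun ζ hζ => ?_
    · rw [EuclideanSpace.norm_sq_eq, ← hP]
      refine Finset.sum_congr rfl fun i _ => ?_
      simp [e, v, Real.sq_sqrt (hp i)]
    · rw [← hsum ζ hζ, PiLp.inner_apply]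
      refine Finset.sum_congr rfl fun i _ => ?_
      simp [e, y, hvc, mul_comm]
  · intro ζ hζ
    ext i
    have h1 := ofReal_sub_ne_zero (x i) hζ
    have h2 := hne ζ hζ
    have : (A.mulVec (fun i => v i / (((x i : ℂ) - ζ) * (1 + s * m ζ)))) i =
        x i * (v i / (((x i : ℂ) - ζ) * (1 + s * m ζ))) + s * (v i * (m ζ / (1 + s * m ζ))) := by
      rw [← hsum ζ hζ, Finset.mul_sum, Finset.mul_sum]
      simp [A, Matrix.mulVec, dotProduct, Matrix.diagonal_apply, add_mul, Finset.sum_add_distrib,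
        mul_assoc]
    simp [y, e, Matrix.toLpLin_apply, this]
    field_simp
    ring

/-- Schur complement: this is the corner entry of the resolvent of `diag x` bordered by `v = √p`,
with corner `0`. The unit corner vector gives mass `1`. -/
theorem IsAtomic.inv_neg_sub {P : ℝ} {m : ℂ → ℂ} (hm : IsAtomic P m) :
    IsAtomic 1 (fun ζ => 1 / (-ζ - m ζ)) := by
  have hne : ∀ ζ : ℂ, 0 < ζ.im → -ζ - m ζ ≠ 0 := by
    intro ζ hζ h0
    have h := hm.im_nonneg hζ
    have := congrArg Complex.im h0
    simp at this
    linarith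
  obtain ⟨d, p, x, hp, hP, hf⟩ := hm
  set v : Fin d → ℂ := fun i => (Real.sqrt (p i) : ℂ)
  have hv : ∀ i, v i * v i = p i := fun i => by
    simp only [v, ← Complex.ofReal_mul, Real.mul_self_sqrt (hp i)]
  have hvc : ∀ i, (starRingEnd ℂ) (v i) = v i := fun i => Complex.conj_ofReal _
  set A : Matrix (Unit ⊕ Fin d) (Unit ⊕ Fin d) ℂ := Matrix.fromBlocks 0
    (Matrix.of fun _ j => v j) (Matrix.of fun i _ => v i) (Matrix.diagonal (fun i => (x i : ℂ)))
  have hA : A.IsHermitian := by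
    refine Matrix.IsHermitian.fromBlocks (by simp) ?_ ?_
    · ext i j; simp [hvc]
    · ext i j
      simp [Matrix.diagonal_apply]
      by_cases h : i = j
      · subst h; simp
      · simp [h, Ne.symm h]
  set e : EuclideanSpace ℂ (Unit ⊕ Fin d) := WithLp.toLp 2 (Sum.elim 1 0)
  set Y : ℂ → Unit ⊕ Fin d → ℂ := fun ζ => Sum.elim (fun _ => 1 / (-ζ - m ζ))
      fun i => - v i * (1 / (-ζ - m ζ)) / ((x i : ℂ) - ζ)
  set y : ℂ → EuclideanSpace ℂ (Unit ⊕ Fin d) := fun ζ => WithLp.toLp 2 (Y ζ)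
  have hsum : ∀ ζ : ℂ, 0 < ζ.im → ∑ i, v i * (- v i * (1 / (-ζ - m ζ)) / ((x i : ℂ) - ζ))
      = - m ζ * (1 / (-ζ - m ζ)) := by
    intro ζ hζ
    generalize 1 / (-ζ - m ζ) = r
    rw [hf ζ hζ, neg_mul, Finset.sum_mul, ← Finset.sum_neg_distrib]
    refine Finset.sum_congr rfl fun i _ => ?_
    rw [← hv i]
    ring
  have := isAtomic_of_isSymmetric (Matrix.isSymmetric_toEuclideanLin_iff.2 hA) e y ?_
  · refine this.congr ?_ fun ζ hζ => ?_
    · rw [EuclideanSpace.norm_sq_eq]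
      simp [e]
    · rw [PiLp.inner_apply]
      simp [e, y, Y]
  · intro ζ hζ
    have h2 := hne ζ hζ
    ext i
    rcases i with i | i
    · have : (A.mulVec (Y ζ)) (Sum.inl i) = - m ζ * (1 / (-ζ - m ζ)) := by
        rw [← hsum ζ hζ]
        simp [A, Matrix.mulVec, dotProduct, Y]
      simp [y, e, Matrix.toLpLin_apply, this]
      simp [Y]
      field_simp
      ring
    · have h1 := ofReal_sub_ne_zero (x i) hζ
      have : (A.mulVec (Y ζ)) (Sum.inr i) = v i * (1 / (-ζ - m ζ)) +
         x i * (- v i * (1 / (-ζ - m ζ)) / ((x i : ℂ) - ζ)) := by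
        simp [A, Matrix.mulVec, dotProduct, Y, Matrix.diagonal_apply]
      simp [y, e, Matrix.toLpLin_apply, this]
      simp [Y]
      field_simp
      ring

/-! ### Vague limits of atomic measures. -/

theorem continuous_resolvent_kernel {ζ : ℂ} (hζ : 0 < ζ.im) :
    Continuous fun y : ℝ => ((y : ℂ) - ζ)⁻¹ :=
  (Complex.continuous_ofReal.sub continuous_const).inv₀ fun y => ofReal_sub_ne_zero y hζ

theorem norm_resolvent_kernel_le (y : ℝ) {ζ : ℂ} (hζ : 0 < ζ.im) :
    ‖((y : ℂ) - ζ)⁻¹‖ ≤ ζ.im⁻¹ := by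
  rw [norm_inv]
  refine inv_anti₀ hζ ?_
  have := Complex.abs_im_le_norm ((y : ℂ) - ζ)
  simpa [abs_of_pos hζ] using this

theorem integrable_resolvent_kernel (σ : Measure ℝ) [IsFiniteMeasure σ] {ζ : ℂ}
    (hζ : 0 < ζ.im) : Integrable (fun y : ℝ => ((y : ℂ) - ζ)⁻¹) σ :=
  Integrable.of_bound (continuous_resolvent_kernel hζ).aestronglyMeasurable ζ.im⁻¹
    (ae_of_all _ fun y => norm_resolvent_kernel_le y hζ)

/-- Vanishing at infinity makes Stieltjes transforms blind to mass that escapes there. -/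
theorem tendsto_resolvent_kernel (ζ : ℂ) :
    Tendsto (fun y : ℝ => ((y : ℂ) - ζ)⁻¹) (cocompact ℝ) (𝓝 0) := by
  refine tendsto_inv₀_cobounded.comp ?_
  rw [← tendsto_norm_atTop_iff_cobounded]
  refine tendsto_atTop_mono (fun y : ℝ => ?_)
    (tendsto_atTop_add_const_right _ (-‖ζ‖) (tendsto_norm_cocompact_atTop (E := ℝ)))
  simpa [sub_eq_add_neg] using norm_sub_norm_le (y : ℂ) ζ

theorem exists_tendsto_hyperfilter_of_abs_le (a : ℕ → ℝ) (C : ℝ) (h : ∀ n, |a n| ≤ C) :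
    ∃ L, Tendsto a (hyperfilter ℕ) (𝓝 L) := by
  obtain ⟨L, -, hL⟩ := isCompact_iff_ultrafilter_le_nhds.1 (isCompact_Icc (a := -C) (b := C))
    ((hyperfilter ℕ).map a) (by
      rw [le_principal_iff]
      exact Ultrafilter.mem_map.2 (Filter.univ_mem' fun n => abs_le.1 (h n)))
  exact ⟨L, hL⟩

/-- A sequence of finitely supported measures of mass `P` has a vague limit along an ultrafilter,
and Stieltjes transforms converge. -/
theorem exists_measure_tendsto_stieltjes {P : ℝ} (g : ℕ → ℂ → ℂ) (hg : ∀ n, IsAtomic P (g n)) :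
    ∃ σ : Measure ℝ, IsFiniteMeasure σ ∧ ∀ ζ : ℂ, 0 < ζ.im →
      Tendsto (fun n => g n ζ) (hyperfilter ℕ) (𝓝 (stieltjes σ ζ)) := by
  choose d p x hp hP hgx using hg
  -- On the compactification every continuous function is compactly supported, so Riesz–Markov
  -- yields a finite measure. Limits along an ultrafilter exist for all bounded sequences at once
  -- and are linear, so no subsequence is needed.
  let X := OnePoint ℝ
  let _ : MeasurableSpace X := borel X
  have : BorelSpace X := ⟨rfl⟩
  let I : (X → ℝ) → ℕ → ℝ := fun f n => ∑ i, p n i * f (x n i : ℝ)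
  have hex : ∀ f : CompactlySupportedContinuousMap X ℝ,
      ∃ L, Tendsto (I f) (hyperfilter ℕ) (𝓝 L) := by
    intro f
    obtain ⟨C, hC⟩ := isCompact_univ.exists_bound_of_continuousOn f.continuous.continuousOn
    refine exists_tendsto_hyperfilter_of_abs_le _ (P * C) fun n => ?_
    rw [← hP n, Finset.sum_mul]
    refine (Finset.abs_sum_le_sum_abs _ _).trans (Finset.sum_le_sum fun i _ => ?_)
    rw [abs_mul, abs_of_nonneg (hp n i)]
    exact mul_le_mul_of_nonneg_left (hC _ trivial) (hp n i)
  choose Λ₀ hΛ₀ using hex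
  let Λ : CompactlySupportedContinuousMap X ℝ →ₚ[ℝ] ℝ := PositiveLinearMap.mk₀
    { toFun := Λ₀
      map_add' := fun f h => tendsto_nhds_unique (hΛ₀ _) (by
        convert (hΛ₀ f).add (hΛ₀ h) using 2 with n
        simp [I, mul_add, Finset.sum_add_distrib])
      map_smul' := fun r f => tendsto_nhds_unique (hΛ₀ _) (by
        convert (hΛ₀ f).const_mul r using 2 with n
        · simp [I, Finset.mul_sum, mul_left_comm]
        · simp) }
    (fun f hf => ge_of_tendsto' (hΛ₀ f) fun n =>
      Finset.sum_nonneg fun i _ => mul_nonneg (hp n i) (hf _))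
  let μ := RealRMK.rieszMeasure Λ
  have hμ : ∀ f : CompactlySupportedContinuousMap X ℝ, ∫ y, f y ∂μ = Λ₀ f :=
    fun f => RealRMK.integral_rieszMeasure Λ f
  have : IsFiniteMeasure μ := by
    refine ⟨?_⟩
    exact isCompact_univ.measure_lt_top
  have hemb : MeasurableEmbedding ((↑) : ℝ → X) := OnePoint.isOpenEmbedding_coe.measurableEmbedding
  let σ := μ.comap ((↑) : ℝ → X)
  have hσ : IsFiniteMeasure σ := ⟨by
    rw [hemb.comap_apply]
    exact measure_lt_top _ _⟩
  refine ⟨σ, hσ, fun ζ hζ => ?_⟩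
  have hint : ∀ (k : ℝ → ℝ), Continuous k → Tendsto k (cocompact ℝ) (𝓝 0) →
      Tendsto (fun n => ∑ i, p n i * k (x n i)) (hyperfilter ℕ) (𝓝 (∫ y, k y ∂σ)) := by
    intro k hk hk0
    -- The test function is extended by `0` at infinity, so restricting the limit measure to `ℝ`
    -- does not change its integral.
    let K : C(X, ℝ) := OnePoint.continuousMapMk ⟨k, hk⟩ 0
      (by rw [coclosedCompact_eq_cocompact]; exact hk0)
    let f : CompactlySupportedContinuousMap X ℝ := ⟨K, HasCompactSupport.of_compactSpace _⟩
    have hf : ∀ y : ℝ, f (y : X) = k y := fun y => rfl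
    have h1 : ∫ y, k y ∂σ = Λ₀ f := by
      rw [← hμ f]
      simp_rw [← hf]
      rw [← hemb.integral_map (fun y => f y), hemb.map_comap]
      refine setIntegral_eq_integral_of_forall_compl_eq_zero fun y hy => ?_
      rw [OnePoint.notMem_range_coe_iff] at hy
      subst hy
      rfl
    rw [h1]
    exact hΛ₀ f
  have hre := hint (fun y => (((y : ℂ) - ζ)⁻¹).re)
    (Complex.continuous_re.comp (continuous_resolvent_kernel hζ))
    ((Complex.continuous_re.tendsto 0).comp (tendsto_resolvent_kernel ζ))
  have him := hint (fun y => (((y : ℂ) - ζ)⁻¹).im)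
    (Complex.continuous_im.comp (continuous_resolvent_kernel hζ))
    ((Complex.continuous_im.tendsto 0).comp (tendsto_resolvent_kernel ζ))
  have hk := integrable_resolvent_kernel σ hζ
  have e1 : (stieltjes σ ζ).re = ∫ y : ℝ, (((y : ℂ) - ζ)⁻¹).re ∂σ := by
    rw [stieltjes_eq_integral]; exact (integral_re hk).symm
  have e2 : (stieltjes σ ζ).im = ∫ y : ℝ, (((y : ℂ) - ζ)⁻¹).im ∂σ := by
    rw [stieltjes_eq_integral]; exact (integral_im hk).symm
  rw [← Complex.re_add_im (stieltjes σ ζ), e1, e2]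
  have := ((Complex.continuous_ofReal.tendsto _).comp hre).add
    (((Complex.continuous_ofReal.tendsto _).comp him).mul_const Complex.I)
  refine this.congr fun n => ?_
  rw [hgx n ζ hζ, ← Complex.re_add_im (∑ i, _)]
  simp only [Function.comp, Complex.re_sum, Complex.im_sum, div_eq_mul_inv, Complex.re_ofReal_mul,
    Complex.im_ofReal_mul]

/-! ### The fixed-point equation in the variable `√z`: uniqueness. -/

/-- The rational function `m / (1 - m²)`. -/
def qfun (m : ℂ) : ℂ := m / (1 - m ^ 2)

/-- The fixed-point map of the canonical equation in the variable `ζ = √z`, `m = ζ c t`. -/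
def sqrtMap {M : ℕ} (l : Fin M → ℝ) (c : ℝ) (ζ m : ℂ) : ℂ :=
  ((c / M : ℝ) : ℂ) * ∑ k, (l k : ℂ) * (1 / (-ζ - l k * qfun m))

theorem one_sub_ne_zero_of_im {m : ℂ} (hm : 0 < m.im) : 1 - m ≠ 0 := by
  intro h
  have := congrArg Complex.im h
  simp at this
  linarith

theorem one_add_ne_zero_of_im {m : ℂ} (hm : 0 < m.im) : 1 + m ≠ 0 := by
  intro h
  have := congrArg Complex.im h
  simp at this
  linarith

/-- Follows from `qfun m = (1/(1 - m) - 1/(1 + m)) / 2`; the choice `n = conj m` gives the factor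
`qfactor` of the imaginary part. -/
theorem qfun_sub {m n : ℂ} (h1 : 1 - m ≠ 0) (h2 : 1 + m ≠ 0) (h3 : 1 - n ≠ 0) (h4 : 1 + n ≠ 0) :
    qfun m - qfun n =
      (m - n) * ((1 / ((1 - m) * (1 - n)) + 1 / ((1 + m) * (1 + n))) / 2) := by
  have e1 : 1 - m ^ 2 = (1 - m) * (1 + m) := by ring
  have e2 : 1 - n ^ 2 = (1 - n) * (1 + n) := by ring
  rw [qfun, qfun, e1, e2]
  field_simp
  ring

/-- The factor `Im (m / (1 - m²)) / Im m`. -/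
def qfactor (m : ℂ) : ℝ := ((‖1 - m‖⁻¹) ^ 2 + (‖1 + m‖⁻¹) ^ 2) / 2

theorem qfun_im {m : ℂ} (h1 : 1 - m ≠ 0) (h2 : 1 + m ≠ 0) :
    (qfun m).im = m.im * qfactor m := by
  have e1 : qfun m = (1 / (1 - m) - 1 / (1 + m)) / 2 := by
    have e1 : 1 - m ^ 2 = (1 - m) * (1 + m) := by ring
    rw [qfun, e1]
    field_simp
    ring
  rw [e1, qfactor]
  have n1 : ∀ z : ℂ, (‖z‖⁻¹) ^ 2 = (Complex.normSq z)⁻¹ := fun z => by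
    rw [inv_pow, Complex.normSq_eq_norm_sq]
  rw [n1, n1, show ((1 / (1 - m) - 1 / (1 + m)) / 2 : ℂ) =
    ((1 / 2 : ℝ) : ℂ) * ((1 - m)⁻¹ - (1 + m)⁻¹) by push_cast; ring, Complex.im_ofReal_mul,
    Complex.sub_im, Complex.inv_im, Complex.inv_im]
  simp
  ring

/-- Cauchy–Schwarz for the vectors `(‖1 - m‖⁻¹, ‖1 + m‖⁻¹)` and `(‖1 - n‖⁻¹, ‖1 + n‖⁻¹)`. -/
theorem norm_qfactor_le (m n : ℂ) :
    ‖(1 / ((1 - m) * (1 - n)) + 1 / ((1 + m) * (1 + n))) / 2‖ ^ 2 ≤ qfactor m * qfactor n := by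
  have h : ‖(1 / ((1 - m) * (1 - n)) + 1 / ((1 + m) * (1 + n))) / 2‖ ≤
      (‖1 - m‖⁻¹ * ‖1 - n‖⁻¹ + ‖1 + m‖⁻¹ * ‖1 + n‖⁻¹) / 2 := by
    rw [norm_div, RCLike.norm_ofNat]
    gcongr
    refine (norm_add_le _ _).trans (le_of_eq ?_)
    simp [mul_comm]
  refine (pow_le_pow_left₀ (norm_nonneg _) h 2).trans ?_
  rw [qfactor, qfactor]
  nlinarith [sq_nonneg (‖1 - m‖⁻¹ * ‖1 + n‖⁻¹ - ‖1 + m‖⁻¹ * ‖1 - n‖⁻¹)]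

section

variable {M : ℕ} {l : Fin M → ℝ} {c : ℝ} {ζ m n : ℂ}

theorem denom_im_le {lk : ℝ} (hl : 0 < lk) (hq : 0 ≤ (qfun m).im) :
    (-ζ - lk * qfun m).im ≤ -ζ.im := by
  simp
  positivity

theorem denom_ne_zero {lk : ℝ} (hl : 0 < lk) (hζ : 0 < ζ.im) (hq : 0 ≤ (qfun m).im) :
    -ζ - lk * qfun m ≠ 0 := by
  intro h
  have := denom_im_le (ζ := ζ) hl hq
  rw [h] at this
  simp at this
  linarith

theorem im_le_norm_denom {lk : ℝ} (hl : 0 < lk) (hq : 0 ≤ (qfun m).im) :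
    ζ.im ≤ ‖-ζ - lk * qfun m‖ := by
  have h1 := denom_im_le (ζ := ζ) hl hq
  have h2 := Complex.abs_im_le_norm (-ζ - lk * qfun m)
  have h3 := neg_le_abs (-ζ - lk * qfun m).im
  linarith

theorem sqrtMap_sub (hl : ∀ k, 0 < l k) (hζ : 0 < ζ.im) (hm : 0 ≤ (qfun m).im)
    (hn : 0 ≤ (qfun n).im) :
    sqrtMap l c ζ m - sqrtMap l c ζ n = (qfun m - qfun n) * (((c / M : ℝ) : ℂ) *
      ∑ k, (l k : ℂ) ^ 2 / ((-ζ - l k * qfun m) * (-ζ - l k * qfun n))) := by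
  rw [sqrtMap, sqrtMap, ← mul_sub, ← Finset.sum_sub_distrib, mul_left_comm]
  congr 1
  rw [Finset.mul_sum]
  refine Finset.sum_congr rfl fun k _ => ?_
  have h1 := denom_ne_zero (hl k) hζ hm
  have h2 := denom_ne_zero (hl k) hζ hn
  field_simp
  ring

/-- Take imaginary parts in the fixed-point equation: the sum times `Im (qfun m) = Im m · qfactor m`
is `Im m` minus a contribution proportional to `Im ζ`, which is strictly positive. Dividing by `Im
m` gives the bound. -/
theorem sum_mul_qfactor_lt_one (hM : 0 < M) (hc : 0 < c) (hl : ∀ k, 0 < l k) (hζ : 0 < ζ.im)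
    (hm : 0 < m.im) (h : m = sqrtMap l c ζ m) :
    (c / M) * (∑ k, (l k * ‖-ζ - l k * qfun m‖⁻¹) ^ 2) * qfactor m < 1 := by
  have h1 := one_sub_ne_zero_of_im hm
  have h2 := one_add_ne_zero_of_im hm
  have hqi := qfun_im h1 h2
  have hK : 0 < qfactor m := by
    have := norm_pos_iff.2 h1
    have := norm_pos_iff.2 h2
    rw [qfactor]; positivity
  have hq : 0 ≤ (qfun m).im := by rw [hqi]; positivity
  have hM' : (0 : ℝ) < c / M := by positivity
  have him : m.im = (c / M) * ∑ k, l k * ((ζ.im + l k * (qfun m).im) *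
      (‖-ζ - l k * qfun m‖⁻¹) ^ 2) := by
    conv_lhs => rw [h]
    rw [sqrtMap, Complex.im_ofReal_mul, Complex.im_sum]
    congr 1
    refine Finset.sum_congr rfl fun k _ => ?_
    rw [Complex.im_ofReal_mul, one_div, Complex.inv_im, inv_pow, ← Complex.normSq_eq_norm_sq]
    simp only [Complex.sub_im, Complex.neg_im, Complex.im_ofReal_mul]
    ring
  have hlt : (c / M) * (∑ k, (l k * ‖-ζ - l k * qfun m‖⁻¹) ^ 2) * (qfun m).im < m.im := by
    rw [him, mul_assoc, Finset.sum_mul]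
    refine mul_lt_mul_of_pos_left (Finset.sum_lt_sum_of_nonempty ?_ fun k _ => ?_) hM'
    · exact ⟨⟨0, hM⟩, Finset.mem_univ _⟩
    · have := norm_pos_iff.2 (denom_ne_zero (hl k) hζ hq)
      have h3 : 0 < l k * (ζ.im * (‖-ζ - l k * qfun m‖⁻¹) ^ 2) := by
        have := hl k
        positivity
      linarith
  rw [hqi] at hlt
  have : m.im * ((c / M) * (∑ k, (l k * ‖-ζ - l k * qfun m‖⁻¹) ^ 2) * qfactor m) < m.im * 1 := by
    linarith
  exact lt_of_mul_lt_mul_left this hm.le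

/-- Two fixed points satisfy `m - n = (m - n) F G`. Cauchy–Schwarz bounds `|F G|²` by the product of
the two quantities that `sum_mul_qfactor_lt_one` makes smaller than `1`, so `F G = 1` is impossible.
-/
theorem sqrtMap_unique (hM : 0 < M) (hc : 0 < c) (hl : ∀ k, 0 < l k) (hζ : 0 < ζ.im)
    (hm : 0 < m.im) (hn : 0 < n.im) (h : m = sqrtMap l c ζ m) (h' : n = sqrtMap l c ζ n) :
    m = n := by
  by_contra hne
  have a1 := one_sub_ne_zero_of_im hm
  have a2 := one_add_ne_zero_of_im hm
  have b1 := one_sub_ne_zero_of_im hn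
  have b2 := one_add_ne_zero_of_im hn
  have K0 : ∀ m, 0 ≤ qfactor m := fun m => by rw [qfactor]; positivity
  have hqm : 0 ≤ (qfun m).im := by rw [qfun_im a1 a2]; exact mul_nonneg hm.le (K0 m)
  have hqn : 0 ≤ (qfun n).im := by rw [qfun_im b1 b2]; exact mul_nonneg hn.le (K0 n)
  have hA := sum_mul_qfactor_lt_one hM hc hl hζ hm h
  have hB := sum_mul_qfactor_lt_one hM hc hl hζ hn h'
  have hsub := sqrtMap_sub (c := c) hl hζ hqm hqn
  rw [← h, ← h', qfun_sub a1 a2 b1 b2] at hsub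
  set F := (1 / ((1 - m) * (1 - n)) + 1 / ((1 + m) * (1 + n))) / 2
  set G := ((c / M : ℝ) : ℂ) *
      ∑ k, (l k : ℂ) ^ 2 / ((-ζ - l k * qfun m) * (-ζ - l k * qfun n))
  have hFG : F * G = 1 := by
    have : (m - n) * (F * G) = (m - n) * 1 := by linear_combination -hsub
    exact mul_left_cancel₀ (sub_ne_zero.2 hne) this
  set A := ∑ k, (l k * ‖-ζ - l k * qfun m‖⁻¹) ^ 2
  set B := ∑ k, (l k * ‖-ζ - l k * qfun n‖⁻¹) ^ 2
  have hA0 : 0 ≤ A := Finset.sum_nonneg fun k _ => sq_nonneg _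
  have hB0 : 0 ≤ B := Finset.sum_nonneg fun k _ => sq_nonneg _
  have hM' : (0 : ℝ) < c / M := by positivity
  have hG : ‖G‖ ^ 2 ≤ (c / M) ^ 2 * (A * B) := by
    have h1 : ‖G‖ ≤ (c / M) *
        ∑ k, (l k * ‖-ζ - l k * qfun m‖⁻¹) * (l k * ‖-ζ - l k * qfun n‖⁻¹) := by
      rw [norm_mul, Complex.norm_real, Real.norm_of_nonneg hM'.le]
      refine mul_le_mul_of_nonneg_left ((norm_sum_le _ _).trans (le_of_eq ?_)) hM'.le
      refine Finset.sum_congr rfl fun k _ => ?_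
      rw [norm_div, norm_mul, norm_pow, Complex.norm_real, Real.norm_of_nonneg (hl k).le]
      field_simp
    refine (pow_le_pow_left₀ (norm_nonneg _) h1 2).trans ?_
    rw [mul_pow]
    exact mul_le_mul_of_nonneg_left (Finset.sum_mul_sq_le_sq_mul_sq _ _ _) (by positivity)
  have hF : ‖F‖ ^ 2 ≤ qfactor m * qfactor n := norm_qfactor_le m n
  have h1 : (1 : ℝ) = ‖F‖ ^ 2 * ‖G‖ ^ 2 := by
    rw [← mul_pow, ← norm_mul, hFG]; simp
  have h2 : ‖F‖ ^ 2 * ‖G‖ ^ 2 ≤ (qfactor m * qfactor n) * ((c / M) ^ 2 * (A * B)) :=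
    mul_le_mul hF hG (by positivity) (mul_nonneg (K0 m) (K0 n))
  have h3 : (qfactor m * qfactor n) * ((c / M) ^ 2 * (A * B)) =
    ((c / M) * A * qfactor m) * ((c / M) * B * qfactor n) := by ring
  have h4 : ((c / M) * A * qfactor m) * ((c / M) * B * qfactor n) < 1 :=
    mul_lt_one_of_nonneg_of_lt_one_left (mul_nonneg (mul_nonneg hM'.le hA0) (K0 m)) hA hB.le
  linarith

theorem qfun_neg_conj (m : ℂ) :
    qfun (-(starRingEnd ℂ) m) = -(starRingEnd ℂ) (qfun m) := by
  simp [qfun, neg_div]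

/-- With uniqueness, this reflection symmetry makes the transforms of the measures in the variable
`ζ` odd under `ζ ↦ -conj ζ` up to conjugation, as needed for the push-forward by squaring. -/
theorem sqrtMap_neg_conj :
    sqrtMap l c (-(starRingEnd ℂ) ζ) (-(starRingEnd ℂ) m) =
      -(starRingEnd ℂ) (sqrtMap l c ζ m) := by
  rw [sqrtMap, sqrtMap, qfun_neg_conj, map_mul, map_sum, Complex.conj_ofReal, ← mul_neg,
    ← Finset.sum_neg_distrib]
  congr 1
  refine Finset.sum_congr rfl fun k _ => ?_
  rw [map_mul, Complex.conj_ofReal, map_div₀, map_one, map_sub, map_neg, map_mul,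
    Complex.conj_ofReal, ← mul_neg, ← div_neg]
  congr 3
  ring

end

/-! ### The fixed-point equation in the variable `√z`: existence. -/

section

variable {M : ℕ} {l : Fin M → ℝ} {c : ℝ}

/-- `qfun m` is the half-sum of `m / (1 + m)` and `m / (1 - m)`, two rank-one perturbations. -/
theorem IsAtomic.qfun {P : ℝ} {m : ℂ → ℂ} (hm : IsAtomic P m) :
    IsAtomic P (fun ζ => qfun (m ζ)) := by
  have h := ((hm.div_one_add 1 (Or.inl rfl)).add (hm.div_one_add (-1) (Or.inr rfl))).smul
    (r := 1 / 2) (by norm_num)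
  refine h.congr (by ring) fun ζ hζ => ?_
  have hne : 1 + m ζ ≠ 0 ∧ 1 - m ζ ≠ 0 := by
    rcases hm.im_pos_or hζ with h | h
    · exact ⟨one_add_ne_zero_of_im h, one_sub_ne_zero_of_im h⟩
    · simp [h]
  obtain ⟨h1, h2⟩ := hne
  have e1 : 1 - m ζ ^ 2 = (1 - m ζ) * (1 + m ζ) := by ring
  have e2 : 1 + ((-1 : ℝ) : ℂ) * m ζ = 1 - m ζ := by push_cast; ring
  have e3 : 1 + ((1 : ℝ) : ℂ) * m ζ = 1 + m ζ := by push_cast; ring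
  rw [AutocovSupport.qfun, e1, e2, e3]
  push_cast
  field_simp
  ring

/-- The iterates of `sqrtMap` started at `0`. -/
def sqrtIter (l : Fin M → ℝ) (c : ℝ) : ℕ → ℂ → ℂ
  | 0 => fun _ => 0
  | n + 1 => fun ζ => sqrtMap l c ζ (sqrtIter l c n ζ)

theorem IsAtomic.kernel {P : ℝ} {m : ℂ → ℂ} (hm : IsAtomic P m) {lk : ℝ} (hl : 0 < lk) :
    IsAtomic 1 (fun ζ => 1 / (-ζ - lk * AutocovSupport.qfun (m ζ))) :=
  (hm.qfun.smul hl.le).inv_neg_sub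

theorem exists_isAtomic_sqrtIter (hc : 0 < c) (hl : ∀ k, 0 < l k) (n : ℕ) :
    ∃ P, IsAtomic P (sqrtIter l c n) := by
  induction n with
  | zero => exact ⟨0, IsAtomic.zero⟩
  | succ n ih =>
    obtain ⟨P, hP⟩ := ih
    exact ⟨_, (IsAtomic.sum Finset.univ fun k _ => (hP.kernel (hl k)).smul (hl k).le).smul
      (r := c / M) (by positivity)⟩

theorem norm_sqrtMap_le (hc : 0 < c) (hl : ∀ k, 0 < l k) {ζ m : ℂ} (hζ : 0 < ζ.im)
    (hq : 0 ≤ (qfun m).im) : ‖sqrtMap l c ζ m‖ ≤ (c / M) * (∑ k, l k) / ζ.im := by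
  rw [sqrtMap, norm_mul, Complex.norm_real, Real.norm_of_nonneg (by positivity), mul_div_assoc,
    Finset.sum_div]
  refine mul_le_mul_of_nonneg_left ((norm_sum_le _ _).trans (Finset.sum_le_sum fun k _ => ?_))
    (by positivity)
  rw [norm_mul, Complex.norm_real, Real.norm_of_nonneg (hl k).le, norm_div, norm_one,
    div_eq_mul_one_div (l k)]
  exact mul_le_mul_of_nonneg_left (one_div_le_one_div_of_le hζ (im_le_norm_denom (hl k) hq))
    (hl k).le

/-- On the ball of radius `1/2` all of `|1 ± m|`, `|1 ± n|` are at least `1/2`, whence the `4`. The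
Lipschitz constant decays like `(Im ζ)⁻²`, which makes the map a contraction high up. -/
theorem norm_sqrtMap_sub_le (hc : 0 < c) (hl : ∀ k, 0 < l k) {ζ m n : ℂ} (hζ : 0 < ζ.im)
    (hm : 0 ≤ (qfun m).im) (hn : 0 ≤ (qfun n).im) (hm2 : ‖m‖ ≤ 1 / 2) (hn2 : ‖n‖ ≤ 1 / 2) :
    ‖sqrtMap l c ζ m - sqrtMap l c ζ n‖ ≤
      4 * ((c / M) * (∑ k, l k ^ 2) / ζ.im ^ 2) * ‖m - n‖ := by
  have half : ∀ z : ℂ, ‖z‖ ≤ 1 / 2 → 1 / 2 ≤ ‖1 - z‖ ∧ 1 / 2 ≤ ‖1 + z‖ := by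
    intro z hz
    have h1 := norm_sub_norm_le (1 : ℂ) z
    have h2 := norm_sub_norm_le (1 : ℂ) (-z)
    simp only [norm_one, norm_neg, sub_neg_eq_add] at h1 h2
    constructor <;> linarith
  obtain ⟨a1, a2⟩ := half m hm2
  obtain ⟨b1, b2⟩ := half n hn2
  have ne : ∀ z : ℂ, 1 / 2 ≤ ‖z‖ → z ≠ 0 := fun z hz => norm_pos_iff.1 (by linarith)
  have hq : ‖qfun m - qfun n‖ ≤ 4 * ‖m - n‖ := by
    rw [qfun_sub (ne _ a1) (ne _ a2) (ne _ b1) (ne _ b2), norm_mul, mul_comm]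
    refine mul_le_mul_of_nonneg_right ?_ (norm_nonneg _)
    have q : ∀ z w : ℂ, 1 / 2 ≤ ‖z‖ → 1 / 2 ≤ ‖w‖ → ‖1 / (z * w)‖ ≤ 4 := by
      intro z w hz hw
      rw [norm_div, norm_one, norm_mul, div_le_iff₀ (by positivity)]
      nlinarith
    rw [norm_div, RCLike.norm_ofNat]
    have := norm_add_le (1 / ((1 - m) * (1 - n))) (1 / ((1 + m) * (1 + n)))
    have := q _ _ a1 b1
    have := q _ _ a2 b2
    linarith
  rw [sqrtMap_sub hl hζ hm hn, norm_mul]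
  have hS : ‖((c / M : ℝ) : ℂ) * ∑ k, (l k : ℂ) ^ 2 /
      ((-ζ - l k * qfun m) * (-ζ - l k * qfun n))‖ ≤ (c / M) * (∑ k, l k ^ 2) / ζ.im ^ 2 := by
    rw [norm_mul, Complex.norm_real, Real.norm_of_nonneg (by positivity), mul_div_assoc,
      Finset.sum_div]
    refine mul_le_mul_of_nonneg_left ((norm_sum_le _ _).trans (Finset.sum_le_sum fun k _ => ?_))
      (by positivity)
    rw [norm_div, norm_pow, Complex.norm_real, Real.norm_of_nonneg (hl k).le, norm_mul, sq ζ.im]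
    exact div_le_div_of_nonneg_left (by positivity) (by positivity)
      (mul_le_mul (im_le_norm_denom (hl k) hm) (im_le_norm_denom (hl k) hn) hζ.le (norm_nonneg _))
  calc _ ≤ (4 * ‖m - n‖) * ((c / M) * (∑ k, l k ^ 2) / ζ.im ^ 2) :=
        mul_le_mul hq hS (norm_nonneg _) (by positivity)
    _ = _ := by ring

/-- The iteration converges high enough in the upper half-plane. -/
theorem exists_tendsto_sqrtIter (hc : 0 < c) (hl : ∀ k, 0 < l k) :
    ∃ Y : ℝ, 0 < Y ∧ ∀ ζ : ℂ, Y < ζ.im →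
      ∃ m : ℂ, ‖m‖ ≤ 1 / 2 ∧ 0 ≤ m.im ∧ Tendsto (fun n => sqrtIter l c n ζ) atTop (𝓝 m) := by
  set C1 := (c / M) * ∑ k, l k
  set C2 := (c / M) * ∑ k, l k ^ 2
  have hC1 : 0 ≤ C1 := mul_nonneg (by positivity) (Finset.sum_nonneg fun k _ => (hl k).le)
  have hC2 : 0 ≤ C2 := mul_nonneg (by positivity) (Finset.sum_nonneg fun k _ => sq_nonneg _)
  -- `2 * C1` keeps the iterates in the ball of radius `1/2`; `8 * C2`, with `Im ζ > 1`, makes the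
  -- contraction ratio at most `1/2`.
  refine ⟨1 + 2 * C1 + 8 * C2, by positivity, fun ζ hY => ?_⟩
  have hζ : 0 < ζ.im := by linarith
  have hq : ∀ n, 0 ≤ (qfun (sqrtIter l c n ζ)).im := fun n => by
    obtain ⟨P, hP⟩ := exists_isAtomic_sqrtIter (l := l) hc hl n
    exact hP.qfun.im_nonneg hζ
  have hn : ∀ n, ‖sqrtIter l c n ζ‖ ≤ 1 / 2 := by
    intro n
    cases n with
    | zero => simp [sqrtIter]
    | succ n =>
      refine (norm_sqrtMap_le hc hl hζ (hq n)).trans ?_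
      rw [div_le_iff₀ hζ]
      linarith
  have hr : 4 * (C2 / ζ.im ^ 2) ≤ 1 / 2 := by
    rw [← mul_div_assoc, div_le_iff₀ (by positivity)]
    nlinarith
  have hstep : ∀ n, dist (sqrtIter l c n ζ) (sqrtIter l c (n + 1) ζ) ≤ 1 * (1 / 2 : ℝ) ^ n := by
    intro n
    induction n with
    | zero =>
      have h1 := hn 1
      simp only [sqrtIter, dist_zero_left, pow_zero, mul_one] at h1 ⊢
      linarith
    | succ n ih =>
      rw [dist_eq_norm] at ih ⊢
      refine (norm_sqrtMap_sub_le hc hl hζ (hq n) (hq (n + 1)) (hn n) (hn (n + 1))).trans ?_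
      rw [show (1 / 2 : ℝ) ^ (n + 1) = (1 / 2) ^ n * (1 / 2) from pow_succ _ _]
      have := mul_le_mul hr ih (norm_nonneg _) (by norm_num)
      linarith
  obtain ⟨m, hm⟩ := cauchySeq_tendsto_of_complete
    (cauchySeq_of_le_geometric (1 / 2) 1 (by norm_num) hstep)
  refine ⟨m, le_of_tendsto' hm.norm hn, ?_, hm⟩
  refine ge_of_tendsto' ((Complex.continuous_im.tendsto m).comp hm) fun n => ?_
  obtain ⟨P, hP⟩ := exists_isAtomic_sqrtIter (l := l) hc hl n
  exact hP.im_nonneg hζ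

theorem stieltjes_im (σ : Measure ℝ) [IsFiniteMeasure σ] {ζ : ℂ} (hζ : 0 < ζ.im) :
    (stieltjes σ ζ).im = ∫ y : ℝ, ζ.im / Complex.normSq ((y : ℂ) - ζ) ∂σ := by
  rw [stieltjes_eq_integral]
  refine (integral_im (integrable_resolvent_kernel σ hζ)).symm.trans ?_
  refine integral_congr_ae (ae_of_all _ fun y => ?_)
  simp

theorem integrable_im_kernel (σ : Measure ℝ) [IsFiniteMeasure σ] {ζ : ℂ} (hζ : 0 < ζ.im) :
    Integrable (fun y : ℝ => ζ.im / Complex.normSq ((y : ℂ) - ζ)) σ := by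
  refine (integrable_resolvent_kernel σ hζ).im.congr (ae_of_all _ fun y => ?_)
  simp

theorem stieltjes_im_pos (σ : Measure ℝ) [IsFiniteMeasure σ] (h : σ ≠ 0) {ζ : ℂ}
    (hζ : 0 < ζ.im) : 0 < (stieltjes σ ζ).im := by
  rw [stieltjes_im σ hζ]
  refine (integral_pos_iff_support_of_nonneg
    (fun y => div_nonneg hζ.le (Complex.normSq_nonneg _)) (integrable_im_kernel σ hζ)).2 ?_
  have : Function.support (fun y : ℝ => ζ.im / Complex.normSq ((y : ℂ) - ζ)) = Set.univ := by
    refine Set.eq_univ_of_forall fun y => ?_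
    exact (div_pos hζ (Complex.normSq_pos.2 (ofReal_sub_ne_zero _ hζ))).ne'
  rw [this]
  exact pos_iff_ne_zero.2 (by simpa using h)

theorem differentiableOn_stieltjes (σ : Measure ℝ) [IsFiniteMeasure σ] :
    DifferentiableOn ℂ (stieltjes σ) {ζ : ℂ | 0 < ζ.im} := by
  intro ζ hζ
  have : HasDerivAt (resolventTransform σ) _ ζ := hasDerivAt_resolventTransform ζ (by
    rintro ⟨x, -, hx⟩
    have := congrArg Complex.im hx
    simp at this
    exact (ne_of_gt (show 0 < ζ.im from hζ)) this.symm)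
  exact this.differentiableAt.differentiableWithinAt

theorem isOpen_upperHalf : IsOpen {ζ : ℂ | 0 < ζ.im} :=
  isOpen_lt continuous_const Complex.continuous_im

/-- Ultrafilter limits of the kernels `1/(-ζ - l qfun m_n)` exist at every `ζ`, but they are known
to satisfy the equation only where the iteration converges. The identity theorem then carries the
equation down to the whole half-plane. -/
theorem exists_sqrt_measures (hM : 0 < M) (hc : 0 < c) (hl : ∀ k, 0 < l k) :
    ∃ σ : Fin M → Measure ℝ, (∀ k, IsFiniteMeasure (σ k)) ∧ ∀ ζ : ℂ, 0 < ζ.im →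
      ∃ m : ℂ, 0 < m.im ∧ m = sqrtMap l c ζ m ∧
        ∀ k, stieltjes (σ k) ζ = 1 / (-ζ - l k * qfun m) := by
  have hat : ∀ k n, IsAtomic 1 (fun ζ => 1 / (-ζ - l k * qfun (sqrtIter l c n ζ))) := fun k n => by
    obtain ⟨P, hP⟩ := exists_isAtomic_sqrtIter (l := l) hc hl n
    exact hP.kernel (hl k)
  choose σ hσ hσlim using fun k => exists_measure_tendsto_stieltjes _ (hat k)
  refine ⟨σ, hσ, ?_⟩
  set m : ℂ → ℂ := fun ζ => ((c / M : ℝ) : ℂ) * ∑ k, (l k : ℂ) * stieltjes (σ k) ζ with hmdef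
  obtain ⟨Y, hY0, hY⟩ := exists_tendsto_sqrtIter (l := l) hc hl
  have hhigh : ∀ ζ : ℂ, Y < ζ.im → ‖m ζ‖ ≤ 1 / 2 ∧ 0 ≤ (m ζ).im ∧
      ∀ k, stieltjes (σ k) ζ = 1 / (-ζ - l k * qfun (m ζ)) := by
    intro ζ hζY
    have hζ : 0 < ζ.im := hY0.trans hζY
    obtain ⟨m₀, hm1, hm2, hlim⟩ := hY ζ hζY
    have h2 : 1 - m₀ ^ 2 ≠ 0 := by
      intro h
      have : ‖m₀‖ ^ 2 = 1 := by rw [← norm_pow, ← sub_eq_zero.1 h]; simp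
      nlinarith [norm_nonneg m₀]
    have hqlim : Tendsto (fun n => qfun (sqrtIter l c n ζ)) atTop (𝓝 (qfun m₀)) :=
      hlim.div (tendsto_const_nhds.sub (hlim.pow 2)) h2
    have hq : 0 ≤ (qfun m₀).im := by
      refine ge_of_tendsto' ((Complex.continuous_im.tendsto _).comp hqlim) fun n => ?_
      obtain ⟨P, hP⟩ := exists_isAtomic_sqrtIter (l := l) hc hl n
      exact hP.qfun.im_nonneg hζ
    have hk : ∀ k, Tendsto (fun n => 1 / (-ζ - l k * qfun (sqrtIter l c n ζ))) atTop
        (𝓝 (1 / (-ζ - l k * qfun m₀))) := fun k =>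
      tendsto_const_nhds.div (tendsto_const_nhds.sub (tendsto_const_nhds.mul hqlim))
        (denom_ne_zero (hl k) hζ hq)
    have hS : ∀ k, stieltjes (σ k) ζ = 1 / (-ζ - l k * qfun m₀) := fun k =>
      tendsto_nhds_unique (hσlim k ζ hζ) ((hk k).mono_left Nat.hyperfilter_le_atTop)
    have hmm : m ζ = m₀ := by
      have h3 : Tendsto (fun n => sqrtIter l c (n + 1) ζ) atTop (𝓝 (m ζ)) := by
        simp only [sqrtIter, sqrtMap, hmdef, hS]
        exact tendsto_const_nhds.mul (tendsto_finsetSum _ fun k _ =>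
          tendsto_const_nhds.mul (hk k))
      exact tendsto_nhds_unique h3 (hlim.comp (tendsto_add_atTop_nat 1))
    rw [hmm]
    exact ⟨hm1, hm2, hS⟩
  have hdm : DifferentiableOn ℂ m {ζ : ℂ | 0 < ζ.im} := by
    refine DifferentiableOn.const_mul (DifferentiableOn.fun_sum fun k _ => ?_) _
    have := hσ k
    exact (differentiableOn_stieltjes (σ k)).const_mul _
  set ζ₀ : ℂ := ⟨0, Y + 1⟩
  have hζ₀ : Y < ζ₀.im := by simp [ζ₀]
  -- The equation is cleared of denominators so that both sides are analytic before `1 - m²` is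
  -- known not to vanish.
  have hid : ∀ k, Set.EqOn
      (fun ζ => stieltjes (σ k) ζ * (-ζ * (1 - m ζ ^ 2) - l k * m ζ)) (fun ζ => 1 - m ζ ^ 2)
      {ζ : ℂ | 0 < ζ.im} := by
    intro k
    have := hσ k
    have hd1 : DifferentiableOn ℂ (fun ζ => 1 - m ζ ^ 2) {ζ : ℂ | 0 < ζ.im} :=
      (differentiableOn_const _).sub (hdm.pow 2)
    have hd2 : DifferentiableOn ℂ
        (fun ζ => stieltjes (σ k) ζ * (-ζ * (1 - m ζ ^ 2) - l k * m ζ)) {ζ : ℂ | 0 < ζ.im} :=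
      (differentiableOn_stieltjes (σ k)).mul ((differentiableOn_id.neg.mul hd1).sub
        (hdm.const_mul _))
    refine (hd2.analyticOnNhd isOpen_upperHalf).eqOn_of_preconnected_of_eventuallyEq
      (hd1.analyticOnNhd isOpen_upperHalf) (convex_halfSpace_im_gt 0).isPreconnected
      (show ζ₀ ∈ _ from hY0.trans hζ₀) ?_
    filter_upwards [(isOpen_lt continuous_const Complex.continuous_im).mem_nhds hζ₀] with ζ hζ
    obtain ⟨h1, h2, h3⟩ := hhigh ζ hζ
    have h4 : 1 - m ζ ^ 2 ≠ 0 := by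
      intro h
      have : ‖m ζ‖ ^ 2 = 1 := by rw [← norm_pow, ← sub_eq_zero.1 h]; simp
      nlinarith [norm_nonneg (m ζ)]
    have h5 : stieltjes (σ k) ζ ≠ 0 := by
      intro h0
      have h6 := h3 k
      rw [h0] at h6
      have hden : -ζ - (l k : ℂ) * qfun (m ζ) = 0 := by
        by_contra hne
        exact one_div_ne_zero hne h6.symm
      have hq : 0 ≤ (qfun (m ζ)).im := by
        have e1 : 1 - m ζ ≠ 0 := by
          intro h; apply h4; linear_combination (1 + m ζ) * h
        have e2 : 1 + m ζ ≠ 0 := by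
          intro h; apply h4; linear_combination (1 - m ζ) * h
        rw [qfun_im e1 e2, qfactor]; positivity
      exact denom_ne_zero (hl k) (hY0.trans hζ) hq hden
    have h6 := h3 k
    have h7 : -ζ - (l k : ℂ) * qfun (m ζ) ≠ 0 := by
      intro h; rw [h] at h6; simp at h6; exact h5 h6
    have h8 : -ζ * (1 - m ζ ^ 2) - l k * m ζ = (-ζ - l k * qfun (m ζ)) * (1 - m ζ ^ 2) := by
      rw [qfun]; field_simp
    rw [h8, h6]
    field_simp
  intro ζ hζ
  -- A zero measure would force `m² = 1` at `ζ₀`, against `|m| ≤ 1/2`.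
  have hσ0 : ∀ k, σ k ≠ 0 := by
    intro k h0
    have h1 := hid k (show ζ₀ ∈ _ from hY0.trans hζ₀)
    obtain ⟨h2, -, -⟩ := hhigh ζ₀ hζ₀
    simp [h0, stieltjes] at h1
    have : ‖m ζ₀‖ ^ 2 = 1 := by rw [← norm_pow, ← sub_eq_zero.1 h1.symm]; simp
    nlinarith [norm_nonneg (m ζ₀)]
  have hmim : 0 < (m ζ).im := by
    rw [hmdef, Complex.im_ofReal_mul, Complex.im_sum]
    refine mul_pos (by positivity) (Finset.sum_pos (fun k _ => ?_) ⟨⟨0, hM⟩, Finset.mem_univ _⟩)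
    have := hσ k
    rw [Complex.im_ofReal_mul]
    exact mul_pos (hl k) (stieltjes_im_pos _ (hσ0 k) hζ)
  have h4 : 1 - m ζ ^ 2 ≠ 0 := by
    have h1 := mul_ne_zero (one_sub_ne_zero_of_im hmim) (one_add_ne_zero_of_im hmim)
    intro h
    exact h1 (by linear_combination h)
  have hS : ∀ k, stieltjes (σ k) ζ = 1 / (-ζ - l k * qfun (m ζ)) := by
    intro k
    have h1 := hid k hζ
    beta_reduce at h1
    have h8 : -ζ * (1 - m ζ ^ 2) - l k * m ζ = (-ζ - l k * qfun (m ζ)) * (1 - m ζ ^ 2) := by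
      rw [qfun]; field_simp
    rw [h8, ← mul_assoc] at h1
    exact eq_one_div_of_mul_eq_one_left (mul_right_cancel₀ h4 (h1.trans (one_mul _).symm))
  refine ⟨m ζ, hmim, ?_, hS⟩
  rw [sqrtMap]
  simp_rw [← hS]
  rfl

end

/-! ### Back to the variable `z`: unique solvability of the canonical equation and the measures μ
and ν. -/

section

variable {M : ℕ} {l : Fin M → ℝ} {c : ℝ}

/-- The scalar form of the `k`-th eigenvalue of `resolventT`. -/
def scalarT (lk c : ℝ) (z t : ℂ) : ℂ :=
  1 / (-z - ((z * (c : ℂ) * t) / (1 - z * (c : ℂ) ^ 2 * t ^ 2)) * lk)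

/-- The scalar form of the canonical equation. -/
def IsScalarSol (l : Fin M → ℝ) (c : ℝ) (z t : ℂ) : Prop :=
  0 < t.im ∧ 0 < (z * t).im ∧ t = (1 / (M : ℂ)) * ∑ k, (l k : ℂ) * scalarT (l k) c z t

theorem exists_sqrt_upperHalf {z : ℂ} (hz : 0 < z.im) :
    ∃ ζ : ℂ, ζ ^ 2 = z ∧ 0 < ζ.im ∧ 0 < ζ.re := by
  obtain ⟨w, hw⟩ := IsAlgClosed.exists_pow_nat_eq z (n := 2) (by norm_num)
  have h : 0 < w.re * w.im := by
    rw [← hw, sq, Complex.mul_im] at hz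
    linarith
  rcases lt_or_ge 0 w.im with h1 | h1
  · exact ⟨w, hw, h1, pos_of_mul_pos_left h h1.le⟩
  · have h2 : w.im < 0 := lt_of_le_of_ne h1 (by intro h0; simp [h0] at h)
    refine ⟨-w, by rw [neg_sq, hw], ?_⟩
    simp only [Complex.neg_im, Complex.neg_re]
    constructor <;> nlinarith

theorem scalarT_sq (lk : ℝ) {ζ m : ℂ} (hc : c ≠ 0) (hζ : ζ ≠ 0) :
    scalarT lk c (ζ ^ 2) (m / (ζ * c)) = (1 / (-ζ - lk * qfun m)) / ζ := by
  have hc' : (c : ℂ) ≠ 0 := by exact_mod_cast hc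
  have e : 1 - ζ ^ 2 * (c : ℂ) ^ 2 * (m / (ζ * c)) ^ 2 = 1 - m ^ 2 := by field_simp
  have e2 : ζ ^ 2 * (c : ℂ) * (m / (ζ * c)) = ζ * m := by field_simp
  rw [scalarT, e, e2, div_div, qfun]
  congr 1
  ring

theorem IsScalarSol.sqrt (hc : 0 < c) {z t ζ : ℂ} (h : IsScalarSol l c z t)
    (hζ : ζ ^ 2 = z) (hre : 0 < ζ.re) :
    0 < (ζ * c * t).im ∧ ζ * c * t = sqrtMap l c ζ (ζ * c * t) := by
  have hζ0 : ζ ≠ 0 := by rintro rfl; simp at hre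
  have hc' : (c : ℂ) ≠ 0 := by exact_mod_cast hc.ne'
  obtain ⟨h1, h2, h3⟩ := h
  constructor
  -- `2 Re ζ · ζ t = z t + |ζ|² t` merges the two half-plane conditions on `t` and `z t` into `Im (ζ
  -- t) > 0`.
  · have e : ((2 * ζ.re : ℝ) : ℂ) * (ζ * t) = z * t + ((Complex.normSq ζ : ℝ) : ℂ) * t := by
      rw [← hζ, Complex.normSq_eq_conj_mul_self]
      have : ((2 * ζ.re : ℝ) : ℂ) = ζ + (starRingEnd ℂ) ζ := by rw [Complex.add_conj]
      rw [this]; ring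
    have h5 := congrArg Complex.im e
    rw [Complex.im_ofReal_mul, Complex.add_im, Complex.im_ofReal_mul] at h5
    have h6 : 0 < 2 * ζ.re * (ζ * t).im := by
      rw [h5]
      exact add_pos h2 (mul_pos (Complex.normSq_pos.2 hζ0) h1)
    have h7 : 0 < (ζ * t).im := pos_of_mul_pos_right h6 (by positivity)
    rw [mul_right_comm, mul_comm, Complex.im_ofReal_mul]
    positivity
  · set m := ζ * c * t with hm
    have ht : t = m / (ζ * c) := by rw [hm]; field_simp
    have h4 : m = ζ * c * ((1 / (M : ℂ)) * ∑ k, (l k : ℂ) * scalarT (l k) c z t) := by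
      rw [← h3]
    refine h4.trans ?_
    rw [sqrtMap, ht, ← hζ]
    simp_rw [scalarT_sq _ hc.ne' hζ0]
    rw [← mul_assoc, Finset.mul_sum, Finset.mul_sum]
    refine Finset.sum_congr rfl fun k _ => ?_
    push_cast
    field_simp

theorem IsScalarSol.unique (hM : 0 < M) (hc : 0 < c) (hl : ∀ k, 0 < l k) {z t s : ℂ}
    (hz : 0 < z.im) (ht : IsScalarSol l c z t) (hs : IsScalarSol l c z s) : t = s := by
  obtain ⟨ζ, hζ, him, hre⟩ := exists_sqrt_upperHalf hz
  obtain ⟨h1, h2⟩ := ht.sqrt hc hζ hre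
  obtain ⟨h3, h4⟩ := hs.sqrt hc hζ hre
  have h := sqrtMap_unique hM hc hl him h1 h3 h2 h4
  have hζ0 : ζ ≠ 0 := by rintro rfl; simp at hre
  have hc' : (c : ℂ) ≠ 0 := by exact_mod_cast hc.ne'
  exact mul_left_cancel₀ (mul_ne_zero hζ0 hc') h

theorem stieltjes_neg_conj (σ : Measure ℝ) (ζ : ℂ) :
    ∫ y : ℝ, ((y : ℂ) + ζ)⁻¹ ∂σ = (starRingEnd ℂ) (stieltjes σ (-(starRingEnd ℂ) ζ)) := by
  rw [stieltjes_eq_integral, ← integral_conj]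
  refine integral_congr_ae (ae_of_all _ fun y => ?_)
  simp

/-- Partial fractions of `1/(y² - ζ²)` produce the kernels at `ζ` and `-ζ`; by `hsym` the second
integrates to minus the first. -/
theorem stieltjes_map_sq (σ : Measure ℝ) [IsFiniteMeasure σ] {ζ : ℂ} (hζ : 0 < ζ.im)
    (hre : 0 < ζ.re) (hsym : stieltjes σ (-(starRingEnd ℂ) ζ) = -(starRingEnd ℂ) (stieltjes σ ζ)) :
    stieltjes (σ.map fun y => y ^ 2) (ζ ^ 2) = stieltjes σ ζ / ζ := by
  have hζ0 : ζ ≠ 0 := by rintro rfl; simp at hre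
  have hz : 0 < (ζ ^ 2).im := by
    rw [sq, Complex.mul_im]; nlinarith [mul_pos hζ hre]
  have hζ' : 0 < (-(starRingEnd ℂ) ζ).im := by simpa using hζ
  have e1 := stieltjes_neg_conj σ ζ
  rw [hsym, map_neg, Complex.conj_conj] at e1
  rw [stieltjes_eq_integral, integral_map (by fun_prop)
    (continuous_resolvent_kernel hz).aestronglyMeasurable]
  have hadd : ∀ y : ℝ, (y : ℂ) + ζ ≠ 0 := by
    intro y h0
    have := congrArg Complex.im h0
    simp at this
    linarith
  have hi2 : Integrable (fun y : ℝ => ((y : ℂ) + ζ)⁻¹) σ := by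
    refine Integrable.of_bound ((Complex.continuous_ofReal.add continuous_const).inv₀
      hadd).aestronglyMeasurable ζ.im⁻¹ (ae_of_all _ fun y => ?_)
    rw [norm_inv]
    refine inv_anti₀ hζ ?_
    have := Complex.abs_im_le_norm ((y : ℂ) + ζ)
    simpa [abs_of_pos hζ] using this
  have e2 : ∀ y : ℝ, (((y ^ 2 : ℝ) : ℂ) - ζ ^ 2)⁻¹ =
      (1 / (2 * ζ)) * (((y : ℂ) - ζ)⁻¹ - ((y : ℂ) + ζ)⁻¹) := by
    intro y
    have h1 := ofReal_sub_ne_zero y hζ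
    have h2 := hadd y
    have h3 : ((y ^ 2 : ℝ) : ℂ) - ζ ^ 2 = ((y : ℂ) - ζ) * ((y : ℂ) + ζ) := by push_cast; ring
    rw [h3]
    field_simp
    ring
  simp_rw [e2]
  rw [integral_const_mul, integral_sub (integrable_resolvent_kernel σ hζ) hi2, e1,
    ← stieltjes_eq_integral]
  field_simp
  ring

theorem stieltjes_sum_smul {ι : Type*} [Fintype ι] (τ : ι → Measure ℝ)
    [∀ k, IsFiniteMeasure (τ k)] (r : ι → NNReal) {z : ℂ} (hz : 0 < z.im) :
    stieltjes (∑ k, r k • τ k) z = ∑ k, ((r k : ℝ) : ℂ) * stieltjes (τ k) z := by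
  simp_rw [stieltjes_eq_integral]
  rw [integral_finsetSum_measure fun k _ => ?_]
  · refine Finset.sum_congr rfl fun k _ => ?_
    rw [integral_smul_nnreal_measure, NNReal.smul_def, Complex.real_smul]
  · exact integrable_resolvent_kernel _ hz

/-- The imaginary part of `z` times a Stieltjes transform, for a measure on `[0, ∞)`. -/
theorem mul_stieltjes_im_nonneg (τ : Measure ℝ) [IsFiniteMeasure τ] (h0 : τ (Set.Iio 0) = 0)
    {z : ℂ} (hz : 0 < z.im) : 0 ≤ (z * stieltjes τ z).im := by
  rw [stieltjes_eq_integral, ← integral_const_mul]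
  have hi := (integrable_resolvent_kernel τ hz).const_mul z
  refine le_of_le_of_eq ?_ (integral_im hi)
  refine integral_nonneg_of_ae ?_
  have : ∀ᵐ y ∂τ, (0 : ℝ) ≤ y := by
    rw [ae_iff]; convert h0 using 2; ext y; simp
  filter_upwards [this] with y hy
  have e : RCLike.im (z * ((y : ℂ) - z)⁻¹) = y * z.im / Complex.normSq ((y : ℂ) - z) := by
    simp
    ring
  rw [e]
  exact div_nonneg (mul_nonneg hy hz.le) (Complex.normSq_nonneg _)

/-- Let `τ k` be the image of the `k`-th measure in the variable `ζ` under `y ↦ y²`; its transform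
is the `k`-th eigenvalue of `T(z)`. Then μ is the sum of the `(l k / M) τ k` and ν is the average of
the `τ k`. -/
theorem exists_scalar_measures (hM : 0 < M) (hc : 0 < c) (hl : ∀ k, 0 < l k) :
    ∃ μ ν : Measure ℝ, IsFiniteMeasure μ ∧ μ (Set.Iio 0) = 0 ∧
      IsFiniteMeasure ν ∧ ν (Set.Iio 0) = 0 ∧ ∀ z : ℂ, 0 < z.im →
        IsScalarSol l c z (stieltjes μ z) ∧
        stieltjes ν z = (1 / (M : ℂ)) * ∑ k, scalarT (l k) c z (stieltjes μ z) := by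
  obtain ⟨σ, hσ, hS⟩ := exists_sqrt_measures (l := l) hM hc hl
  set τ : Fin M → Measure ℝ := fun k => (σ k).map fun y => y ^ 2
  have hτ : ∀ k, IsFiniteMeasure (τ k) := fun k => by
    have := hσ k
    exact Measure.isFiniteMeasure_map _ _
  have hτ0 : ∀ k, τ k (Set.Iio 0) = 0 := fun k => by
    rw [Measure.map_apply (by fun_prop) measurableSet_Iio]
    convert measure_empty (μ := σ k)
    ext y
    simpa using sq_nonneg y
  have hpush : ∀ z : ℂ, 0 < z.im → ∃ ζ m : ℂ, ζ ^ 2 = z ∧ 0 < ζ.im ∧ 0 < ζ.re ∧ 0 < m.im ∧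
      m = sqrtMap l c ζ m ∧ ∀ k, stieltjes (τ k) z = 1 / (-ζ - l k * qfun m) / ζ := by
    intro z hz
    obtain ⟨ζ, hζz, hζ, hre⟩ := exists_sqrt_upperHalf hz
    have hζ' : 0 < (-(starRingEnd ℂ) ζ).im := by simpa using hζ
    obtain ⟨m, hm, hfix, hm2⟩ := hS ζ hζ
    obtain ⟨n, hn, hfixn, hn2⟩ := hS _ hζ'
    have hmn : n = -(starRingEnd ℂ) m := by
      refine sqrtMap_unique hM hc hl hζ' hn (by simpa using hm) hfixn ?_
      rw [sqrtMap_neg_conj, ← hfix]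
    refine ⟨ζ, m, hζz, hζ, hre, hm, hfix, fun k => ?_⟩
    have := hσ k
    rw [← hm2 k, ← hζz]
    refine stieltjes_map_sq (σ k) hζ hre ?_
    rw [hn2 k, hm2 k, hmn, qfun_neg_conj, map_div₀, map_one, map_sub, map_neg, map_mul,
      Complex.conj_ofReal, ← div_neg]
    congr 1
    ring
  have hMC : (M : ℂ) ≠ 0 := by exact_mod_cast hM.ne'
  have hcC : (c : ℂ) ≠ 0 := by exact_mod_cast hc.ne'
  have hlM : ∀ k, 0 ≤ l k / M := fun k => div_nonneg (hl k).le (by positivity)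
  refine ⟨∑ k, Real.toNNReal (l k / M) • τ k,
    ∑ k, (1 / M : NNReal) • τ k, inferInstance, ?_, inferInstance, ?_, fun z hz => ?_⟩
  · simp [Measure.finsetSum_apply, hτ0]
  · simp [Measure.finsetSum_apply, hτ0]
  obtain ⟨ζ, m, hζz, hζ, hre, hm, hfix, hT⟩ := hpush z hz
  have hζ0 : ζ ≠ 0 := by rintro rfl; simp at hre
  rw [stieltjes_sum_smul _ _ hz, stieltjes_sum_smul _ _ hz]
  set t := ∑ k, ((Real.toNNReal (l k / M) : ℝ) : ℂ) *
    stieltjes (τ k) z with ht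
  have htm : t = m / (ζ * c) := by
    have h2 : m / (ζ * c) = sqrtMap l c ζ m / (ζ * c) := by rw [← hfix]
    rw [h2, ht, sqrtMap, mul_div_assoc, Finset.sum_div, Finset.mul_sum]
    refine Finset.sum_congr rfl fun k _ => ?_
    rw [hT k]
    rw [Real.coe_toNNReal _ (hlM k)]
    push_cast
    field_simp
  have hTs : ∀ k, stieltjes (τ k) z = scalarT (l k) c z t := by
    intro k
    rw [htm, ← hζz, scalarT_sq _ hc.ne' hζ0, hζz, hT k]
  have h3 : t = (1 / (M : ℂ)) * ∑ k, (l k : ℂ) * scalarT (l k) c z t := by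
    rw [Finset.mul_sum]
    conv_lhs => rw [ht]
    refine Finset.sum_congr rfl fun k _ => ?_
    rw [hTs k]
    rw [Real.coe_toNNReal _ (hlM k)]
    push_cast
    ring
  have hnn : ∀ k, 0 ≤ (z * stieltjes (τ k) z).im := fun k =>
    mul_stieltjes_im_nonneg (τ k) (hτ0 k) hz
  have hzt : (z * t).im = ∑ k, l k / M * (z * stieltjes (τ k) z).im := by
    rw [ht, Finset.mul_sum, Complex.im_sum]
    refine Finset.sum_congr rfl fun k _ => ?_
    rw [mul_left_comm, Complex.im_ofReal_mul, Real.coe_toNNReal _ (hlM k)]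
  have hq : 0 ≤ (qfun m).im := by
    rw [qfun_im (one_sub_ne_zero_of_im hm) (one_add_ne_zero_of_im hm), qfactor]
    positivity
  have hD : ∀ k, -ζ - l k * qfun m ≠ 0 := fun k => denom_ne_zero (hl k) hζ hq
  have ht0 : 0 < t.im := by
    rw [ht, Complex.im_sum]
    refine Finset.sum_pos (fun k _ => ?_) ⟨⟨0, hM⟩, Finset.mem_univ _⟩
    rw [Complex.im_ofReal_mul, Real.coe_toNNReal _ (hlM k)]
    refine mul_pos (div_pos (hl k) (by positivity)) (stieltjes_im_pos _ (fun h0 => ?_) hz)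
    have h1 := hT k
    rw [h0] at h1
    exact div_ne_zero (one_div_ne_zero (hD k)) hζ0 (by rw [← h1]; simp [stieltjes])
  refine ⟨⟨ht0, ?_, h3⟩, ?_⟩
  -- If `Im (z t) = 0`, the weights being positive, `ζ m = r` and `z` times the transform of `τ 0`,
  -- say `s`, are both real. The kernel equation then reads `(-(z - r²) - l r) s = z - r²`;
  -- imaginary parts give `s = -1`, so `l r = 0` and `m = 0`, a contradiction.
  · by_contra hle
    have hnn' : ∀ k ∈ Finset.univ, 0 ≤ l k / M * (z * stieltjes (τ k) z).im :=
      fun k _ => mul_nonneg (hlM k) (hnn k)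
    have h0 : (z * t).im = 0 := le_antisymm (not_lt.1 hle) (hzt ▸ Finset.sum_nonneg hnn')
    have hr : (ζ * m).im = 0 := by
      have e : ζ * m = (c : ℂ) * (z * t) := by rw [htm, ← hζz]; field_simp
      rw [e, Complex.im_ofReal_mul, h0, mul_zero]
    have hs : (z * stieltjes (τ ⟨0, hM⟩) z).im = 0 := by
      rw [hzt] at h0
      have := (Finset.sum_eq_zero_iff_of_nonneg hnn').1 h0 ⟨0, hM⟩ (Finset.mem_univ _)
      rcases mul_eq_zero.1 this with h | h
      · exact absurd h (div_pos (hl _) (by positivity)).ne'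
      · exact h
    have hr' : ζ * m = ((ζ * m).re : ℂ) := Complex.ext rfl (by simpa using hr)
    have hs' : z * stieltjes (τ ⟨0, hM⟩) z = ((z * stieltjes (τ ⟨0, hM⟩) z).re : ℂ) :=
      Complex.ext rfl (by simpa using hs)
    generalize (ζ * m).re = r at hr'
    generalize (z * stieltjes (τ ⟨0, hM⟩) z).re = s at hs'
    rw [hT] at hs'
    have hm2 : 1 - m ^ 2 ≠ 0 := by
      have := mul_ne_zero (one_sub_ne_zero_of_im hm) (one_add_ne_zero_of_im hm)
      intro h; exact this (by linear_combination h)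
    have e1 : (-ζ - l ⟨0, hM⟩ * qfun m) * s = ζ := by
      rw [← hs', ← hζz]
      have := hD ⟨0, hM⟩
      field_simp
    have e2 : (-(z - (r : ℂ) ^ 2) - l ⟨0, hM⟩ * r) * s = z - (r : ℂ) ^ 2 := by
      have e3 : qfun m * (1 - m ^ 2) = m := by rw [qfun]; field_simp
      rw [← hr', ← hζz]
      linear_combination ζ * (1 - m ^ 2) * e1 + ζ * l ⟨0, hM⟩ * s * e3
    have hs1 : s = -1 := by
      have h5 := congrArg Complex.im e2
      simp [← Complex.ofReal_pow] at h5
      have h6 : z.im * (s + 1) = 0 := by linarith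
      rcases mul_eq_zero.1 h6 with h | h
      · exact absurd h hz.ne'
      · linarith
    rw [hs1] at e2
    have e4 : ((l ⟨0, hM⟩ * r : ℝ) : ℂ) = 0 := by push_cast at e2 ⊢; linear_combination e2
    have hr0 : r = 0 := by
      rcases mul_eq_zero.1 (Complex.ofReal_eq_zero.1 e4) with h | h
      · exact absurd h (hl _).ne'
      · exact h
    rw [hr0] at hr'
    rcases mul_eq_zero.1 (hr'.trans Complex.ofReal_zero) with h | h
    · exact hζ0 h
    · rw [h] at hm; simp at hm
  · rw [Finset.mul_sum]
    refine Finset.sum_congr rfl fun k _ => ?_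
    rw [← hTs k]
    simp

end

/-! ### Traces of resolvents as sums over eigenvalues. -/

section

variable {M : ℕ}

theorem inv_smul_one_add_smul {R : Matrix (Fin M) (Fin M) ℂ} (hR : R.IsHermitian) (α β : ℂ)
    (h : ∀ k, α + β * hR.eigenvalues k ≠ 0) :
    (α • (1 : Matrix (Fin M) (Fin M) ℂ) + β • R)⁻¹ =
      Unitary.conjStarAlgAut ℂ _ hR.eigenvectorUnitary
        (Matrix.diagonal fun k => 1 / (α + β * hR.eigenvalues k)) := by
  have e : α • (1 : Matrix (Fin M) (Fin M) ℂ) + β • R =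
      Unitary.conjStarAlgAut ℂ _ hR.eigenvectorUnitary
        (Matrix.diagonal fun k => α + β * hR.eigenvalues k) := by
    have e1 : (Matrix.diagonal fun k => α + β * (hR.eigenvalues k : ℂ)) =
        α • (1 : Matrix (Fin M) (Fin M) ℂ) +
          β • Matrix.diagonal (RCLike.ofReal ∘ hR.eigenvalues) := by
      ext i j
      by_cases hij : i = j
      · subst hij; simp
      · simp [hij]
    rw [e1, map_add, map_smul, map_smul, map_one, ← hR.spectral_theorem]
  rw [e]
  refine Matrix.inv_eq_right_inv ?_
  rw [← map_mul, Matrix.diagonal_mul_diagonal]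
  have : (fun i => (α + β * (hR.eigenvalues i : ℂ)) * (1 / (α + β * hR.eigenvalues i))) =
      fun _ => 1 := funext fun k => mul_one_div_cancel (h k)
  rw [this, Matrix.diagonal_one, map_one]

theorem trace_conjStarAlgAut (U : unitary (Matrix (Fin M) (Fin M) ℂ))
    (A : Matrix (Fin M) (Fin M) ℂ) :
    (Unitary.conjStarAlgAut ℂ _ U A).trace = A.trace := by
  rw [Unitary.conjStarAlgAut_apply, Matrix.trace_mul_cycle, Unitary.coe_star_mul_self, one_mul]

theorem ntr_inv {R : Matrix (Fin M) (Fin M) ℂ} (hR : R.IsHermitian) (α β : ℂ)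
    (h : ∀ k, α + β * hR.eigenvalues k ≠ 0) :
    ntr (α • (1 : Matrix (Fin M) (Fin M) ℂ) + β • R)⁻¹ =
      (1 / (M : ℂ)) * ∑ k, 1 / (α + β * hR.eigenvalues k) := by
  rw [ntr, inv_smul_one_add_smul hR α β h, trace_conjStarAlgAut, Matrix.trace_diagonal]

theorem ntr_mul_inv {R : Matrix (Fin M) (Fin M) ℂ} (hR : R.IsHermitian) (α β : ℂ)
    (h : ∀ k, α + β * hR.eigenvalues k ≠ 0) :
    ntr (R * (α • (1 : Matrix (Fin M) (Fin M) ℂ) + β • R)⁻¹) =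
      (1 / (M : ℂ)) * ∑ k, hR.eigenvalues k * (1 / (α + β * hR.eigenvalues k)) := by
  have e : ∀ D, (R * Unitary.conjStarAlgAut ℂ _ hR.eigenvectorUnitary D).trace =
      (Matrix.diagonal (RCLike.ofReal ∘ hR.eigenvalues) * D).trace := fun D => by
    conv_lhs => enter [1, 1]; rw [hR.spectral_theorem]
    rw [← map_mul, trace_conjStarAlgAut]
  rw [ntr, inv_smul_one_add_smul hR α β h, e, Matrix.diagonal_mul_diagonal,
    Matrix.trace_diagonal]
  rfl

end

/-! ### The change of variable `w = z c t - 1/(c t)`. -/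

section

variable {M : ℕ} {l : Fin M → ℝ} {c : ℝ}

/-- `(1/M) ∑ l / (l - w)`. -/
def cf (l : Fin M → ℝ) (w : ℂ) : ℂ := (1 / (M : ℂ)) * ∑ k, (l k : ℂ) / (l k - w)

/-- `(c/M) ∑ l² / |l - w|²`. -/
def ch (l : Fin M → ℝ) (c : ℝ) (w : ℂ) : ℝ := (c / M) * ∑ k, (l k / ‖(l k : ℂ) - w‖) ^ 2

/-- `c w² f(w) (c f(w) - 1)` for complex `w`. -/
def cphi (l : Fin M → ℝ) (c : ℝ) (w : ℂ) : ℂ := c * w ^ 2 * cf l w * (c * cf l w - 1)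

theorem cphi_eq (l : Fin M → ℝ) (c : ℝ) (w : ℂ) :
    cphi l c w = (c * (w * cf l w)) * (c * (w * cf l w) - w) := by
  rw [cphi]; ring

theorem cf_im (l : Fin M → ℝ) (w : ℂ) :
    (cf l w).im = w.im * ((1 / M) * ∑ k, l k / ‖(l k : ℂ) - w‖ ^ 2) := by
  have : (1 / (M : ℂ)) = ((1 / M : ℝ) : ℂ) := by push_cast; rfl
  rw [cf, this, Complex.im_ofReal_mul, Complex.im_sum]
  simp only [Finset.mul_sum]
  refine Finset.sum_congr rfl fun k _ => ?_
  rw [im_ofReal_div_sub, ← Complex.normSq_eq_norm_sq]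
  ring

theorem mul_cf_eq {w : ℂ} (h : ∀ k, (l k : ℂ) - w ≠ 0) :
    w * cf l w = (1 / (M : ℂ)) * ∑ k, ((l k ^ 2 : ℝ) / ((l k : ℂ) - w) - l k) := by
  rw [cf]
  simp only [Finset.mul_sum]
  refine Finset.sum_congr rfl fun k _ => ?_
  have := h k
  push_cast
  field_simp
  ring

/-- Since `l w/(l - w) = l²/(l - w) - l`, only the first term has an imaginary part. So `ch < 1`
says exactly that `c Im (w f(w)) < Im w` in the upper half-plane. -/
theorem mul_cf_im (hc : c ≠ 0) {w : ℂ} (h : ∀ k, (l k : ℂ) - w ≠ 0) :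
    (w * cf l w).im = w.im * (ch l c w / c) := by
  have : (1 / (M : ℂ)) = ((1 / M : ℝ) : ℂ) := by push_cast; rfl
  rw [mul_cf_eq h, this, Complex.im_ofReal_mul, Complex.im_sum, ch]
  simp only [Finset.mul_sum, Finset.sum_div]
  refine Finset.sum_congr rfl fun k _ => ?_
  rw [Complex.sub_im, im_ofReal_div_sub, div_pow, ← Complex.normSq_eq_norm_sq, Complex.ofReal_im]
  field_simp
  ring

theorem ch_pos (hM : 0 < M) (hc : 0 < c) (hl : ∀ k, 0 < l k) {w : ℂ}
    (h : ∀ k, (l k : ℂ) - w ≠ 0) : 0 < ch l c w := by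
  refine mul_pos (by positivity) (Finset.sum_pos (fun k _ => ?_) ⟨⟨0, hM⟩, Finset.mem_univ _⟩)
  have := norm_pos_iff.2 (h k)
  have := hl k
  positivity

theorem scalarT_eq {lk : ℝ} {z t w : ℂ} (hz : z ≠ 0) (hw : 0 < w.im)
    (h : (z * (c : ℂ) * t) / (1 - z * (c : ℂ) ^ 2 * t ^ 2) = - z / w) :
    scalarT lk c z t = w / z * (1 / ((lk : ℂ) - w)) := by
  have h1 := ofReal_sub_ne_zero lk hw
  have hw0 : w ≠ 0 := by rintro rfl; simp at hw
  have h2 : -z - (-z / w) * lk = z * ((lk : ℂ) - w) / w := by field_simp; ring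
  rw [scalarT, h, h2]
  field_simp

/-- The data attached to a solution of the canonical equation. -/
structure WData (l : Fin M → ℝ) (c : ℝ) (z t w : ℂ) : Prop where
  im_pos : 0 < w.im
  ch_lt : ch l c w < 1
  cphi_eq : cphi l c w = z
  mul_eq : z * t = w * cf l w
  ratio : (z * (c : ℂ) * t) / (1 - z * (c : ℂ) ^ 2 * t ^ 2) = - z / w

/-- This `w` satisfies `T = (w/z)(R - w)⁻¹`, hence `z t = w f(w)`; and `c z t - w = 1/(c t)` then
gives `φ(w) = z`. The bound `ch < 1` comes from `Im w = c Im (z t) + Im t/(c |t|²)`, whose last term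
is positive. -/
theorem IsScalarSol.wData (hc : 0 < c) {z t : ℂ} (hz : 0 < z.im)
    (h : IsScalarSol l c z t) : WData l c z t (z * c * t - 1 / (c * t)) := by
  obtain ⟨h1, h2, h3⟩ := h
  have hz0 : z ≠ 0 := by rintro rfl; simp at hz
  have ht0 : t ≠ 0 := by rintro rfl; simp at h1
  have hcC : (c : ℂ) ≠ 0 := by exact_mod_cast hc.ne'
  -- If it vanished, the quotient would take the default value `0`, every `scalarT` would be `-1/z`
  -- and `z t` would be real.
  have hD : 1 - z * (c : ℂ) ^ 2 * t ^ 2 ≠ 0 := by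
    intro hD
    have e : z * t = ((-((1 / M) * ∑ k, l k) : ℝ) : ℂ) := by
      have : ∀ k, scalarT (l k) c z t = - (1 / z) := fun k => by
        rw [scalarT, hD, div_zero, zero_mul, sub_zero, one_div_neg_eq_neg_one_div]
      rw [h3]
      simp_rw [this]
      rw [← Finset.sum_mul]
      push_cast
      field_simp
    rw [e, Complex.ofReal_im] at h2
    exact lt_irrefl _ h2
  set w := z * c * t - 1 / (c * t) with hw
  have hwD : w = -(1 - z * (c : ℂ) ^ 2 * t ^ 2) / (c * t) := by
    rw [hw]; field_simp; ring
  have hw0 : w ≠ 0 := by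
    rw [hwD]; exact div_ne_zero (neg_ne_zero.2 hD) (mul_ne_zero hcC ht0)
  have him : w.im = c * (z * t).im + t.im / (c * Complex.normSq t) := by
    have e : w = (c : ℂ) * (z * t) - ((1 / c : ℝ) : ℂ) * t⁻¹ := by
      rw [hw]; push_cast; field_simp
    rw [e, Complex.sub_im, Complex.im_ofReal_mul, Complex.im_ofReal_mul, Complex.inv_im]
    field_simp
    ring
  have hpos : 0 < t.im / (c * Complex.normSq t) :=
    div_pos h1 (mul_pos hc (Complex.normSq_pos.2 ht0))
  have hwim : 0 < w.im := by rw [him]; positivity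
  have hratio : (z * (c : ℂ) * t) / (1 - z * (c : ℂ) ^ 2 * t ^ 2) = - z / w := by
    rw [hwD]; field_simp
  have hf : z * t = w * cf l w := by
    conv_lhs => rw [h3]
    simp_rw [scalarT_eq hz0 hwim hratio]
    rw [cf]
    simp only [Finset.mul_sum]
    refine Finset.sum_congr rfl fun k _ => ?_
    field_simp
  refine ⟨hwim, ?_, ?_, hf, hratio⟩
  · have h4 := mul_cf_im (l := l) hc.ne' fun k => ofReal_sub_ne_zero (l k) hwim
    rw [← hf] at h4
    have h5 : c * (z * t).im < w.im := by linarith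
    rw [h4] at h5
    have h6 : w.im * ch l c w < w.im * 1 := by
      calc w.im * ch l c w = c * (w.im * (ch l c w / c)) := by field_simp
        _ < w.im * 1 := by linarith
    exact lt_of_mul_lt_mul_left h6 hwim.le
  · rw [AutocovSupport.cphi_eq, ← hf, hw]
    field_simp
    ring

/-- Converse of `IsScalarSol.wData`: with `v = c w f(w) - w` one has `t = 1/(c v)`, and `ch < 1`
means `Im v < 0`, that is `Im t > 0`. -/
theorem isScalarSol_of_w (hM : 0 < M) (hc : 0 < c) (hl : ∀ k, 0 < l k) {w : ℂ} (hw : 0 < w.im)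
    (hch : ch l c w < 1) (hz : 0 < (cphi l c w).im) :
    IsScalarSol l c (cphi l c w) (w * cf l w / cphi l c w) := by
  set z := cphi l c w with hzdef
  have hz0 : z ≠ 0 := by intro h; rw [h] at hz; simp at hz
  have hw0 : w ≠ 0 := by rintro rfl; simp at hw
  have hcC : (c : ℂ) ≠ 0 := by exact_mod_cast hc.ne'
  have hne : ∀ k, (l k : ℂ) - w ≠ 0 := fun k => ofReal_sub_ne_zero (l k) hw
  have hGim := mul_cf_im (l := l) hc.ne' hne
  have hchp := ch_pos hM hc hl hne
  have hG : 0 < (w * cf l w).im := by rw [hGim]; positivity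
  set G := w * cf l w
  have hG0 : G ≠ 0 := by intro h; rw [h] at hG; simp at hG
  set v := c * G - w with hv
  have hzv : z = c * G * v := cphi_eq l c w
  have hvim : v.im < 0 := by
    rw [hv, Complex.sub_im, Complex.im_ofReal_mul, hGim]
    have : c * (w.im * (ch l c w / c)) = w.im * ch l c w := by field_simp
    rw [this]
    nlinarith
  have hv0 : v ≠ 0 := by intro h; rw [h] at hvim; simp at hvim
  have ht : G / z = 1 / (c * v) := by rw [hzv]; field_simp
  have hzt : z * (G / z) = G := by field_simp
  have hratio : (z * (c : ℂ) * (G / z)) / (1 - z * (c : ℂ) ^ 2 * (G / z) ^ 2) = - z / w := by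
    have e : 1 - z * (c : ℂ) ^ 2 * (G / z) ^ 2 = -w / v := by
      have : z * (c : ℂ) ^ 2 * (G / z) ^ 2 = c * G * (c * (G / z)) := by field_simp
      rw [this, ht]
      field_simp
      rw [hv]; ring
    rw [e, hzv]
    field_simp
  refine ⟨?_, by rw [hzt]; exact hG, ?_⟩
  · have e : (1 / (c * v) : ℂ) = ((1 / c : ℝ) : ℂ) * v⁻¹ := by push_cast; field_simp
    rw [ht, e, Complex.im_ofReal_mul, Complex.inv_im]
    exact mul_pos (by positivity) (div_pos (by linarith) (Complex.normSq_pos.2 hv0))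
  · simp_rw [scalarT_eq hz0 hw hratio]
    have : G / z = (w * cf l w) / z := rfl
    rw [this, cf, mul_left_comm, Finset.mul_sum, mul_div_assoc, Finset.sum_div]
    congr 1
    refine Finset.sum_congr rfl fun k _ => ?_
    ring

/-- Injectivity of `φ` on this region is inherited from the uniqueness of `t`, since `z t = w f(w)`
together with `z` determines `w`. -/
theorem w_unique (hM : 0 < M) (hc : 0 < c) (hl : ∀ k, 0 < l k) {w v : ℂ} (hw : 0 < w.im)
    (hv : 0 < v.im) (hchw : ch l c w < 1) (hchv : ch l c v < 1) (h : cphi l c w = cphi l c v)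
    (hz : 0 < (cphi l c w).im) : w = v := by
  have h1 := isScalarSol_of_w hM hc hl hw hchw hz
  have h2 := isScalarSol_of_w hM hc hl hv hchv (h ▸ hz)
  rw [← h] at h2
  have h3 := h1.unique hM hc hl hz h2
  have hz0 : cphi l c w ≠ 0 := by intro h; rw [h] at hz; simp at hz
  have h4 : w * cf l w = v * cf l v := by
    field_simp at h3
    exact h3
  have e1 := cphi_eq l c w
  have e2 := cphi_eq l c v
  rw [← h, ← h4] at e2
  have hne : (c : ℂ) * (w * cf l w) ≠ 0 := by
    intro h0; rw [h0, zero_mul] at e1; exact hz0 e1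
  have := mul_left_cancel₀ hne (e1.symm.trans e2)
  linear_combination -this

theorem WData.sum_scalarT (hM : 0 < M) {z t w : ℂ} (hz : 0 < z.im) (h : WData l c z t w) :
    z * ((1 / (M : ℂ)) * ∑ k, scalarT (l k) c z t) = cf l w - 1 := by
  have hz0 : z ≠ 0 := by rintro rfl; simp at hz
  have hMC : (M : ℂ) ≠ 0 := by exact_mod_cast hM.ne'
  simp_rw [scalarT_eq hz0 h.im_pos h.ratio]
  have e : ∀ k, (l k : ℂ) / (l k - w) = w * (1 / ((l k : ℂ) - w)) + 1 := fun k => by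
    have := ofReal_sub_ne_zero (l k) h.im_pos
    field_simp
    ring
  rw [cf]
  simp_rw [e]
  rw [Finset.sum_add_distrib, ← Finset.mul_sum, ← Finset.mul_sum]
  simp
  field_simp
  ring

theorem ntr_resolventT (hc : 0 < c) {R : Matrix (Fin M) (Fin M) ℂ}
    (hR : R.IsHermitian) {z t : ℂ} (hz : 0 < z.im) (ht : 0 < t.im) (hzt : 0 < (z * t).im) :
    ntr (R * resolventT R c z t) =
        (1 / (M : ℂ)) * ∑ k, (hR.eigenvalues k : ℂ) * scalarT (hR.eigenvalues k) c z t ∧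
      ntr (resolventT R c z t) = (1 / (M : ℂ)) * ∑ k, scalarT (hR.eigenvalues k) c z t := by
  have hz0 : z ≠ 0 := by rintro rfl; simp at hz
  have ht0 : t ≠ 0 := by rintro rfl; simp at ht
  have hcC : (c : ℂ) ≠ 0 := by exact_mod_cast hc.ne'
  set s := (z * (c : ℂ) * t) / (1 - z * (c : ℂ) ^ 2 * t ^ 2) with hs
  have e : resolventT R c z t =
      ((-z) • (1 : Matrix (Fin M) (Fin M) ℂ) + (-s) • R)⁻¹ := by
    rw [resolventT, ← hs, sub_eq_add_neg, neg_smul, neg_smul]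
  have hne : ∀ k, -z + -s * hR.eigenvalues k ≠ 0 := by
    intro k h0
    by_cases hD : 1 - z * (c : ℂ) ^ 2 * t ^ 2 = 0
    · rw [hs, hD] at h0
      simp at h0
      exact hz0 h0
    · set w := z * c * t - 1 / (c * t) with hw
      have hwD : w = -(1 - z * (c : ℂ) ^ 2 * t ^ 2) / (c * t) := by
        rw [hw]; field_simp; ring
      have hwim : 0 < w.im := by
        have e : w = (c : ℂ) * (z * t) - ((1 / c : ℝ) : ℂ) * t⁻¹ := by
          rw [hw]; push_cast; field_simp
        have hpos : 0 < t.im / Complex.normSq t := div_pos ht (Complex.normSq_pos.2 ht0)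
        rw [e, Complex.sub_im, Complex.im_ofReal_mul, Complex.im_ofReal_mul, Complex.inv_im]
        have : 0 < c * (z * t).im := by positivity
        have : 0 < 1 / c * (t.im / Complex.normSq t) := by positivity
        rw [neg_div, mul_neg]
        linarith
      have hw0 : w ≠ 0 := by intro h; rw [h] at hwim; simp at hwim
      have hratio : s = - z / w := by
        rw [hs, hwD]; field_simp
      have h1 := ofReal_sub_ne_zero (hR.eigenvalues k) hwim
      have h2 : z * ((hR.eigenvalues k : ℂ) - w) = 0 := by
        rw [hratio] at h0
        field_simp at h0
        linear_combination h0
      exact mul_ne_zero hz0 h1 h2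
  have e2 : ∀ k, scalarT (hR.eigenvalues k) c z t = 1 / (-z + -s * hR.eigenvalues k) := by
    intro k
    rw [scalarT, ← hs]
    congr 1
    ring
  simp_rw [e2]
  rw [e]
  exact ⟨ntr_mul_inv hR _ _ hne, ntr_inv hR _ _ hne⟩

end

/-! ### The support in terms of real solutions of `φ(w) = x`. -/

section

variable {M : ℕ} {l : Fin M → ℝ} {c : ℝ}

/-- Properness of `φ`, for compactness: once `|w| > 4 ∑ l`, `G = w f(w)` is within a third of `mean
l` from `-mean l`, and `w = c G - φ(w)/(c G)` bounds `w`. -/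
theorem norm_w_le (hM : 0 < M) (hc : 0 < c) (hl : ∀ k, 0 < l k) {w : ℂ}
    (hw : ∀ k, (l k : ℂ) - w ≠ 0) :
    ‖w‖ ≤ 4 * (∑ k, l k) + c * (4 / 3 * ((∑ k, l k) / M)) +
      ‖cphi l c w‖ / (c * (2 / 3 * ((∑ k, l k) / M))) := by
  set Λ := ∑ k, l k
  have hΛ : 0 < Λ := Finset.sum_pos (fun k _ => hl k) ⟨⟨0, hM⟩, Finset.mem_univ _⟩
  have hMR : (0 : ℝ) < M := by exact_mod_cast hM
  rcases le_or_gt ‖w‖ (4 * Λ) with h | h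
  · have : 0 ≤ c * (4 / 3 * (Λ / M)) := by positivity
    have : 0 ≤ ‖cphi l c w‖ / (c * (2 / 3 * (Λ / M))) := by positivity
    linarith
  · set G := w * cf l w with hG
    have h1 : ‖G + ((Λ / M : ℝ) : ℂ)‖ ≤ 1 / 3 * (Λ / M) := by
      have e : G + ((Λ / M : ℝ) : ℂ) = (1 / (M : ℂ)) * ∑ k, (l k ^ 2 : ℝ) / ((l k : ℂ) - w) := by
        rw [hG, mul_cf_eq hw, Finset.sum_sub_distrib]
        push_cast [Λ]
        ring
      have e2 : 1 / 3 * (Λ / M) = 1 / (M : ℝ) * ∑ k, 1 / 3 * l k := by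
        rw [← Finset.mul_sum]; ring
      rw [e, e2, norm_mul, norm_div, norm_one, Complex.norm_natCast]
      refine mul_le_mul_of_nonneg_left ((norm_sum_le _ _).trans
        (Finset.sum_le_sum fun k _ => ?_)) (by positivity)
      have hk : l k ≤ Λ := Finset.single_le_sum (fun k _ => (hl k).le) (Finset.mem_univ k)
      have h2 := norm_sub_norm_le w (l k : ℂ)
      rw [Complex.norm_real, Real.norm_of_nonneg (hl k).le, norm_sub_rev] at h2
      rw [norm_div, Complex.norm_real, Real.norm_of_nonneg (by positivity),
        div_le_iff₀ (norm_pos_iff.2 (hw k))]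
      nlinarith [hl k]
    have hm0 : 0 < Λ / M := by positivity
    have hn : ‖((Λ / M : ℝ) : ℂ)‖ = Λ / M := by
      rw [Complex.norm_real, Real.norm_of_nonneg hm0.le]
    have h2 : ‖G‖ ≤ 4 / 3 * (Λ / M) := by
      have := norm_sub_le (G + ((Λ / M : ℝ) : ℂ)) ((Λ / M : ℝ) : ℂ)
      rw [add_sub_cancel_right, hn] at this
      linarith
    have h3 : 2 / 3 * (Λ / M) ≤ ‖G‖ := by
      have := norm_sub_norm_le ((Λ / M : ℝ) : ℂ) (-G)
      rw [sub_neg_eq_add, norm_neg, add_comm, hn] at this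
      rw [add_comm G] at h1
      rw [add_comm] at this
      linarith
    have hG0 : 0 < ‖G‖ := by linarith
    have hcn : ‖(c : ℂ)‖ = c := by rw [Complex.norm_real, Real.norm_of_nonneg hc.le]
    have e : w = c * G - cphi l c w / (c * G) := by
      have hcC : (c : ℂ) ≠ 0 := by exact_mod_cast hc.ne'
      have := norm_pos_iff.1 hG0
      rw [cphi_eq, ← hG]
      field_simp
      ring
    have h4 : ‖w‖ ≤ c * ‖G‖ + ‖cphi l c w‖ / (c * ‖G‖) := by
      conv_lhs => rw [e]
      refine (norm_sub_le _ _).trans ?_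
      rw [norm_mul (c : ℂ) G, norm_div, norm_mul (c : ℂ) G, hcn]
    have h5 : ‖cphi l c w‖ / (c * ‖G‖) ≤ ‖cphi l c w‖ / (c * (2 / 3 * (Λ / M))) := by
      gcongr
    have h6 : c * ‖G‖ ≤ c * (4 / 3 * (Λ / M)) := by gcongr
    linarith

theorem analyticAt_cf {w : ℂ} (hw : ∀ k, (l k : ℂ) - w ≠ 0) : AnalyticAt ℂ (cf l) w := by
  refine analyticAt_const.mul (Finset.analyticAt_fun_sum _ fun k _ => ?_)
  exact analyticAt_const.div (analyticAt_const.sub analyticAt_id) (hw k)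

theorem analyticAt_cphi {w : ℂ} (hw : ∀ k, (l k : ℂ) - w ≠ 0) : AnalyticAt ℂ (cphi l c) w := by
  have := analyticAt_cf hw
  exact ((analyticAt_const.mul (analyticAt_id.pow 2)).mul this).mul
    ((analyticAt_const.mul this).sub analyticAt_const)

theorem continuousAt_ch {w : ℂ} (hw : ∀ k, (l k : ℂ) - w ≠ 0) : ContinuousAt (ch l c) w := by
  refine continuousAt_const.mul (tendsto_finsetSum _ fun k _ => ?_)
  exact (continuousAt_const.div (continuousAt_const.sub continuousAt_id).norm
    (norm_ne_zero_iff.2 (hw k))).pow 2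

/-- `ch ≤ 1` keeps `w` at a fixed distance from every eigenvalue, so limits of such points avoid the
poles. -/
theorem sq_le_of_ch_le (hc : 0 < c) {w : ℂ} (h : ch l c w ≤ 1) (k : Fin M)
    (hk : (l k : ℂ) - w ≠ 0) : c / M * l k ^ 2 ≤ ‖(l k : ℂ) - w‖ ^ 2 := by
  have h1 : c / M * (l k / ‖(l k : ℂ) - w‖) ^ 2 ≤ ch l c w :=
    mul_le_mul_of_nonneg_left (Finset.single_le_sum (f := fun k => (l k / ‖(l k : ℂ) - w‖) ^ 2)
      (fun k _ => sq_nonneg _) (Finset.mem_univ k)) (by positivity)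
  have h2 : 0 < ‖(l k : ℂ) - w‖ ^ 2 := by have := norm_pos_iff.2 hk; positivity
  rw [div_pow, ← mul_div_assoc] at h1
  exact (div_le_one h2).1 (h1.trans h)

/-- The measure `τ` has a Stieltjes transform which is, up to the factor `z`, an explicit function
`F` of the solution `w` of `φ(w) = z`. -/
structure WRep (l : Fin M → ℝ) (c : ℝ) (τ : Measure ℝ) (F : ℂ → ℂ) : Prop where
  finite : IsFiniteMeasure τ
  rep : ∀ z : ℂ, 0 < z.im → ∃ w : ℂ, 0 < w.im ∧ ch l c w < 1 ∧ cphi l c w = z ∧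
    z * stieltjes τ z = F w
  cont : ∀ w : ℂ, (∀ k, (l k : ℂ) - w ≠ 0) → ContinuousAt F w
  im_pos : ∀ w : ℂ, 0 < w.im → 0 < (F w).im
  lip : ∃ K : ℝ, 0 ≤ K ∧ ∀ w : ℂ, 0 < w.im → ch l c w < 1 → (F w).im ≤ K * w.im

theorem stieltjes_ofReal_im (τ : Measure ℝ) (x : ℝ) : (stieltjes τ (x : ℂ)).im = 0 := by
  rw [stieltjes_eq_integral]
  have : ∀ y : ℝ, ((y : ℂ) - (x : ℂ))⁻¹ = (((y - x)⁻¹ : ℝ) : ℂ) := fun y => by push_cast; rfl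
  simp_rw [this]
  rw [integral_complex_ofReal, Complex.ofReal_im]

theorem continuousAt_stieltjes (τ : Measure ℝ) [IsFiniteMeasure τ] {x : ℝ} (hx : x ∉ τ.support) :
    ContinuousAt (stieltjes τ) (x : ℂ) := by
  have : HasDerivAt (resolventTransform τ) _ (x : ℂ) :=
    hasDerivAt_resolventTransform (x : ℂ) (by
      rintro ⟨y, hy, hxy⟩
      have : y = x := Complex.ofReal_injective hxy
      exact hx (this ▸ hy))
  exact this.continuousAt

/-- At a real point off the support, `w` has a real limit point. -/
theorem WRep.exists_real (hM : 0 < M) (hc : 0 < c) (hl : ∀ k, 0 < l k) {τ : Measure ℝ}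
    {F : ℂ → ℂ} (h : WRep l c τ F) {x : ℝ} (hx : x ∉ τ.support) :
    ∃ w : ℝ, (∀ k, l k ≠ w) ∧ ch l c w ≤ 1 ∧ cphi l c w = x ∧ F w = x * stieltjes τ x := by
  have := h.finite
  set z : ℕ → ℂ := fun n => (x : ℂ) + ((1 / ((n : ℝ) + 1) : ℝ) : ℂ) * Complex.I
  have hzim : ∀ n, 0 < (z n).im := fun n => by
    have : (z n).im = 1 / ((n : ℝ) + 1) := by
      simp only [z, Complex.add_im, Complex.ofReal_im, Complex.im_ofReal_mul, Complex.I_im]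
      ring
    rw [this]; positivity
  have hz : Tendsto z atTop (𝓝 (x : ℂ)) := by
    have := ((Complex.continuous_ofReal.tendsto 0).comp
      tendsto_one_div_add_atTop_nhds_zero_nat).mul_const Complex.I
    simpa [z, Function.comp_def] using this.const_add (x : ℂ)
  choose w hw hch hphi hF using fun n => h.rep (z n) (hzim n)
  have hne : ∀ n k, (l k : ℂ) - w n ≠ 0 := fun n k => ofReal_sub_ne_zero _ (hw n)
  obtain ⟨B, hB⟩ := (hz.norm.bddAbove_range)
  have hMR : (0 : ℝ) < M := by exact_mod_cast hM
  have hΛ : 0 < ∑ k, l k := Finset.sum_pos (fun k _ => hl k) ⟨⟨0, hM⟩, Finset.mem_univ _⟩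
  have hbd : Bornology.IsBounded (Set.range w) := by
    rw [isBounded_iff_forall_norm_le]
    refine ⟨4 * (∑ k, l k) + c * (4 / 3 * ((∑ k, l k) / M)) +
      B / (c * (2 / 3 * ((∑ k, l k) / M))), ?_⟩
    rintro _ ⟨n, rfl⟩
    refine (norm_w_le hM hc hl (hne n)).trans ?_
    rw [hphi]
    have : ‖z n‖ ≤ B := hB ⟨n, rfl⟩
    gcongr
  obtain ⟨w₀, -, φ, hφ, hlim⟩ := tendsto_subseq_of_bounded hbd fun n => Set.mem_range_self n
  have hne₀ : ∀ k, (l k : ℂ) - w₀ ≠ 0 := by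
    intro k h0
    have h1 : c / M * l k ^ 2 ≤ ‖(l k : ℂ) - w₀‖ ^ 2 :=
      ge_of_tendsto' ((hlim.const_sub (l k : ℂ)).norm.pow 2) fun n =>
        sq_le_of_ch_le hc (hch _).le k (hne _ k)
    rw [h0] at h1
    have : 0 < c / M * l k ^ 2 := by have := hl k; positivity
    simp at h1
    linarith
  have hch₀ : ch l c w₀ ≤ 1 :=
    le_of_tendsto' ((continuousAt_ch hne₀).tendsto.comp hlim) fun n => (hch _).le
  have hzφ := hz.comp hφ.tendsto_atTop
  have hphi₀ : cphi l c w₀ = x := by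
    refine tendsto_nhds_unique ((analyticAt_cphi hne₀).continuousAt.tendsto.comp hlim) ?_
    exact hzφ.congr fun n => (hphi _).symm
  have hF₀ : F w₀ = x * stieltjes τ x := by
    refine tendsto_nhds_unique ((h.cont _ hne₀).tendsto.comp hlim) ?_
    refine (hzφ.mul ((continuousAt_stieltjes τ hx).tendsto.comp hzφ)).congr fun n => ?_
    exact hF (φ n)
  have him : 0 ≤ w₀.im :=
    ge_of_tendsto' ((Complex.continuous_im.tendsto _).comp hlim) fun n => (hw _).le
  -- A limit in the open half-plane would have `Im F > 0`, while the limit of `z` times the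
  -- transform is real at a real point off the support.
  have him0 : w₀.im = 0 := by
    refine le_antisymm (not_lt.1 fun hpos => ?_) him
    have := h.im_pos _ hpos
    rw [hF₀, Complex.im_ofReal_mul, stieltjes_ofReal_im, mul_zero] at this
    exact lt_irrefl _ this
  have hw₀ : w₀ = ((w₀.re : ℝ) : ℂ) := Complex.ext rfl (by simpa using him0)
  rw [hw₀] at hch₀ hphi₀ hF₀ hne₀
  refine ⟨w₀.re, fun k hk => hne₀ k ?_, hch₀, hphi₀, hF₀⟩
  rw [hk, sub_self]

/-- A measure whose Stieltjes transform has imaginary part `O(ε)` at height `ε` above an interval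
does not charge that interval. -/
theorem notMem_support_of_im_le (τ : Measure ℝ) [IsFiniteMeasure τ] {x₀ δ K : ℝ} (hδ : 0 < δ)
    (h : ∀ x ε : ℝ, |x - x₀| < δ → 0 < ε → ε < δ → (stieltjes τ ⟨x, ε⟩).im ≤ K * ε) :
    x₀ ∉ τ.support := by
  have hIcc : ∀ x y : ℝ, |x - x₀| < δ → x < y → y - x < δ →
      τ.real (Set.Ioc x y) ≤ 2 * K * (y - x) ^ 2 := by
    intro x y hx hxy hyδ
    set ε := y - x
    have hε : 0 < ε := sub_pos.2 hxy
    have h1 := h x ε hx hε hyδ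
    have hz : 0 < (⟨x, ε⟩ : ℂ).im := hε
    rw [stieltjes_im τ hz] at h1
    have hker : ∀ s : ℝ, Complex.normSq ((s : ℂ) - ⟨x, ε⟩) = (s - x) ^ 2 + ε ^ 2 := fun s => by
      rw [Complex.normSq_apply]; simp; ring
    -- At height `ε = y - x` the Poisson kernel is at least `1/(2ε)` on `(x, y]`, so the mass of an
    -- interval is at most quadratic in its length.
    have h2 : τ.real (Set.Ioc x y) * (1 / (2 * ε)) ≤
        ∫ s : ℝ, (⟨x, ε⟩ : ℂ).im / Complex.normSq ((s : ℂ) - ⟨x, ε⟩) ∂τ := by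
      rw [← smul_eq_mul, ← integral_indicator_const _ measurableSet_Ioc]
      refine integral_mono ((integrable_const _).indicator measurableSet_Ioc)
        (integrable_im_kernel τ hz) fun s => ?_
      rw [hker]
      by_cases hs : s ∈ Set.Ioc x y
      · rw [Set.indicator_of_mem hs]
        change 1 / (2 * ε) ≤ ε / ((s - x) ^ 2 + ε ^ 2)
        have h3 : (s - x) ^ 2 ≤ ε ^ 2 :=
          pow_le_pow_left₀ (by linarith [hs.1]) (by simp only [ε]; linarith [hs.2]) 2
        rw [div_le_div_iff₀ (by positivity) (by positivity)]
        nlinarith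
      · rw [Set.indicator_of_notMem hs]
        have : 0 ≤ (⟨x, ε⟩ : ℂ).im := hε.le
        positivity
    have h4 : τ.real (Set.Ioc x y) ≤ (K * ε) * (2 * ε) := by
      have := h2.trans h1
      rwa [mul_one_div, div_le_iff₀ (by positivity)] at this
    linarith
  set g : ℝ → ℝ := fun s => τ.real (Set.Iic s)
  have hg : ∀ x y : ℝ, x ≤ y → g y - g x = τ.real (Set.Ioc x y) := by
    intro x y hxy
    have : τ.real (Set.Iic y) = τ.real (Set.Iic x) + τ.real (Set.Ioc x y) := by
      rw [← measureReal_union (Set.Iic_disjoint_Ioc le_rfl) measurableSet_Ioc,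
        Set.Iic_union_Ioc_eq_Iic hxy]
    simp only [g]; linarith
  have hgl : ∀ x y : ℝ, |x - x₀| < δ → |y - x₀| < δ → |y - x| < δ →
      |g y - g x| ≤ 2 * K * |y - x| ^ 2 := by
    intro x y hx hy hxy
    rcases lt_trichotomy x y with hlt | rfl | hlt
    · rw [hg x y hlt.le, abs_of_nonneg measureReal_nonneg, sq_abs]
      rw [abs_of_pos (sub_pos.2 hlt)] at hxy
      exact hIcc x y hx hlt hxy
    · simp
    · rw [abs_sub_comm, hg y x hlt.le, abs_of_nonneg measureReal_nonneg, sq_abs]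
      rw [abs_sub_comm, abs_of_pos (sub_pos.2 hlt)] at hxy
      have := hIcc y x hy hlt hxy
      linarith [sub_sq_comm x y]
  -- The quadratic bound kills the derivative of the distribution function, which is therefore
  -- constant near `x₀`.
  have hder : ∀ x : ℝ, |x - x₀| < δ → HasDerivAt g 0 x := by
    intro x hx
    rw [hasDerivAt_iff_isLittleO]
    have hnear : ∀ᶠ y in 𝓝 x, |y - x₀| < δ ∧ |y - x| < δ := by
      refine Filter.Eventually.and ?_ ?_
      · exact (isOpen_lt (continuous_abs.comp (continuous_id.sub continuous_const))
          continuous_const).mem_nhds hx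
      · exact (isOpen_lt (continuous_abs.comp (continuous_id.sub continuous_const))
          continuous_const).mem_nhds (by simpa using hδ)
    refine Asymptotics.IsBigO.trans_isLittleO (g := fun y => (y - x) ^ 2) ?_ ?_
    · refine Asymptotics.IsBigO.of_bound (2 * K) ?_
      filter_upwards [hnear] with y hy
      simpa using hgl x y hx hy.1 hy.2
    · have h0 : Tendsto (fun y => y - x) (𝓝 x) (𝓝 0) := by
        have : Tendsto (fun y : ℝ => y - x) (𝓝 x) (𝓝 (x - x)) := tendsto_id.sub_const x
        simpa using this
      simpa [sq] using (Asymptotics.isLittleO_one_iff ℝ |>.2 h0).mul_isBigO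
        (Asymptotics.isBigO_refl (fun y : ℝ => y - x) (𝓝 x))
  set a := x₀ - δ / 2
  set b := x₀ + δ / 2
  have hin : ∀ x ∈ Set.Icc a b, |x - x₀| < δ := fun x hx => by
    rw [abs_lt]; constructor <;> simp only [a, b] at hx <;> linarith [hx.1, hx.2]
  have hab : a ≤ b := by simp only [a, b]; linarith
  have hconst := constant_of_has_deriv_right_zero (f := g) (a := a) (b := b)
    (fun x hx => (hder x (hin x hx)).continuousAt.continuousWithinAt)
    (fun x hx => (hder x (hin x ⟨hx.1, hx.2.le⟩)).hasDerivWithinAt) b ⟨hab, le_rfl⟩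
  rw [Measure.notMem_support_iff_exists]
  refine ⟨Set.Ioc a b, Ioc_mem_nhds (by simp only [a]; linarith) (by simp only [b]; linarith), ?_⟩
  have := hg a b hab
  rw [hconst, sub_self] at this
  exact (measureReal_eq_zero_iff).1 this.symm

theorem cf_conj (w : ℂ) : cf l ((starRingEnd ℂ) w) = (starRingEnd ℂ) (cf l w) := by
  simp [cf, map_sum]

theorem cphi_conj (w : ℂ) : cphi l c ((starRingEnd ℂ) w) = (starRingEnd ℂ) (cphi l c w) := by
  simp [cphi, cf_conj]

/-- Images under `φ` of real points where `φ` increases and `ch < 1` are off the support. -/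
theorem WRep.notMem_support (hM : 0 < M) (hc : 0 < c) (hl : ∀ k, 0 < l k) {τ : Measure ℝ}
    {F : ℂ → ℂ} (h : WRep l c τ F) {w₀ x₀ d : ℝ} (hx₀ : 0 < x₀) (hne : ∀ k, l k ≠ w₀)
    (hch : ch l c w₀ < 1) (hphi : cphi l c w₀ = x₀) (hd : 0 < d)
    (hderiv : HasDerivAt (cphi l c) (d : ℂ) (w₀ : ℂ)) : x₀ ∉ τ.support := by
  have := h.finite
  have hneC : ∀ k, (l k : ℂ) - (w₀ : ℂ) ≠ 0 := fun k => by
    rw [← Complex.ofReal_sub, Complex.ofReal_ne_zero]; exact sub_ne_zero.2 (hne k)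
  have hstrict : HasStrictDerivAt (cphi l c) (d : ℂ) (w₀ : ℂ) := by
    have := (analyticAt_cphi (c := c) hneC).hasStrictDerivAt
    rwa [hderiv.deriv] at this
  have hdC : (d : ℂ) ≠ 0 := by exact_mod_cast hd.ne'
  obtain ⟨K, hK, hlip⟩ := h.lip
  set B := ‖F w₀‖ + 1
  have hest := hstrict.isLittleO.bound (half_pos hd)
  rw [nhds_prod_eq] at hest
  obtain ⟨V, hV, hVest⟩ := (Filter.eventually_prod_self_iff (r := fun a b : ℂ =>
    ‖cphi l c a - cphi l c b - (ContinuousLinearMap.toSpanSingleton ℂ (d : ℂ)) (a - b)‖ ≤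
      d / 2 * ‖a - b‖)).1 hest
  obtain ⟨r, hr, hball⟩ : ∃ r > 0, ∀ w ∈ Metric.ball (w₀ : ℂ) r,
      w ∈ V ∧ ch l c w < 1 ∧ ‖F w‖ < B := by
    have e1 := (continuousAt_ch (c := c) hneC).tendsto.eventually_lt_const hch
    have e2 := (h.cont _ hneC).norm.tendsto.eventually_lt_const (lt_add_one ‖F w₀‖)
    exact Metric.eventually_nhds_iff_ball.1 (Filter.Eventually.and hV (e1.and e2))
  have himage : cphi l c '' Metric.ball (w₀ : ℂ) r ∈ 𝓝 (x₀ : ℂ) := by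
    rw [← hphi, ← hstrict.map_nhds_eq hdC]
    exact Filter.image_mem_map (Metric.ball_mem_nhds _ hr)
  obtain ⟨ρ, hρ, hρsub⟩ := Metric.mem_nhds_iff.1 himage
  set δ := min (ρ / 2) (x₀ / 2)
  have hδ : 0 < δ := lt_min (by linarith) (by linarith)
  set K' := (K * (2 / d) * (2 * x₀) + B) / (x₀ / 2) ^ 2
  refine notMem_support_of_im_le τ hδ (K := K') fun x ε hx hε hεδ => ?_
  have hx1 : x₀ / 2 < x ∧ x < 2 * x₀ := by
    have := abs_lt.1 (hx.trans_le (min_le_right _ _))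
    constructor <;> linarith [this.1, this.2]
  set z : ℂ := ⟨x, ε⟩ with hz
  have hzim : z.im = ε := rfl
  have hzre : z.re = x := rfl
  have hzpos : 0 < z.im := hε
  have hzmem : z ∈ Metric.ball (x₀ : ℂ) ρ := by
    rw [Metric.mem_ball, dist_eq_norm]
    refine (Complex.norm_le_abs_re_add_abs_im _).trans_lt ?_
    simp only [Complex.sub_re, Complex.sub_im, Complex.ofReal_re, Complex.ofReal_im, hzim, hzre,
      sub_zero, abs_of_pos hε]
    have := hx.trans_le (min_le_left _ _)
    have := hεδ.trans_le (min_le_left _ _)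
    linarith
  obtain ⟨w, hwball, hwz⟩ := hρsub hzmem
  obtain ⟨hwV, hwch, hwB⟩ := hball w hwball
  have hwcball : (starRingEnd ℂ) w ∈ Metric.ball (w₀ : ℂ) r := by
    rw [Metric.mem_ball, dist_eq_norm] at hwball ⊢
    rw [← Complex.conj_ofReal, ← map_sub, RCLike.norm_conj]
    exact hwball
  -- Comparing `φ` at `w` and at its conjugate by strict differentiability gives `|Im z - d Im w| ≤
  -- (d/2) |Im w|`. Hence `Im w > 0` and `Im w ≤ 2ε/d`.
  have hE := hVest w hwV _ (hball _ hwcball).1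
  simp only [cphi_conj, hwz, Complex.sub_conj, ContinuousLinearMap.toSpanSingleton_apply, smul_eq_mul] at hE
  have hE2 : |z.im - d * w.im| ≤ d / 2 * |w.im| := by
    have e1 : ((2 * z.im : ℝ) : ℂ) * Complex.I - ((2 * w.im : ℝ) : ℂ) * Complex.I * d =
        ((2 * (z.im - d * w.im) : ℝ) : ℂ) * Complex.I := by push_cast; ring
    rw [e1] at hE
    simp only [norm_mul, Complex.norm_I, mul_one, Complex.norm_real, Real.norm_eq_abs,
      abs_two] at hE
    linarith
  rw [hzim] at hE2
  have hwim : 0 < w.im := by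
    by_contra hneg
    rw [not_lt] at hneg
    rw [abs_of_nonpos hneg] at hE2
    have := (abs_le.1 hE2).2
    nlinarith
  have hwim2 : w.im ≤ 2 / d * ε := by
    rw [abs_of_pos hwim] at hE2
    have := (abs_le.1 hE2).1
    rw [div_mul_eq_mul_div, le_div_iff₀ hd]
    linarith
  obtain ⟨v, hv, hvch, hvphi, hvF⟩ := h.rep z hzpos
  -- The local preimage of `z` is the point that represents the transform, so bounds on `F w` become
  -- bounds on the transform.
  have hvw : v = w := w_unique hM hc hl hv hwim hvch hwch (by rw [hvphi, hwz])
    (by rw [hvphi]; exact hzpos)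
  rw [hvw] at hvF
  have hz0 : z ≠ 0 := by intro h0; rw [h0] at hzpos; simp at hzpos
  have hFim : (F w).im ≤ K * (2 / d * ε) :=
    (hlip w hwim hwch).trans (mul_le_mul_of_nonneg_left hwim2 hK)
  have hFim0 := h.im_pos w hwim
  have hFre : -(F w).re ≤ B := (neg_le_abs _).trans ((Complex.abs_re_le_norm _).trans hwB.le)
  have hS : stieltjes τ z = F w / z := by rw [← hvF]; field_simp
  have hns : Complex.normSq z = x ^ 2 + ε ^ 2 := by rw [Complex.normSq_apply, hzim, hzre]; ring
  rw [hS, Complex.div_im, hns, hzim, hzre, ← sub_div]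
  have hnum : (F w).im * x - (F w).re * ε ≤ (K * (2 / d) * (2 * x₀) + B) * ε := by
    have h1 : (F w).im * x ≤ K * (2 / d * ε) * (2 * x₀) :=
      mul_le_mul hFim hx1.2.le (by linarith) (by positivity)
    have h2 := mul_le_mul_of_nonneg_right hFre hε.le
    linarith
  have hK'' : K' * ε = ((K * (2 / d) * (2 * x₀) + B) * ε) / (x₀ / 2) ^ 2 := by
    simp only [K']; ring
  rw [hK'']
  have hden : (x₀ / 2) ^ 2 ≤ x ^ 2 + ε ^ 2 := by
    have := pow_le_pow_left₀ (by linarith) hx1.1.le 2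
    nlinarith
  exact div_le_div₀ (by positivity) hnum (by positivity) hden

end

/-! ### Real analysis of `φ` outside the convex hull of the eigenvalues. -/

section

variable {M : ℕ} {l : Fin M → ℝ} {c : ℝ}

/-- `(1/M) ∑ l / (l - w)` for real `w`. -/
def A1 (l : Fin M → ℝ) (w : ℝ) : ℝ := (1 / M) * ∑ k, l k / (l k - w)

/-- `(1/M) ∑ l² / (l - w)²` for real `w`. -/
def A2 (l : Fin M → ℝ) (w : ℝ) : ℝ := (1 / M) * ∑ k, (l k / (l k - w)) ^ 2

/-- `c w² f(w) (c f(w) - 1)` for real `w`. -/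
def rphi (l : Fin M → ℝ) (c w : ℝ) : ℝ := c * w ^ 2 * A1 l w * (c * A1 l w - 1)

/-- The derivative of `rphi`. -/
def dphi (l : Fin M → ℝ) (c w : ℝ) : ℝ := c * w * (2 * c * A1 l w * A2 l w - A1 l w - A2 l w)

/-- `(1/M) ∑ l`. -/
def mean (l : Fin M → ℝ) : ℝ := (1 / M) * ∑ k, l k

theorem cf_ofReal (w : ℝ) : cf l w = A1 l w := by
  rw [cf, A1]; push_cast; rfl

theorem cphi_ofReal (w : ℝ) : cphi l c w = rphi l c w := by
  rw [cphi, rphi, cf_ofReal]; push_cast; rfl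

theorem ch_ofReal (w : ℝ) : ch l c w = c * A2 l w := by
  rw [ch, A2, ← mul_assoc, mul_one_div]
  congr 1
  refine Finset.sum_congr rfl fun k _ => ?_
  rw [← Complex.ofReal_sub, Complex.norm_real, Real.norm_eq_abs, div_pow, div_pow, sq_abs]

theorem mul_A1_eq {w : ℝ} (h : ∀ k, l k ≠ w) :
    w * A1 l w = (1 / M) * ∑ k, (l k ^ 2 / (l k - w) - l k) := by
  rw [A1]
  simp only [Finset.mul_sum]
  refine Finset.sum_congr rfl fun k _ => ?_
  have := sub_ne_zero.2 (h k)
  field_simp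
  ring

theorem hasDerivAt_mul_A1 {w : ℝ} (h : ∀ k, l k ≠ w) :
    HasDerivAt (fun w => w * A1 l w) (A2 l w) w := by
  have e : (fun w => w * A1 l w) =ᶠ[𝓝 w]
      fun w => (1 / M) * ∑ k, (l k ^ 2 / (l k - w) - l k) := by
    have : ∀ᶠ v in 𝓝 w, ∀ k, l k ≠ v := Filter.eventually_all.2 fun k =>
      (eventually_ne_nhds (h k).symm).mono fun v hv => Ne.symm hv
    filter_upwards [this] with v hv using mul_A1_eq hv
  refine HasDerivAt.congr_of_eventuallyEq ?_ e
  refine HasDerivAt.const_mul _ (HasDerivAt.fun_sum fun k _ => ?_)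
  have h0 := sub_ne_zero.2 (h k)
  have := (((hasDerivAt_const w (l k ^ 2)).div ((hasDerivAt_id w).const_sub (l k)) h0)).sub_const
    (l k)
  refine this.congr_deriv ?_
  rw [div_pow]
  simp

theorem rphi_eq (w : ℝ) : rphi l c w = (c * (w * A1 l w)) * (c * (w * A1 l w) - w) := by
  rw [rphi]; ring

theorem hasDerivAt_rphi {w : ℝ} (h : ∀ k, l k ≠ w) : HasDerivAt (rphi l c) (dphi l c w) w := by
  have h1 := (hasDerivAt_mul_A1 h).const_mul c
  have h2 := h1.mul (h1.sub (hasDerivAt_id w))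
  refine (h2.congr_of_eventuallyEq (Eventually.of_forall fun v => ?_)).congr_deriv ?_
  · exact rphi_eq v
  · simp [dphi]; ring

theorem hasDerivAt_cphi {w : ℝ} (h : ∀ k, l k ≠ w) :
    HasDerivAt (cphi l c) (dphi l c w : ℂ) (w : ℂ) := by
  have hneC : ∀ k, (l k : ℂ) - (w : ℂ) ≠ 0 := fun k => by
    rw [← Complex.ofReal_sub, Complex.ofReal_ne_zero]; exact sub_ne_zero.2 (h k)
  have h1 := (analyticAt_cphi (c := c) hneC).differentiableAt.hasDerivAt
  have h2 := h1.comp_ofReal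
  have h3 := (hasDerivAt_rphi (c := c) h).ofReal_comp
  have e : (fun y : ℝ => cphi l c (y : ℂ)) = fun y : ℝ => ((rphi l c y : ℝ) : ℂ) :=
    funext fun y => cphi_ofReal y
  rw [e] at h2
  rwa [h2.unique h3] at h1

theorem mean_pos (hM : 0 < M) (hl : ∀ k, 0 < l k) : 0 < mean l :=
  mul_pos (by positivity) (Finset.sum_pos (fun k _ => hl k) ⟨⟨0, hM⟩, Finset.mem_univ _⟩)

theorem avg_lt_avg (hM : 0 < M) {f g : Fin M → ℝ} (h : ∀ k, f k < g k) :
    (1 / (M : ℝ)) * ∑ k, f k < (1 / (M : ℝ)) * ∑ k, g k :=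
  mul_lt_mul_of_pos_left (Finset.sum_lt_sum_of_nonempty ⟨⟨0, hM⟩, Finset.mem_univ _⟩
    fun k _ => h k) (by positivity)

theorem avg_le_avg {f g : Fin M → ℝ} (h : ∀ k, f k ≤ g k) :
    (1 / (M : ℝ)) * ∑ k, f k ≤ (1 / (M : ℝ)) * ∑ k, g k :=
  mul_le_mul_of_nonneg_left (Finset.sum_le_sum fun k _ => h k) (by positivity)

theorem avg_const (hM : 0 < M) (r : ℝ) : (1 / (M : ℝ)) * ∑ _k : Fin M, r = r := by
  have : (M : ℝ) ≠ 0 := by positivity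
  simp
  field_simp

theorem A2_pos (hM : 0 < M) (hl : ∀ k, 0 < l k) {w : ℝ} (h : ∀ k, l k ≠ w) : 0 < A2 l w := by
  rw [A2, ← avg_const hM 0]
  refine avg_lt_avg hM fun k => ?_
  have := div_ne_zero (hl k).ne' (sub_ne_zero.2 (h k))
  positivity

/-! ### To the right of the eigenvalues -/

/-- `-w A1 = mean + (1/M) ∑ l² / (w - l)`. -/
def rightG (l : Fin M → ℝ) (w : ℝ) : ℝ := (1 / M) * ∑ k, l k ^ 2 / (w - l k)

/-- The decreasing part of `φ'` to the right of the eigenvalues. -/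
def rightQ (l : Fin M → ℝ) (c w : ℝ) : ℝ :=
  2 * c * (mean l + rightG l w) * A2 l w + (1 / M) * ∑ k, l k ^ 3 / (w - l k) ^ 2

theorem mul_A1_right {w : ℝ} (h : ∀ k, l k < w) : w * A1 l w = -(mean l + rightG l w) := by
  rw [mul_A1_eq fun k => (h k).ne, mean, rightG, ← mul_add, ← Finset.sum_add_distrib, ← mul_neg,
    ← Finset.sum_neg_distrib]
  congr 1
  refine Finset.sum_congr rfl fun k _ => ?_
  rw [← neg_sub w, div_neg]
  ring

theorem rightG_pos (hM : 0 < M) (hl : ∀ k, 0 < l k) {w : ℝ} (h : ∀ k, l k < w) :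
    0 < rightG l w := by
  rw [rightG, ← avg_const hM 0]
  exact avg_lt_avg hM fun k => div_pos (by have := hl k; positivity) (sub_pos.2 (h k))

/-- As `rightQ` is strictly decreasing with limit `0`, this form shows that `φ'` changes sign once,
from negative to positive. -/
theorem dphi_right {w : ℝ} (h : ∀ k, l k < w) : dphi l c w = c * (mean l - rightQ l c w) := by
  have e : w * A2 l w = rightG l w + (1 / M) * ∑ k, l k ^ 3 / (w - l k) ^ 2 := by
    rw [A2, rightG, ← mul_add, ← Finset.sum_add_distrib, mul_left_comm, Finset.mul_sum]
    congr 1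
    refine Finset.sum_congr rfl fun k _ => ?_
    have h1 := (sub_pos.2 (h k)).ne'
    rw [div_pow, ← neg_sub w, neg_sq]
    field_simp
    ring
  have e1 := mul_A1_right h
  have : dphi l c w = c * (2 * c * (w * A1 l w) * A2 l w - w * A1 l w - w * A2 l w) := by
    rw [dphi]; ring
  rw [this, e1, e, rightQ]
  ring

theorem rightQ_lt (hM : 0 < M) (hc : 0 < c) (hl : ∀ k, 0 < l k) {v w : ℝ} (h : ∀ k, l k < v)
    (hvw : v < w) : rightQ l c w < rightQ l c v := by
  have hw : ∀ k, l k < w := fun k => (h k).trans hvw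
  have h1 : rightG l w < rightG l v := avg_lt_avg hM fun k => by
    have := hl k
    exact div_lt_div_of_pos_left (by positivity) (sub_pos.2 (h k)) (by linarith)
  have h2 : A2 l w < A2 l v := avg_lt_avg hM fun k => by
    have := hl k
    have h3 := sub_pos.2 (h k)
    rw [div_pow, div_pow, ← neg_sub w, ← neg_sub v, neg_sq, neg_sq]
    exact div_lt_div_of_pos_left (by positivity) (by positivity)
      (pow_lt_pow_left₀ (by linarith) h3.le two_ne_zero)
  have h3 : (1 / (M : ℝ)) * ∑ k, l k ^ 3 / (w - l k) ^ 2 <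
      (1 / (M : ℝ)) * ∑ k, l k ^ 3 / (v - l k) ^ 2 := avg_lt_avg hM fun k => by
    have := hl k
    have h3 := sub_pos.2 (h k)
    exact div_lt_div_of_pos_left (by positivity) (by positivity)
      (pow_lt_pow_left₀ (by linarith) h3.le two_ne_zero)
  have g := rightG_pos hM hl hw
  have a := A2_pos hM hl fun k => (hw k).ne
  have m := mean_pos hM hl
  have h4 : (mean l + rightG l w) * A2 l w < (mean l + rightG l v) * A2 l v :=
    mul_lt_mul (by linarith) h2.le a (by linarith)
  rw [rightQ, rightQ, mul_assoc, mul_assoc (2 * c)]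
  have := mul_lt_mul_of_pos_left h4 (by positivity : 0 < 2 * c)
  linarith

theorem continuousAt_A2 {w : ℝ} (h : ∀ k, l k ≠ w) : ContinuousAt (A2 l) w := by
  refine continuousAt_const.mul (tendsto_finsetSum _ fun k _ => ?_)
  exact (continuousAt_const.div (continuousAt_const.sub continuousAt_id)
    (sub_ne_zero.2 (h k))).pow 2

theorem continuousAt_A1 {w : ℝ} (h : ∀ k, l k ≠ w) : ContinuousAt (A1 l) w := by
  refine continuousAt_const.mul (tendsto_finsetSum _ fun k _ => ?_)
  exact continuousAt_const.div (continuousAt_const.sub continuousAt_id) (sub_ne_zero.2 (h k))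

theorem continuousAt_dphi {w : ℝ} (h : ∀ k, l k ≠ w) : ContinuousAt (dphi l c) w := by
  have h1 := continuousAt_A1 h
  have h2 := continuousAt_A2 h
  unfold dphi
  fun_prop

theorem tendsto_rightQ : Tendsto (rightQ l c) atTop (𝓝 0) := by
  have h0 : ∀ k, Tendsto (fun w => w - l k) atTop atTop := fun k =>
    tendsto_atTop_add_const_right _ _ tendsto_id
  have hG : Tendsto (rightG l) atTop (𝓝 ((1 / M) * ∑ _k : Fin M, 0)) :=
    tendsto_const_nhds.mul (tendsto_finsetSum _ fun k _ => tendsto_const_nhds.div_atTop (h0 k))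
  have hA : Tendsto (A2 l) atTop (𝓝 ((1 / M) * ∑ _k : Fin M, 0 ^ 2)) := by
    refine tendsto_const_nhds.mul (tendsto_finsetSum _ fun k _ => ?_)
    refine ((tendsto_const_nhds (x := - l k)).div_atTop (h0 k) |>.congr fun w => ?_).pow 2
    rw [← neg_sub (l k), neg_div_neg_eq]
  have hC : Tendsto (fun w => (1 / (M : ℝ)) * ∑ k, l k ^ 3 / (w - l k) ^ 2) atTop
      (𝓝 ((1 / M) * ∑ _k : Fin M, 0)) :=
    tendsto_const_nhds.mul (tendsto_finsetSum _ fun k _ =>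
      tendsto_const_nhds.div_atTop ((tendsto_pow_atTop two_ne_zero).comp (h0 k)))
  have := ((tendsto_const_nhds (x := 2 * c)).mul ((tendsto_const_nhds (x := mean l)).add hG)).mul
    hA |>.add hC
  unfold rightQ
  simpa using this

/-- With `E = c (mean + rightG)`, `φ = E (E + w)` and `E > c mean`. The first bound separates `x₋`
from `x₊`; the second makes `φ` unbounded. -/
theorem sq_lt_rphi_right (hM : 0 < M) (hc : 0 < c) (hl : ∀ k, 0 < l k) {w : ℝ}
    (h : ∀ k, l k < w) : (c * mean l) ^ 2 < rphi l c w ∧ c * mean l * w < rphi l c w := by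
  have g := rightG_pos hM hl h
  have m := mean_pos hM hl
  have hw : 0 < w := (hl ⟨0, hM⟩).trans (h _)
  rw [rphi_eq, mul_A1_right h]
  have hE : c * mean l < c * (mean l + rightG l w) := mul_lt_mul_of_pos_left (by linarith) hc
  have hE0 : 0 < c * mean l := by positivity
  constructor <;> nlinarith

theorem exists_wplus (hM : 0 < M) (hc : 0 < c) (hl : ∀ k, 0 < l k) :
    ∃ wp : ℝ, (∀ k, l k < wp) ∧
      (∀ w, (∀ k, l k < w) → (dphi l c w = 0 ↔ w = wp) ∧ rphi l c wp ≤ rphi l c w) ∧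
      ∀ x, rphi l c wp < x → ∃ w, (∀ k, l k < w) ∧ rphi l c w = x ∧ 0 < dphi l c w := by
  have m := mean_pos hM hl
  have hMR : (0 : ℝ) < M := by exact_mod_cast hM
  obtain ⟨j, -, hj⟩ := Finset.exists_max_image Finset.univ l ⟨⟨0, hM⟩, Finset.mem_univ _⟩
  have hj : ∀ k, l k ≤ l j := fun k => hj k (Finset.mem_univ k)
  have hne : ∀ {w}, (∀ k, l k < w) → ∀ k, l k ≠ w := fun h k => (h k).ne
  -- At distance `r` from the largest eigenvalue, its own term in the cubic sum equals `M * mean l`,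
  -- which already makes `rightQ` exceed the mean.
  set r := Real.sqrt (l j ^ 3 / (M * mean l))
  have hr0 : 0 < l j ^ 3 / (M * mean l) := by have := hl j; positivity
  have hr : 0 < r := Real.sqrt_pos.2 hr0
  set wa := l j + r
  have hwa : ∀ k, l k < wa := fun k => by have := hj k; simp only [wa]; linarith
  have hQa : mean l < rightQ l c wa := by
    have h1 : mean l ≤ (1 / M) * ∑ k, l k ^ 3 / (wa - l k) ^ 2 := by
      have h2 : l j ^ 3 / (wa - l j) ^ 2 ≤ ∑ k, l k ^ 3 / (wa - l k) ^ 2 :=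
        Finset.single_le_sum (f := fun k => l k ^ 3 / (wa - l k) ^ 2)
          (fun k _ => by have := hl k; positivity) (Finset.mem_univ j)
      have h3 : l j ^ 3 / (wa - l j) ^ 2 = M * mean l := by
        have : (wa - l j) ^ 2 = l j ^ 3 / (M * mean l) := by
          simp only [wa, add_sub_cancel_left]; exact Real.sq_sqrt hr0.le
        rw [this]
        have := (hl j).ne'
        field_simp
      rw [h3] at h2
      calc mean l = (1 / M) * (M * mean l) := by field_simp
        _ ≤ _ := mul_le_mul_of_nonneg_left h2 (by positivity)
    have h4 : 0 < 2 * c * (mean l + rightG l wa) * A2 l wa := by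
      have := rightG_pos hM hl hwa
      have := A2_pos hM hl (hne hwa)
      positivity
    rw [rightQ]; linarith
  obtain ⟨wb, hwb, hwab⟩ := ((tendsto_rightQ (l := l) (c := c)).eventually_lt_const m |>.and
    (eventually_gt_atTop wa)).exists
  have hge : ∀ {w}, wa ≤ w → ∀ k, l k < w := fun h k => (hwa k).trans_le h
  have hda : dphi l c wa < 0 := by rw [dphi_right hwa]; nlinarith
  have hdb : 0 < dphi l c wb := by rw [dphi_right (hge hwab.le)]; nlinarith
  obtain ⟨wp, ⟨hp1, -⟩, hp0⟩ := intermediate_value_Icc hwab.le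
    (fun w hw => (continuousAt_dphi (c := c) (hne (hge hw.1))).continuousWithinAt)
    (⟨hda.le, hdb.le⟩ : (0 : ℝ) ∈ Set.Icc (dphi l c wa) (dphi l c wb))
  have hwp := hge hp1
  have hQp : rightQ l c wp = mean l := by
    rw [dphi_right hwp] at hp0
    rcases mul_eq_zero.1 hp0 with h | h <;> linarith
  have hpos : ∀ w, wp < w → 0 < dphi l c w := fun w hw => by
    rw [dphi_right fun k => (hwp k).trans hw]
    have := rightQ_lt hM hc hl hwp hw
    exact mul_pos hc (by linarith)
  have hneg : ∀ w, (∀ k, l k < w) → w < wp → dphi l c w < 0 := fun w hl' hw => by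
    rw [dphi_right hl']
    have := rightQ_lt hM hc hl hl' hw
    exact mul_neg_of_pos_of_neg hc (by linarith)
  have hcont : ∀ w, (∀ k, l k < w) → ContinuousAt (rphi l c) w := fun w h =>
    (hasDerivAt_rphi (hne h)).continuousAt
  refine ⟨wp, hwp, fun w hw => ⟨⟨fun h0 => ?_, fun h => h ▸ hp0⟩, ?_⟩, fun x hx => ?_⟩
  · rcases lt_trichotomy w wp with h | h | h
    · exact absurd h0 (hneg w hw h).ne
    · exact h
    · exact absurd h0 (hpos w h).ne'
  · rcases le_total w wp with h | h
    · refine antitoneOn_of_deriv_nonpos (convex_Icc w wp)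
        (fun v hv => (hcont v fun k => (hw k).trans_le hv.1).continuousWithinAt)
        (fun v hv => ?_) (fun v hv => ?_) ⟨le_rfl, h⟩ ⟨h, le_rfl⟩ h
      · rw [interior_Icc] at hv
        exact (hasDerivAt_rphi (hne fun k => (hw k).trans hv.1)).differentiableAt.differentiableWithinAt
      · rw [interior_Icc] at hv
        rw [(hasDerivAt_rphi (hne fun k => (hw k).trans hv.1)).deriv]
        exact (hneg v (fun k => (hw k).trans hv.1) hv.2).le
    · refine monotoneOn_of_deriv_nonneg (convex_Icc wp w)
        (fun v hv => (hcont v fun k => (hwp k).trans_le hv.1).continuousWithinAt)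
        (fun v hv => ?_) (fun v hv => ?_) ⟨le_rfl, h⟩ ⟨h, le_rfl⟩ h
      · rw [interior_Icc] at hv
        exact (hasDerivAt_rphi (hne fun k => (hwp k).trans hv.1)).differentiableAt.differentiableWithinAt
      · rw [interior_Icc] at hv
        rw [(hasDerivAt_rphi (hne fun k => (hwp k).trans hv.1)).deriv]
        exact (hpos v hv.1).le
  · set wc := max wp (x / (c * mean l))
    have hwc : ∀ k, l k < wc := fun k => (hwp k).trans_le (le_max_left _ _)
    have hxc : x ≤ rphi l c wc := by
      refine le_trans ?_ (sq_lt_rphi_right hM hc hl hwc).2.le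
      have h1 : x / (c * mean l) ≤ wc := le_max_right _ _
      rw [div_le_iff₀ (by positivity)] at h1
      linarith
    obtain ⟨w, ⟨hw1, -⟩, hwx⟩ := intermediate_value_Icc (le_max_left wp (x / (c * mean l)))
      (fun v hv => (hcont v fun k => (hwp k).trans_le hv.1).continuousWithinAt)
      (⟨hx.le, hxc⟩ : x ∈ Set.Icc (rphi l c wp) (rphi l c wc))
    have hlt : wp < w := lt_of_le_of_ne hw1 (by rintro rfl; exact hx.ne hwx)
    exact ⟨w, fun k => (hwp k).trans hlt, hwx, hpos w hlt⟩

theorem A1_neg_right (hM : 0 < M) (hl : ∀ k, 0 < l k) {w : ℝ} (h : ∀ k, l k < w) :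
    A1 l w < 0 := by
  rw [A1, ← avg_const hM 0]
  exact avg_lt_avg hM fun k => div_neg_of_pos_of_neg (hl k) (sub_neg.2 (h k))

/-- On the increasing branch to the right, `c A2 < 1`. -/
theorem mul_A2_lt_one_right (hM : 0 < M) (hc : 0 < c) (hl : ∀ k, 0 < l k) {w : ℝ}
    (h : ∀ k, l k < w) (hd : 0 < dphi l c w) : c * A2 l w < 1 := by
  have h1 := A1_neg_right hM hl h
  have h2 := A2_pos hM hl fun k => (h k).ne
  have hw : 0 < w := (hl ⟨0, hM⟩).trans (h _)
  -- The bracket is `A1 (2 c A2 - 1) - A2` with `A1 < 0 < A2`, hence negative if `c A2 ≥ 1`.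
  have h3 : 0 < 2 * c * A1 l w * A2 l w - A1 l w - A2 l w :=
    pos_of_mul_pos_right hd (by positivity)
  by_contra hge
  rw [not_lt] at hge
  nlinarith

/-! ### To the left of the eigenvalues -/

theorem A1_pos_left (hM : 0 < M) (hl : ∀ k, 0 < l k) {w : ℝ} (h : ∀ k, w < l k) : 0 < A1 l w := by
  rw [A1, ← avg_const hM 0]
  exact avg_lt_avg hM fun k => div_pos (hl k) (sub_pos.2 (h k))

theorem A1_zero (hM : 0 < M) (hl : ∀ k, 0 < l k) : A1 l 0 = 1 := by
  refine Eq.trans ?_ (avg_const hM 1)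
  simp [A1, div_self (hl _).ne']

theorem A2_zero (hM : 0 < M) (hl : ∀ k, 0 < l k) : A2 l 0 = 1 := by
  refine Eq.trans ?_ (avg_const hM 1)
  simp [A2, div_self (hl _).ne']

theorem A1_lt_A1 (hM : 0 < M) (hl : ∀ k, 0 < l k) {v w : ℝ} (hvw : v < w) (h : ∀ k, w < l k) :
    A1 l v < A1 l w :=
  avg_lt_avg hM fun k => div_lt_div_of_pos_left (hl k) (sub_pos.2 (h k)) (by linarith)

theorem A2_lt_A2 (hM : 0 < M) (hl : ∀ k, 0 < l k) {v w : ℝ} (hvw : v < w) (h : ∀ k, w < l k) :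
    A2 l v < A2 l w := by
  refine avg_lt_avg hM fun k => pow_lt_pow_left₀
    (div_lt_div_of_pos_left (hl k) (sub_pos.2 (h k)) (by linarith)) ?_ two_ne_zero
  exact (div_pos (hl k) (by linarith [h k])).le

theorem A2_lt_A1 (hM : 0 < M) (hl : ∀ k, 0 < l k) {w : ℝ} (hw : w < 0) : A2 l w < A1 l w := by
  refine avg_lt_avg hM fun k => ?_
  have h1 : 0 < l k / (l k - w) := div_pos (hl k) (by linarith [hl k])
  have h2 : l k / (l k - w) < 1 := (div_lt_one (by linarith [hl k])).2 (by linarith)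
  nlinarith

theorem A1_le_A2 {w : ℝ} (hw : 0 ≤ w) (h : ∀ k, w < l k) : A1 l w ≤ A2 l w := by
  refine avg_le_avg fun k => ?_
  have h2 : 1 ≤ l k / (l k - w) := (one_le_div (by linarith [h k])).2 (by linarith)
  nlinarith

/-- Between `0` and the eigenvalues, `c A2 ≤ 1` forces `φ ≤ 0`. -/
theorem rphi_nonpos_middle (hM : 0 < M) (hc : 0 < c) (hl : ∀ k, 0 < l k) {w : ℝ} (hw : 0 ≤ w)
    (h : ∀ k, w < l k) (hA : c * A2 l w ≤ 1) : rphi l c w ≤ 0 := by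
  have h1 := A1_pos_left hM hl h
  have h2 : c * A1 l w ≤ c * A2 l w := mul_le_mul_of_nonneg_left (A1_le_A2 hw h) hc.le
  exact mul_nonpos_of_nonneg_of_nonpos (by positivity) (by linarith)

/-- For `w < 0`, `A1 l w < A1 l 0 = 1 ≤ 1/c`, so the last factor of `φ` is negative. -/
theorem rphi_neg_left (hM : 0 < M) (hc : 0 < c) (hc1 : c ≤ 1) (hl : ∀ k, 0 < l k) {w : ℝ}
    (hw : w < 0) : rphi l c w < 0 := by
  have h1 := A1_pos_left hM hl fun k => hw.trans (hl k)
  have h2 := A1_lt_A1 hM hl hw hl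
  rw [A1_zero hM hl] at h2
  refine mul_neg_of_pos_of_neg ?_ (by nlinarith)
  have : 0 < w ^ 2 := by have := hw.ne; positivity
  positivity

/-- The prefactor is positive, so the sign of `φ'` is that of `1/A1 + 1/A2 - 2c`, which decreases in
`w`. -/
theorem dphi_left (hM : 0 < M) (hl : ∀ k, 0 < l k) {w : ℝ} (hw : w < 0) :
    dphi l c w = c * (-w) * A1 l w * A2 l w * (1 / A1 l w + 1 / A2 l w - 2 * c) := by
  have h1 := (A1_pos_left hM hl fun k => hw.trans (hl k)).ne'
  have h2 := (A2_pos hM hl fun k => (hw.trans (hl k)).ne').ne'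
  rw [dphi]
  field_simp
  ring

theorem exists_wminus (hM : 0 < M) (hc : 1 < c) (hl : ∀ k, 0 < l k) :
    ∃ ω wm : ℝ, A1 l ω = 1 / c ∧ (∀ v, v < ω → A1 l v < 1 / c) ∧ ω < wm ∧ wm < 0 ∧
      (∀ w, w < 0 → (dphi l c w = 0 ↔ w = wm)) ∧ (∀ w, w < 0 → rphi l c w ≤ rphi l c wm) ∧
      0 < rphi l c wm ∧ rphi l c wm < (c * mean l) ^ 2 ∧
      ∀ x, 0 < x → x < rphi l c wm →
        ∃ w, w < 0 ∧ rphi l c w = x ∧ 0 < dphi l c w ∧ c * A2 l w < 1 := by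
  have hc0 : 0 < c := by linarith
  have m := mean_pos hM hl
  have hlt : ∀ {w : ℝ}, w ≤ 0 → ∀ k, w < l k := fun h k => h.trans_lt (hl k)
  have hne : ∀ {w : ℝ}, w ≤ 0 → ∀ k, l k ≠ w := fun h k => (hlt h k).ne'
  have p1 : ∀ {w : ℝ}, w ≤ 0 → 0 < A1 l w := fun h => A1_pos_left hM hl (hlt h)
  have p2 : ∀ {w : ℝ}, w ≤ 0 → 0 < A2 l w := fun h => A2_pos hM hl (hne h)
  -- At this point `l/(l + c mean) < l/(c mean)`, and the average of the right-hand side is `1/c`.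
  have hstart : A1 l (-(c * mean l)) < 1 / c := by
    have e : 1 / c = (1 / M) * ∑ k, l k / (c * mean l) := by
      rw [← Finset.sum_div, ← mul_div_assoc]
      change 1 / c = mean l / (c * mean l)
      field_simp
    rw [e]
    refine avg_lt_avg hM fun k => div_lt_div_of_pos_left (hl k) (by positivity) ?_
    linarith [hl k]
  have h1c : 1 / c < 1 := (div_lt_one hc0).2 hc
  have hcm : -(c * mean l) ≤ 0 := by have : 0 < c * mean l := by positivity
                                     linarith
  obtain ⟨ω, ⟨-, hω0⟩, hω⟩ := intermediate_value_Icc hcm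
    (fun w hw => (continuousAt_A1 (hne hw.2)).continuousWithinAt)
    (⟨hstart.le, by rw [A1_zero hM hl]; exact h1c.le⟩ :
      1 / c ∈ Set.Icc (A1 l (-(c * mean l))) (A1 l 0))
  have hωneg : ω < 0 := lt_of_le_of_ne hω0 (by rintro rfl; rw [A1_zero hM hl] at hω; linarith)
  set H : ℝ → ℝ := fun w => 1 / A1 l w + 1 / A2 l w with hH
  have hHanti : ∀ v w : ℝ, v < w → w ≤ 0 → H w < H v := fun v w hvw hw =>
    add_lt_add (one_div_lt_one_div_of_lt (p1 (hvw.le.trans hw)) (A1_lt_A1 hM hl hvw (hlt hw)))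
      (one_div_lt_one_div_of_lt (p2 (hvw.le.trans hw)) (A2_lt_A2 hM hl hvw (hlt hw)))
  -- `H` crosses `2 c` between `ω` and `0`: at `ω`, `1/A1 = c` and `1/A2 > 1/A1`; at `0`, `H = 2 < 2
  -- c`.
  have hHω : 2 * c < H ω := by
    have h2 := one_div_lt_one_div_of_lt (p2 hω0) (A2_lt_A1 hM hl hωneg)
    simp only [hH]
    rw [hω, one_div_one_div] at h2 ⊢
    linarith
  have hH0 : H 0 < 2 * c := by simp only [hH]; rw [A1_zero hM hl, A2_zero hM hl]; linarith
  obtain ⟨wm, ⟨hm1, hm2⟩, hHm⟩ := intermediate_value_Icc' hω0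
    (fun w hw => ((continuousAt_const.div (continuousAt_A1 (hne hw.2)) (p1 hw.2).ne').add
      (continuousAt_const.div (continuousAt_A2 (hne hw.2)) (p2 hw.2).ne')).continuousWithinAt)
    (⟨hH0.le, hHω.le⟩ : 2 * c ∈ Set.Icc (H 0) (H ω))
  change H wm = 2 * c at hHm
  have hωm : ω < wm := lt_of_le_of_ne hm1 (by rintro rfl; linarith)
  have hm0 : wm < 0 := lt_of_le_of_ne hm2 (by rintro rfl; linarith)
  have hfac : ∀ w, w < 0 → 0 < c * (-w) * A1 l w * A2 l w := fun w hw => by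
    have := p1 hw.le
    have := p2 hw.le
    have : 0 < -w := by linarith
    positivity
  have hpos : ∀ w, w < wm → 0 < dphi l c w := fun w hw => by
    rw [dphi_left hM hl (hw.trans hm0)]
    have := hHanti w wm hw hm0.le
    exact mul_pos (hfac w (hw.trans hm0)) (by simp only [hH] at this hHm; linarith)
  have hneg : ∀ w, w < 0 → wm < w → dphi l c w < 0 := fun w hw hw' => by
    rw [dphi_left hM hl hw]
    have := hHanti wm w hw' hw.le
    exact mul_neg_of_pos_of_neg (hfac w hw) (by simp only [hH] at this hHm; linarith)
  have hcont : ∀ w, w ≤ 0 → ContinuousAt (rphi l c) w := fun w h =>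
    (hasDerivAt_rphi (hne h)).continuousAt
  have hA1m : 1 / c < A1 l wm := hω ▸ A1_lt_A1 hM hl hωm (hlt hm0.le)
  refine ⟨ω, wm, hω, fun v hv => hω ▸ A1_lt_A1 hM hl hv (hlt hω0), hωm, hm0, fun w hw =>
    ⟨fun h0 => ?_, fun h => ?_⟩, fun w hw => ?_, ?_, ?_, fun x hx0 hx => ?_⟩
  · rcases lt_trichotomy w wm with h | h | h
    · exact absurd h0 (hpos w h).ne'
    · exact h
    · exact absurd h0 (hneg w hw h).ne
  · rw [h, dphi_left hM hl hm0]
    simp only [hH] at hHm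
    rw [hHm]; ring
  · rcases le_total w wm with h | h
    · refine monotoneOn_of_deriv_nonneg (convex_Icc w wm)
        (fun v hv => (hcont v (hv.2.trans hm0.le)).continuousWithinAt)
        (fun v hv => ?_) (fun v hv => ?_) ⟨le_rfl, h⟩ ⟨h, le_rfl⟩ h
      · rw [interior_Icc] at hv
        exact (hasDerivAt_rphi (hne (hv.2.trans hm0).le)).differentiableAt.differentiableWithinAt
      · rw [interior_Icc] at hv
        rw [(hasDerivAt_rphi (hne (hv.2.trans hm0).le)).deriv]
        exact (hpos v hv.2).le
    · refine antitoneOn_of_deriv_nonpos (convex_Icc wm w)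
        (fun v hv => (hcont v (hv.2.trans hw.le)).continuousWithinAt)
        (fun v hv => ?_) (fun v hv => ?_) ⟨le_rfl, h⟩ ⟨h, le_rfl⟩ h
      · rw [interior_Icc] at hv
        exact (hasDerivAt_rphi (hne (hv.2.trans hw).le)).differentiableAt.differentiableWithinAt
      · rw [interior_Icc] at hv
        rw [(hasDerivAt_rphi (hne (hv.2.trans hw).le)).deriv]
        exact (hneg v (hv.2.trans hw) hv.1).le
  · rw [div_lt_iff₀ hc0] at hA1m
    have := p1 hm0.le
    have : 0 < wm ^ 2 := by have := hm0.ne; positivity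
    exact mul_pos (by positivity) (by linarith)
  -- With `g = -(w A1)` in `(0, mean)`, `φ = c g (c g + w) < (c g)²` because `w < 0`.
  · have h1 : 0 < -(wm * A1 l wm) := by have := p1 hm0.le; nlinarith
    have h2 : -(wm * A1 l wm) < mean l := by
      rw [A1, mean, ← mul_neg_one, mul_comm, ← mul_assoc, mul_left_comm, Finset.mul_sum]
      refine avg_lt_avg hM fun k => ?_
      have h3 : 0 < l k - wm := sub_pos.2 (hlt hm0.le k)
      have h4 : -1 * wm * (l k / (l k - wm)) = l k * (-wm / (l k - wm)) := by ring
      rw [h4]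
      have h5 : -wm / (l k - wm) < 1 := (div_lt_one h3).2 (by linarith [hl k])
      nlinarith [hl k]
    rw [rphi_eq]
    have h3 : 0 < c * -(wm * A1 l wm) := by positivity
    have h4 := mul_lt_mul_of_pos_left h2 hc0
    nlinarith
  · have hω_zero : rphi l c ω = 0 := by rw [rphi, hω]; field_simp; ring
    obtain ⟨w, ⟨hw1, hw2⟩, hwx⟩ := intermediate_value_Icc hωm.le
      (fun v hv => (hcont v (hv.2.trans hm0.le)).continuousWithinAt)
      (⟨by rw [hω_zero]; exact hx0.le, hx.le⟩ : x ∈ Set.Icc (rphi l c ω) (rphi l c wm))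
    have hw3 : w < wm := lt_of_le_of_ne hw2 (by rintro rfl; exact hx.ne' hwx)
    have hw0 : w < 0 := hw3.trans hm0
    refine ⟨w, hw0, hwx, hpos w hw3, ?_⟩
    -- `1/A1 + 1/A2 > 2 c` and `1/A2 > 1/A1` give `1/A2 > c`.
    have h2 := one_div_lt_one_div_of_lt (p2 hw0.le) (A2_lt_A1 hM hl hw0)
    have h3 := hHanti w wm hw3 hm0.le
    simp only [hH] at h3 hHm
    have h4 : c < 1 / A2 l w := by linarith
    exact (lt_div_iff₀ (p2 hw0.le)).1 h4

end

/-! ### Supports of μ and ν once `w` is confined to the two outer half-lines. -/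

section

variable {M : ℕ} {l : Fin M → ℝ} {c : ℝ}

theorem wRep_mu (hM : 0 < M) (hc : 0 < c) (hl : ∀ k, 0 < l k) {μ : Measure ℝ}
    [IsFiniteMeasure μ] (h : ∀ z : ℂ, 0 < z.im → IsScalarSol l c z (stieltjes μ z)) :
    WRep l c μ (fun w => w * cf l w) where
  finite := inferInstance
  rep z hz := by
    have hW := (h z hz).wData hc hz
    exact ⟨_, hW.im_pos, hW.ch_lt, hW.cphi_eq, hW.mul_eq⟩
  cont w hw := continuousAt_id.mul (analyticAt_cf hw).continuousAt
  im_pos w hw := by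
    have hne : ∀ k, (l k : ℂ) - w ≠ 0 := fun k => ofReal_sub_ne_zero _ hw
    rw [mul_cf_im hc.ne' hne]
    have := ch_pos hM hc hl hne
    positivity
  lip := by
    refine ⟨1 / c, by positivity, fun w hw hch => ?_⟩
    rw [mul_cf_im hc.ne' fun k => ofReal_sub_ne_zero _ hw, mul_comm]
    gcongr

theorem wRep_nu (hM : 0 < M) (hc : 0 < c) (hl : ∀ k, 0 < l k) {μ ν : Measure ℝ}
    [IsFiniteMeasure ν] (h : ∀ z : ℂ, 0 < z.im → IsScalarSol l c z (stieltjes μ z))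
    (hν : ∀ z : ℂ, 0 < z.im →
      stieltjes ν z = (1 / (M : ℂ)) * ∑ k, scalarT (l k) c z (stieltjes μ z)) :
    WRep l c ν (fun w => cf l w - 1) where
  finite := inferInstance
  rep z hz := by
    have hW := (h z hz).wData hc hz
    refine ⟨_, hW.im_pos, hW.ch_lt, hW.cphi_eq, ?_⟩
    rw [hν z hz, hW.sum_scalarT hM hz]
  cont w hw := (analyticAt_cf hw).continuousAt.sub continuousAt_const
  im_pos w hw := by
    rw [Complex.sub_im, Complex.one_im, sub_zero, cf_im]
    refine mul_pos hw ?_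
    conv_lhs => rw [← avg_const hM 0]
    refine avg_lt_avg hM fun k => ?_
    have := norm_pos_iff.2 (ofReal_sub_ne_zero (l k) hw)
    have := hl k
    positivity
  lip := by
    -- `sq_le_of_ch_le` gives `l/|l - w|² ≤ M/(c l)` term by term.
    refine ⟨(1 / M) * ∑ k, M / (c * l k), ?_, fun w hw hch => ?_⟩
    · exact mul_nonneg (by positivity) (Finset.sum_nonneg fun k _ => by have := hl k; positivity)
    rw [Complex.sub_im, Complex.one_im, sub_zero, cf_im, mul_comm]
    refine mul_le_mul_of_nonneg_right (avg_le_avg fun k => ?_) hw.le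
    have hne := ofReal_sub_ne_zero (l k) hw
    have h1 := sq_le_of_ch_le hc hch.le k hne
    have h2 := norm_pos_iff.2 hne
    have h3 := hl k
    have hMR : (0 : ℝ) < M := by exact_mod_cast hM
    rw [div_le_div_iff₀ (by positivity) (by positivity)]
    have h4 := mul_le_mul_of_nonneg_left h1 hMR.le
    have h5 : M * (c / M * l k ^ 2) = c * l k ^ 2 := by field_simp
    nlinarith

/-- The only real points with `c A2 ≤ 1` lie outside the convex hull of the eigenvalues. -/
def OutsideOnly (l : Fin M → ℝ) (c : ℝ) : Prop :=
  ∀ w : ℝ, (∀ k, l k ≠ w) → c * A2 l w ≤ 1 → (∀ k, w < l k) ∨ (∀ k, l k < w)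

/-- Off the support, `x` would be `φ(w)` for a real `w` with `c A2 ≤ 1`. Each of the three possible
locations is excluded: values are too small for `w < 0`, nonpositive between `0` and the
eigenvalues, too large beyond them. -/
theorem WRep.mem_support (hM : 0 < M) (hc : 0 < c) (hl : ∀ k, 0 < l k) (hout : OutsideOnly l c)
    {τ : Measure ℝ} {F : ℂ → ℂ} (h : WRep l c τ F) {x : ℝ} (hx0 : 0 < x)
    (hleft : ∀ w, w < 0 → rphi l c w < x) (hright : ∀ w, (∀ k, l k < w) → x < rphi l c w) :
    x ∈ τ.support := by
  by_contra hx
  obtain ⟨w, hne, hch, hphi, -⟩ := h.exists_real hM hc hl hx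
  rw [ch_ofReal] at hch
  have hwx : rphi l c w = x := by
    rw [cphi_ofReal] at hphi
    exact_mod_cast hphi
  rcases hout w hne hch with hw | hw
  · rcases lt_or_ge w 0 with hw0 | hw0
    · exact (hleft w hw0).ne hwx
    · have := rphi_nonpos_middle hM hc hl hw0 hw hch
      linarith
  · exact (hright w hw).ne' hwx

theorem WRep.notMem_support_real (hM : 0 < M) (hc : 0 < c) (hl : ∀ k, 0 < l k) {τ : Measure ℝ}
    {F : ℂ → ℂ} (h : WRep l c τ F) {w x : ℝ} (hx : 0 < x) (hne : ∀ k, l k ≠ w)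
    (hA : c * A2 l w < 1) (hphi : rphi l c w = x) (hd : 0 < dphi l c w) : x ∉ τ.support :=
  h.notMem_support hM hc hl hx hne (by rwa [ch_ofReal]) (by rw [cphi_ofReal, hphi]) hd
    (hasDerivAt_cphi hne)

theorem notMem_support_of_neg {τ : Measure ℝ} (h : τ (Set.Iio 0) = 0) {x : ℝ} (hx : x < 0) :
    x ∉ τ.support :=
  Measure.notMem_support_iff_exists.2 ⟨_, Iio_mem_nhds hx, h⟩

theorem WRep.support_eq_of_le_one (hM : 0 < M) (hc : 0 < c) (hc1 : c ≤ 1) (hl : ∀ k, 0 < l k)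
    (hout : OutsideOnly l c) {τ : Measure ℝ} {F : ℂ → ℂ} (h : WRep l c τ F)
    (h0 : τ (Set.Iio 0) = 0) {xp : ℝ} (hxp : 0 < xp)
    (hmin : ∀ w, (∀ k, l k < w) → xp ≤ rphi l c w)
    (hbig : ∀ x, xp < x → ∃ w, (∀ k, l k < w) ∧ rphi l c w = x ∧ 0 < dphi l c w) :
    τ.support = Set.Icc 0 xp := by
  apply Set.Subset.antisymm
  · intro x hx
    refine ⟨not_lt.1 fun hneg => notMem_support_of_neg h0 hneg hx, not_lt.1 fun hgt => ?_⟩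
    obtain ⟨w, hw, hwx, hd⟩ := hbig x hgt
    exact h.notMem_support_real hM hc hl (hxp.trans hgt) (fun k => (hw k).ne)
      (mul_A2_lt_one_right hM hc hl hw hd) hwx hd hx
  · rw [← closure_Ioo hxp.ne]
    refine closure_minimal (fun x hx => ?_) Measure.isClosed_support
    exact h.mem_support hM hc hl hout hx.1
      (fun w hw => (rphi_neg_left hM hc hc1 hl hw).trans hx.1)
      fun w hw => hx.2.trans_le (hmin w hw)

theorem WRep.support_eq_of_one_lt (hM : 0 < M) (hc : 1 < c) (hl : ∀ k, 0 < l k)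
    (hout : OutsideOnly l c) {τ : Measure ℝ} {F : ℂ → ℂ} (h : WRep l c τ F)
    (h0 : τ (Set.Iio 0) = 0) (hzero : (0 : ℝ) ∈ τ.support) {xm xp : ℝ} (hxm : 0 < xm)
    (hmp : xm < xp) (hmin : ∀ w, (∀ k, l k < w) → xp ≤ rphi l c w)
    (hbig : ∀ x, xp < x → ∃ w, (∀ k, l k < w) ∧ rphi l c w = x ∧ 0 < dphi l c w)
    (hmax : ∀ w, w < 0 → rphi l c w ≤ xm)
    (hsmall : ∀ x, 0 < x → x < xm →
      ∃ w, w < 0 ∧ rphi l c w = x ∧ 0 < dphi l c w ∧ c * A2 l w < 1) :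
    τ.support = {0} ∪ Set.Icc xm xp := by
  have hc0 : 0 < c := by linarith
  apply Set.Subset.antisymm
  · intro x hx
    rcases lt_trichotomy x 0 with hx0 | rfl | hx0
    · exact absurd hx (notMem_support_of_neg h0 hx0)
    · exact Or.inl rfl
    · refine Or.inr ⟨not_lt.1 fun hlt => ?_, not_lt.1 fun hgt => ?_⟩
      · obtain ⟨w, hw, hwx, hd, hA⟩ := hsmall x hx0 hlt
        exact h.notMem_support_real hM hc0 hl hx0 (fun k => (hw.trans (hl k)).ne') hA hwx hd hx
      · obtain ⟨w, hw, hwx, hd⟩ := hbig x hgt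
        exact h.notMem_support_real hM hc0 hl hx0 (fun k => (hw k).ne)
          (mul_A2_lt_one_right hM hc0 hl hw hd) hwx hd hx
  · refine Set.union_subset (Set.singleton_subset_iff.2 hzero) ?_
    rw [← closure_Ioo hmp.ne]
    refine closure_minimal (fun x hx => ?_) Measure.isClosed_support
    exact h.mem_support hM hc0 hl hout (hxm.trans hx.1)
      (fun w hw => (hmax w hw).trans_lt hx.1) fun w hw => hx.2.trans_le (hmin w hw)

/-- Otherwise `w A1 = 0` at some admissible real `w`; but `A1` does not vanish outside the hull, and
at `w = 0` one has `c A2 = c > 1`. -/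
theorem zero_mem_support_mu (hM : 0 < M) (hc : 1 < c) (hl : ∀ k, 0 < l k)
    (hout : OutsideOnly l c) {τ : Measure ℝ} (h : WRep l c τ (fun w => w * cf l w)) :
    (0 : ℝ) ∈ τ.support := by
  by_contra hx
  have hc0 : 0 < c := by linarith
  obtain ⟨w, hne, hch, -, hF⟩ := h.exists_real hM hc0 hl hx
  rw [ch_ofReal] at hch
  rw [Complex.ofReal_zero, zero_mul, cf_ofReal, ← Complex.ofReal_mul, Complex.ofReal_eq_zero] at hF
  rcases mul_eq_zero.1 hF with rfl | hA
  · rw [A2_zero hM hl] at hch; linarith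
  · rcases hout w hne hch with hw | hw
    · exact (A1_pos_left hM hl hw).ne' hA
    · exact (A1_neg_right hM hl hw).ne hA

/-- Otherwise `A1 = 1` and `φ(w) = c w² (c - 1) = 0`, which forces `w = 0`, where `c A2 = c > 1`. -/
theorem zero_mem_support_nu (hM : 0 < M) (hc : 1 < c) (hl : ∀ k, 0 < l k)
    {τ : Measure ℝ} (h : WRep l c τ (fun w => cf l w - 1)) :
    (0 : ℝ) ∈ τ.support := by
  by_contra hx
  have hc0 : 0 < c := by linarith
  obtain ⟨w, hne, hch, hphi, hF⟩ := h.exists_real hM hc0 hl hx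
  rw [ch_ofReal] at hch
  rw [Complex.ofReal_zero, zero_mul, cf_ofReal, ← Complex.ofReal_one, ← Complex.ofReal_sub,
    Complex.ofReal_eq_zero, sub_eq_zero] at hF
  rw [cphi_ofReal, Complex.ofReal_inj, rphi, hF] at hphi
  have hw : w = 0 := by
    have h1 : c * w ^ 2 * (c - 1) = 0 := by linarith
    have h2 : c - 1 ≠ 0 := by linarith
    simpa [hc0.ne', h2] using h1
  rw [hw, A2_zero hM hl] at hch
  linarith

/-! ### The spacing condition -/

/-- Let `e (j+1) < w < e j`. The `(i+1)`-st value on either side of `w` is no farther from `w` than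
from the neighbour of `w` on the other side, `i + 1` indices away, so its term is at least `n/(κ²
(i+1))`. One of the two sides contains at least `n / 2` values. -/
theorem sum_inv_sq_ge {n : ℕ} {e : Fin n → ℝ} (he : Antitone e) {κ : ℝ} (hκ : 0 < κ)
    (h : ∀ k m : Fin n, k ≤ m →
      |e k - e m| ≤ κ * (|((k : ℕ) : ℝ) - ((m : ℕ) : ℝ)| / n) ^ (1 / 2 : ℝ))
    {w : ℝ} (hne : ∀ k, e k ≠ w) (h1 : ∃ k, w < e k) (h2 : ∃ k, e k < w) :
    n / κ ^ 2 * ∑ i ∈ Finset.range (n / 2), 1 / ((i : ℝ) + 1) ≤ ∑ k, 1 / (e k - w) ^ 2 := by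
  obtain ⟨k₀, hk₀⟩ := h1
  obtain ⟨k₁, hk₁⟩ := h2
  obtain ⟨j, hj, hjmax⟩ := Finset.exists_max_image (Finset.univ.filter fun k => w < e k) id
    ⟨k₀, by simpa using hk₀⟩
  simp only [Finset.mem_filter, Finset.mem_univ, true_and, id] at hj hjmax
  have hn : 0 < n := j.pos
  have hnR : (0 : ℝ) < n := by exact_mod_cast hn
  have hjk : j < k₁ := by
    by_contra hle
    exact (hk₁.trans hj).not_ge (he (not_lt.1 hle))
  have hj1 : (j : ℕ) + 1 < n := lt_of_le_of_lt hjk k₁.2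
  set j' : Fin n := ⟨j + 1, hj1⟩
  have hj' : e j' < w := by
    refine lt_of_le_of_ne (not_lt.1 fun hlt => ?_) (hne j')
    have := hjmax j' hlt
    rw [Fin.le_def] at this
    simp [j'] at this
  have hsq : ∀ (k m : Fin n) (i : ℕ), k ≤ m → ((m : ℕ) : ℝ) - ((k : ℕ) : ℝ) = i + 1 →
      ∀ d : ℝ, 0 < d → d ≤ e k - e m → n / κ ^ 2 * (1 / ((i : ℝ) + 1)) ≤ 1 / d ^ 2 := by
    intro k m i hkm him d hd hde
    have h3 := hde.trans ((le_abs_self _).trans (h k m hkm))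
    rw [abs_sub_comm, him, abs_of_pos (by positivity), ← Real.sqrt_eq_rpow] at h3
    have h4 := pow_le_pow_left₀ hd.le h3 2
    rw [mul_pow, Real.sq_sqrt (by positivity)] at h4
    rw [div_mul_div_comm, mul_one, div_le_div_iff₀ (by positivity) (by positivity)]
    calc (n : ℝ) * d ^ 2 ≤ n * (κ ^ 2 * (((i : ℝ) + 1) / n)) := by gcongr
      _ = 1 * (κ ^ 2 * ((i : ℝ) + 1)) := by field_simp
  have hembed : ∀ f : Fin (n / 2) → Fin n, Function.Injective f →
      (∀ i : Fin (n / 2), n / κ ^ 2 * (1 / (((i : ℕ) : ℝ) + 1)) ≤ 1 / (e (f i) - w) ^ 2) →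
      n / κ ^ 2 * ∑ i ∈ Finset.range (n / 2), 1 / ((i : ℝ) + 1) ≤ ∑ k, 1 / (e k - w) ^ 2 := by
    intro f hf hle
    rw [Finset.mul_sum, ← Fin.sum_univ_eq_sum_range
      (fun i => (n : ℝ) / κ ^ 2 * (1 / ((i : ℝ) + 1)))]
    refine (Finset.sum_le_sum fun i _ => hle i).trans ?_
    rw [← Finset.sum_image (f := fun k => 1 / (e k - w) ^ 2) (g := f) hf.injOn]
    exact Finset.sum_le_sum_of_subset_of_nonneg (Finset.subset_univ _) fun _ _ _ => by positivity
  rcases le_or_gt (n / 2) ((j : ℕ) + 1) with hcase | hcase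
  · refine hembed (fun i => ⟨j - i, by omega⟩) (fun i i' hii => ?_) fun i => ?_
    · have := i.2
      have := i'.2
      simp only [Fin.mk.injEq] at hii
      exact Fin.ext (by omega)
    · have hi := i.2
      set k : Fin n := ⟨j - i, by omega⟩
      have hkj : k ≤ j := by rw [Fin.le_def]; simp [k]
      have hek : w < e k := hj.trans_le (he hkj)
      refine hsq k j' i (by rw [Fin.le_def]; simp only [k, j']; omega) ?_ _ (sub_pos.2 hek)
        (by linarith)
      simp only [k, j']
      rw [Nat.cast_sub (by omega)]
      push_cast
      ring
  · refine hembed (fun i => ⟨j + 1 + i, by omega⟩) (fun i i' hii => ?_) fun i => ?_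
    · simp only [Fin.mk.injEq] at hii
      exact Fin.ext (by omega)
    · have hi := i.2
      set k : Fin n := ⟨j + 1 + i, by omega⟩
      have hkj : j' ≤ k := by rw [Fin.le_def]; simp [k, j']
      have hek : e k < w := (he hkj).trans_lt hj'
      rw [← neg_sub w, neg_sq]
      refine hsq j k i (by rw [Fin.le_def]; simp only [k]; omega) ?_ _ (sub_pos.2 hek)
        (by linarith)
      simp only [k]
      push_cast
      ring

end

/-! ### From eigenvalues to the matrix statements. -/

section

variable {M : ℕ} {c : ℝ} {R : Matrix (Fin M) (Fin M) ℂ}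

theorem le_eigenvalues {a : ℝ} (hR : R.IsHermitian)
    (h : (R - (a : ℂ) • (1 : Matrix (Fin M) (Fin M) ℂ)).PosSemidef) (i : Fin M) :
    a ≤ hR.eigenvalues i := by
  have h1 := h.re_dotProduct_nonneg (hR.eigenvectorBasis i : Fin M → ℂ)
  have h2 : star (hR.eigenvectorBasis i : Fin M → ℂ) ⬝ᵥ (hR.eigenvectorBasis i : Fin M → ℂ) = 1 := by
    rw [dotProduct_comm, ← EuclideanSpace.inner_eq_star_dotProduct, inner_self_eq_norm_sq_to_K,
      hR.eigenvectorBasis.orthonormal.1 i]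
    simp
  rw [Matrix.sub_mulVec, dotProduct_sub, hR.mulVec_eigenvectorBasis, Matrix.smul_mulVec,
    Matrix.one_mulVec, dotProduct_smul, dotProduct_smul, h2] at h1
  simp at h1
  exact h1

theorem isCanonicalSolution_iff (hc : 0 < c) (hR : R.IsHermitian) {z t : ℂ} (hz : 0 < z.im) :
    IsCanonicalSolution R c z t ↔ IsScalarSol hR.eigenvalues c z t := by
  unfold IsCanonicalSolution IsScalarSol
  refine and_congr_right fun ht => and_congr_right fun hzt => ?_
  rw [(ntr_resolventT hc hR hz ht hzt).1]

/-- Existence guarantees that `mu` is not the default zero measure. -/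
theorem isMu_mu (hM : 0 < M) (hc : 0 < c) (hR : R.IsHermitian) (hl : ∀ k, 0 < hR.eigenvalues k) :
    IsMu R c (mu R c) := by
  have hex : ∃ μ : Measure ℝ, IsMu R c μ := by
    obtain ⟨μ, ν, h1, h2, -, -, h3⟩ := exists_scalar_measures hM hc hl
    exact ⟨μ, h1, h2, fun z hz => (isCanonicalSolution_iff hc hR hz).2 (h3 z hz).1⟩
  rw [mu, dif_pos hex]
  exact hex.choose_spec

/-- `nu` is defined through the chosen `mu`; uniqueness of the canonical solution identifies its
transform with that of the constructed μ. -/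
theorem isNu_nu (hM : 0 < M) (hc : 0 < c) (hR : R.IsHermitian) (hl : ∀ k, 0 < hR.eigenvalues k) :
    IsNu R c (nu R c) := by
  have hex : ∃ ν : Measure ℝ, IsNu R c ν := by
    obtain ⟨μ, ν, -, -, h1, h2, h3⟩ := exists_scalar_measures hM hc hl
    refine ⟨ν, h1, h2, fun z hz => ?_⟩
    have h4 := (isMu_mu hM hc hR hl).2.2 z hz
    have h5 := ((isCanonicalSolution_iff hc hR hz).1 h4).unique hM hc hl hz (h3 z hz).1
    rw [tfun, (ntr_resolventT hc hR hz h4.1 h4.2.1).2, (h3 z hz).2, h5]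
  rw [nu, dif_pos hex]
  exact hex.choose_spec

theorem rtr_eq (hR : R.IsHermitian) {w : ℝ} (h : ∀ k, hR.eigenvalues k ≠ w) :
    rtr R w = A1 hR.eigenvalues w := by
  have e : R - (w : ℂ) • (1 : Matrix (Fin M) (Fin M) ℂ) =
      (-(w : ℂ)) • (1 : Matrix (Fin M) (Fin M) ℂ) + (1 : ℂ) • R := by
    rw [neg_smul, one_smul]; abel
  have hne : ∀ k, -(w : ℂ) + 1 * hR.eigenvalues k ≠ 0 := fun k => by
    rw [one_mul, neg_add_eq_sub, ← Complex.ofReal_sub, Complex.ofReal_ne_zero]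
    exact sub_ne_zero.2 (h k)
  have e2 : (1 / (M : ℂ)) * ∑ k, hR.eigenvalues k * (1 / (-(w : ℂ) + 1 * hR.eigenvalues k)) =
      (A1 hR.eigenvalues w : ℂ) := by
    rw [← cf_ofReal, cf]
    congr 1
    refine Finset.sum_congr rfl fun k _ => ?_
    rw [one_mul, neg_add_eq_sub, mul_one_div]
  rw [rtr, e, ntr_mul_inv hR _ _ hne, e2, Complex.ofReal_re]

theorem phi_eq (hR : R.IsHermitian) {w : ℝ} (h : ∀ k, hR.eigenvalues k ≠ w) :
    phi R c w = rphi hR.eigenvalues c w := by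
  rw [phi, rtr_eq hR h, rphi]

theorem deriv_phi (hR : R.IsHermitian) {w : ℝ} (h : ∀ k, hR.eigenvalues k ≠ w) :
    deriv (phi R c) w = dphi hR.eigenvalues c w := by
  have e : phi R c =ᶠ[𝓝 w] rphi hR.eigenvalues c := by
    have : ∀ᶠ v in 𝓝 w, ∀ k, hR.eigenvalues k ≠ v := Filter.eventually_all.2 fun k =>
      (eventually_ne_nhds (h k).symm).mono fun v hv => Ne.symm hv
    filter_upwards [this] with v hv using phi_eq hR hv
  rw [e.deriv_eq, (hasDerivAt_rphi h).deriv]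

theorem eigenvalues₀_lt_iff (hR : R.IsHermitian) {w : ℝ} :
    (∀ k, hR.eigenvalues₀ k < w) ↔ ∀ k, hR.eigenvalues k < w :=
  ⟨fun h _ => h _, fun h k => by
    have := h ((Fintype.equivOfCardEq (Fintype.card_fin _)) k)
    simpa [Matrix.IsHermitian.eigenvalues] using this⟩

/-- The supports for a single matrix whose eigenvalues satisfy the spacing consequence
`OutsideOnly`. -/
theorem support_of_outsideOnly (hM : 0 < M) (hc : 0 < c) (hR : R.IsHermitian)
    (hl : ∀ k, 0 < hR.eigenvalues k) (hout : OutsideOnly hR.eigenvalues c) :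
    ∃ xplus : ℝ, IsXPlus hR c xplus ∧
      (c ≤ 1 → (mu R c).support = Set.Icc 0 xplus ∧ (nu R c).support = Set.Icc 0 xplus) ∧
      (1 < c → ∃ xminus : ℝ, IsXMinus R c xminus ∧ 0 < xminus ∧ xminus < xplus ∧
        (mu R c).support = {0} ∪ Set.Icc xminus xplus ∧
        (nu R c).support = {0} ∪ Set.Icc xminus xplus) := by
  obtain ⟨hμ1, hμ2, hμ3⟩ := isMu_mu hM hc hR hl
  obtain ⟨hν1, hν2, hν3⟩ := isNu_nu hM hc hR hl
  have hsol : ∀ z : ℂ, 0 < z.im → IsScalarSol hR.eigenvalues c z (stieltjes (mu R c) z) :=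
    fun z hz => (isCanonicalSolution_iff hc hR hz).1 (hμ3 z hz)
  have hWμ := wRep_mu hM hc hl hsol
  have hWν := wRep_nu hM hc hl (ν := nu R c) hsol fun z hz => by
    rw [hν3 z hz, tfun, (ntr_resolventT hc hR hz (hμ3 z hz).1 (hμ3 z hz).2.1).2]
  obtain ⟨wp, hwp, hwp2, hwp3⟩ := exists_wplus hM hc hl
  have hxp := (sq_lt_rphi_right hM hc hl hwp).1
  have hxp0 : 0 < rphi hR.eigenvalues c wp := lt_of_le_of_lt (sq_nonneg _) hxp
  refine ⟨rphi hR.eigenvalues c wp, ⟨wp, ⟨(eigenvalues₀_lt_iff hR).2 hwp, ?_⟩, ?_, ?_⟩,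
    fun hc1 => ⟨?_, ?_⟩, fun hc1 => ?_⟩
  · rw [deriv_phi hR fun k => (hwp k).ne]
    exact (hwp2 wp hwp).1.2 rfl
  · rintro w ⟨hw, hd⟩
    rw [eigenvalues₀_lt_iff] at hw
    rw [deriv_phi hR fun k => (hw k).ne] at hd
    exact (hwp2 w hw).1.1 hd
  · rw [phi_eq hR fun k => (hwp k).ne]
  · exact hWμ.support_eq_of_le_one hM hc hc1 hl hout hμ2 hxp0 (fun w hw => (hwp2 w hw).2) hwp3
  · exact hWν.support_eq_of_le_one hM hc hc1 hl hout hν2 hxp0 (fun w hw => (hwp2 w hw).2) hwp3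
  · obtain ⟨ω, wm, hω, hωlt, hωm, hm0, hm1, hm2, hm3, hm4, hm5⟩ := exists_wminus hM hc1 hl
    have hne : ∀ {w : ℝ}, w < 0 → ∀ k, hR.eigenvalues k ≠ w := fun h k => (h.trans (hl k)).ne'
    have hleast : IsLeast {v : ℝ | rtr R v = 1 / c} ω := by
      refine ⟨?_, fun v hv => not_lt.1 fun hlt => ?_⟩
      · change rtr R ω = 1 / c
        rw [rtr_eq hR (hne (hωm.trans hm0)), hω]
      · change rtr R v = 1 / c at hv
        rw [rtr_eq hR (hne (hlt.trans (hωm.trans hm0)))] at hv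
        exact (hωlt v hlt).ne hv
    refine ⟨rphi hR.eigenvalues c wm, ⟨wm, ⟨⟨ω, hleast, hωm⟩, hm0, ?_⟩, ?_, ?_⟩, hm3,
      hm4.trans hxp, ?_, ?_⟩
    · rw [deriv_phi hR (hne hm0)]
      exact (hm1 wm hm0).2 rfl
    · rintro w ⟨-, hw, hd⟩
      rw [deriv_phi hR (hne hw)] at hd
      exact (hm1 w hw).1 hd
    · rw [phi_eq hR (hne hm0)]
    · exact hWμ.support_eq_of_one_lt hM hc1 hl hout hμ2 (zero_mem_support_mu hM hc1 hl hout hWμ)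
        hm3 (hm4.trans hxp) (fun w hw => (hwp2 w hw).2) hwp3 hm2 hm5
    · exact hWν.support_eq_of_one_lt hM hc1 hl hout hν2 (zero_mem_support_nu hM hc1 hl hWν)
        hm3 (hm4.trans hxp) (fun w hw => (hwp2 w hw).2) hwp3 hm2 hm5

/-- Between two eigenvalues, `l ≥ a` and the harmonic bound of `sum_inv_sq_ge` make `c A2 > 1`. -/
theorem outsideOnly_of_spacing (hM : 0 < M) (hc : 0 < c) (hR : R.IsHermitian) {a κ : ℝ}
    (ha : 0 < a) (hal : ∀ k, a ≤ hR.eigenvalues k) (hκ : 0 < κ)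
    (h : ∀ k m : Fin (Fintype.card (Fin M)), k ≤ m →
      |hR.eigenvalues₀ k - hR.eigenvalues₀ m|
        ≤ κ * (|((k : ℕ) : ℝ) - ((m : ℕ) : ℝ)| / (M : ℝ)) ^ (1 / 2 : ℝ))
    (hbig : 1 < c * (a ^ 2 / κ ^ 2 * ∑ i ∈ Finset.range (M / 2), 1 / ((i : ℝ) + 1))) :
    OutsideOnly hR.eigenvalues c := by
  intro w hne hA
  by_contra hcon
  push Not at hcon
  obtain ⟨⟨k₁, hk₁⟩, k₀, hk₀⟩ := hcon
  have hMR : (0 : ℝ) < M := by exact_mod_cast hM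
  set E := Fintype.equivOfCardEq (Fintype.card_fin (Fintype.card (Fin M)))
  have hE : ∀ k, hR.eigenvalues k = hR.eigenvalues₀ (E.symm k) := fun k => rfl
  have hne0 : ∀ k, hR.eigenvalues₀ k ≠ w := fun k => by
    have := hne (E k)
    rwa [hE, E.symm_apply_apply] at this
  have hsum := sum_inv_sq_ge hR.eigenvalues₀_antitone hκ (w := w)
    (by simpa only [Fintype.card_fin] using h) hne0
    ⟨E.symm k₀, lt_of_le_of_ne hk₀ (hne k₀).symm⟩ ⟨E.symm k₁, lt_of_le_of_ne hk₁ (hne k₁)⟩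
  have hsum2 : ∑ k, 1 / (hR.eigenvalues₀ k - w) ^ 2 = ∑ k, 1 / (hR.eigenvalues k - w) ^ 2 := by
    simp_rw [hE]
    exact (Equiv.sum_comp E.symm fun k => 1 / (hR.eigenvalues₀ k - w) ^ 2).symm
  rw [hsum2, Fintype.card_fin] at hsum
  have h1 : a ^ 2 / κ ^ 2 * ∑ i ∈ Finset.range (M / 2), 1 / ((i : ℝ) + 1) ≤
      A2 hR.eigenvalues w := by
    calc a ^ 2 / κ ^ 2 * ∑ i ∈ Finset.range (M / 2), 1 / ((i : ℝ) + 1)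
        = (1 / M) * (a ^ 2 * (M / κ ^ 2 * ∑ i ∈ Finset.range (M / 2), 1 / ((i : ℝ) + 1))) := by
          field_simp
      _ ≤ (1 / M) * (a ^ 2 * ∑ k, 1 / (hR.eigenvalues k - w) ^ 2) := by gcongr
      _ ≤ A2 hR.eigenvalues w := by
          rw [A2, Finset.mul_sum]
          refine avg_le_avg fun k => ?_
          rw [div_pow, mul_one_div]
          have := hal k
          gcongr
  have h2 := mul_le_mul_of_nonneg_left h1 hc.le
  linarith

end

end AutocovSupport
end

/-! ### Large `N`. -/

theorem mainTheorem10
    (L : ℕ) (M : ℕ → ℕ) (c : ℕ → ℝ) (cstar a b : ℝ)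
    (R : (N : ℕ) → Matrix (Fin (M N)) (Fin (M N)) ℂ)
    (hc : ∀ N : ℕ, c N = ((M N : ℝ) * (L : ℝ)) / (N : ℝ))
    (hcstar : 0 < cstar) (hlim : Tendsto c atTop (𝓝 cstar))
    (ha : 0 < a) (hb : 0 < b)
    (hherm : ∀ N : ℕ, (R N).IsHermitian)
    (hlow : ∀ N : ℕ, 1 ≤ N →
      (R N - (a : ℂ) • (1 : Matrix (Fin (M N)) (Fin (M N)) ℂ)).PosSemidef)
    (hupp : ∀ N : ℕ, 1 ≤ N →
      ((b : ℂ) • (1 : Matrix (Fin (M N)) (Fin (M N)) ℂ) - R N).PosDef)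
    (hcond : ∃ κ : ℝ, 0 < κ ∧ ∀ᶠ N : ℕ in atTop,
      ∀ k l : Fin (Fintype.card (Fin (M N))), k ≤ l →
        |(hherm N).eigenvalues₀ k - (hherm N).eigenvalues₀ l|
          ≤ κ * (|((k : ℕ) : ℝ) - ((l : ℕ) : ℝ)| / (M N : ℝ)) ^ (1 / 2 : ℝ)) :
    ∀ᶠ N : ℕ in atTop,
      ∃ xplus : ℝ, AutocovSupport.IsXPlus (hherm N) (c N) xplus ∧
        (c N ≤ 1 →
          (AutocovSupport.mu (R N) (c N)).support = Set.Icc 0 xplus ∧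
          (AutocovSupport.nu (R N) (c N)).support = Set.Icc 0 xplus) ∧
        (1 < c N →
          ∃ xminus : ℝ, AutocovSupport.IsXMinus (R N) (c N) xminus ∧
            0 < xminus ∧ xminus < xplus ∧
            (AutocovSupport.mu (R N) (c N)).support = {0} ∪ Set.Icc xminus xplus ∧
            (AutocovSupport.nu (R N) (c N)).support = {0} ∪ Set.Icc xminus xplus) := by
  obtain ⟨κ, hκ, hcond⟩ := hcond
  have hcN : ∀ᶠ N in atTop, cstar / 2 < c N := hlim.eventually_const_lt (half_lt_self hcstar)
  -- `L = 0` would make `c` vanish identically, against its positive limit; then `M = c N / L` tends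
  -- to infinity.
  have hL : (0 : ℝ) < L := by
    rcases Nat.eq_zero_or_pos L with rfl | h
    · obtain ⟨N, hN⟩ := hcN.exists
      rw [hc] at hN
      simp at hN
      linarith
    · exact_mod_cast h
  have hMtop : Tendsto M atTop atTop := by
    rw [← tendsto_natCast_atTop_iff (R := ℝ)]
    refine (tendsto_mul_const_atTop_of_pos hL).1 (tendsto_atTop_mono' _ ?_
      (tendsto_natCast_atTop_atTop.const_mul_atTop (half_pos hcstar)))
    filter_upwards [hcN, eventually_ge_atTop 1] with N hN hN1
    have hN0 : (0 : ℝ) < N := by exact_mod_cast hN1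
    rw [hc, lt_div_iff₀ hN0] at hN
    exact hN.le
  have hhalf : Tendsto (fun N => M N / 2) atTop atTop :=
    (Nat.tendsto_div_const_atTop two_ne_zero).comp hMtop
  have hharm := Real.tendsto_sum_range_one_div_nat_succ_atTop.comp hhalf
  filter_upwards [hcN, eventually_ge_atTop 1, hcond, hMtop.eventually_gt_atTop 0,
    -- The threshold for the harmonic sum is the one that makes `(cstar/2) (a²/κ²)` times it exceed
    -- `1`.
    hharm.eventually_gt_atTop (κ ^ 2 / a ^ 2 * (2 / cstar))] with N hN hN1 hsp hM hH
  have hc0 : 0 < c N := (half_pos hcstar).trans hN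
  have hal := AutocovSupport.le_eigenvalues (hherm N) (hlow N hN1)
  refine AutocovSupport.support_of_outsideOnly hM hc0 (hherm N) (fun k => ha.trans_le (hal k))
    (AutocovSupport.outsideOnly_of_spacing hM hc0 (hherm N) ha hal hκ hsp ?_)
  simp only [Function.comp_def] at hH
  calc (1 : ℝ) = cstar / 2 * (a ^ 2 / κ ^ 2 * (κ ^ 2 / a ^ 2 * (2 / cstar))) := by field_simp
    _ < cstar / 2 * (a ^ 2 / κ ^ 2 *
        ∑ i ∈ Finset.range (M N / 2), 1 / ((i : ℝ) + 1)) := by gcongr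
    _ ≤ _ := by
      refine mul_le_mul_of_nonneg_right hN.le ?_
      exact mul_nonneg (by positivity) (Finset.sum_nonneg fun i _ => by positivity)
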